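/- For each $N\in\mathbb N$ let $d_1=d_1(N)$, $d_2=d_2(N)$, $p=p(N)$ be natural numbers and let $G_1,\dots,G_{d_1}$ be random $d_2\times p$ real matrices, all of whose entries are independent standard real Gaussian variables. Let $$W=W_N=\frac{1}{d_1d_2}\bigl(G_iG_j^{\mathrm T}\bigr)_{i,j=1}^{d_1}$$ be the corresponding $d_1d_2\times d_1d_2$ real Wishart matrix, written as a $d_1\times d_1$ block matrix with $d_2\times d_2$ blocks, and let $W^\Gamma$ be its partial transpose, obtained by transposing each block. Suppose that $p/(d_1d_2)\to c$ as $N\to\infty$, where $0<c<\infty$. A sequence $X_N$ of random $d_1d_2\times d_1d_2$ matrices is said to have an asymptotic distribution with moments $(m_k)_{k\ge0}$ if for every $k\ge 0$ the expectations $\mathrm E\bigl[\tfrac1{d_1d_2}\mathrm{Tr}(X_N^k)\bigr]$ exist and converge to $m_k$. The Marchenko–Pastur law with parameter $\lambda\ge0$ is the measure with density $\frac{\sqrt{(b-t)(t-a)}}{2\pi t}$ on $[a,b]$, where $a=(1-\sqrt\lambda)^2$ and $b=(1+\sqrt\lambda)^2$, plus an atom of weight $1-\lambda$ at $0$ if $\lambda<1$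 (for $\lambda=0$ it is $\delta_0$). (1) If $d_1\to\infty$ and $d_2\to\infty$, then the asymptotic distribution of $W^\Gamma$ is the shifted semicircle law with mean $c$ and variance $c$, i.e. with density $\frac1{2\pi c}\sqrt{4c-(t-c)^2}$ on $[c-2\sqrt c,\,c+2\sqrt c]$; its free cumulants are $\kappa_1=\kappa_2=c$ and $\kappa_n=0$ for $n\ge3$. (2) If $d_1\to\infty$ and $d_2\ge2$ is fixed, then $d_2W^\Gamma$ has an asymptotic distribution, and it is the distribution of the difference $x-y$ of two free self-adjoint elements $x,y$ of a $*$-probability space, where $x$ and $y$ have Marchenko–Pastur laws with parameters $c\,d_2\frac{d_2+1}{2}$ and $c\,d_2\frac{d_2-1}{2}$, respectively. (3) If $d_1\ge1$ is fixed and $d_2\to\infty$, then $d_1W^\Gamma$ has an asymptotic distribution, and it is the distribution of the difference $x-y$ of two free self-adjoint elements $x,y$ of a $*$-probability space, where $x$ and $y$ have Marchenko–Pastur laws with parameters $c\,d_1\frac{d_1+1}{2}$ and $c\,d_1\frac{d_1-1}{2}$, respectively. -/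

import Mathlib

open MeasureTheory ProbabilityTheory Filter Topology

noncomputable section

/-! ### Real Wishart matrices in block form and their partial transposes -/

/-- All entries of the random `d₂ × p` matrices `G₁, …, G_{d₁}` are independent standard real
Gaussian random variables. -/
structure IsStandardGaussianBlocks {Ω : Type*} [MeasurableSpace Ω] (P : Measure Ω)
    {d₁ d₂ p : ℕ} (G : Ω → Fin d₁ → Matrix (Fin d₂) (Fin p) ℝ) : Prop where
  law : ∀ i j k, HasLaw (fun ω => G ω i j k) (gaussianReal 0 1) P
  indep : iIndepFun
    (fun (t : Fin d₁ × Fin d₂ × Fin p) (ω : Ω) => G ω t.1 t.2.1 t.2.2) P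

/-- The Wishart matrix `W = (d₁ d₂)⁻¹ (G_i G_jᵀ)_{ij}`, a `d₁ × d₁` block matrix whose blocks have
size `d₂ × d₂`; the index `(i, s)` is the `s`-th row (or column) of the `i`-th block. -/
def wishart {d₁ d₂ p : ℕ} (G : Fin d₁ → Matrix (Fin d₂) (Fin p) ℝ) :
    Matrix (Fin d₁ × Fin d₂) (Fin d₁ × Fin d₂) ℝ :=
  Matrix.of fun x y => ((d₁ : ℝ) * (d₂ : ℝ))⁻¹ * (G x.1 * (G y.1).transpose) x.2 y.2

/-- The (right) partial transpose: each `d₂ × d₂` block is replaced by its transpose. -/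
def partialTranspose {d₁ d₂ : ℕ} (M : Matrix (Fin d₁ × Fin d₂) (Fin d₁ × Fin d₂) ℝ) :
    Matrix (Fin d₁ × Fin d₂) (Fin d₁ × Fin d₂) ℝ :=
  Matrix.of fun x y => M (x.1, y.2) (y.1, x.2)

/-- The normalized trace `tr ⊗ tr`. -/
def normalizedTrace {d₁ d₂ : ℕ} (M : Matrix (Fin d₁ × Fin d₂) (Fin d₁ × Fin d₂) ℝ) : ℝ :=
  M.trace / ((d₁ : ℝ) * (d₂ : ℝ))

/-- Convergence in distribution, in the sense of noncommutative probability, of a sequence of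
random matrices: all expected normalized trace moments exist, and the `k`-th one converges to
`m k`. -/
def HasAsymptoticMoments {Ω : ℕ → Type*} [∀ N, MeasurableSpace (Ω N)]
    (P : ∀ N, Measure (Ω N)) {d₁ d₂ : ℕ → ℕ}
    (X : ∀ N, Ω N → Matrix (Fin (d₁ N) × Fin (d₂ N)) (Fin (d₁ N) × Fin (d₂ N)) ℝ)
    (m : ℕ → ℝ) : Prop :=
  ∀ k : ℕ, (∀ N, Integrable (fun ω => normalizedTrace (X N ω ^ k)) (P N)) ∧
    Tendsto (fun N => ∫ ω, normalizedTrace (X N ω ^ k) ∂(P N)) atTop (𝓝 (m k))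

/-! ### The limit laws -/

/-- The semicircle law with mean `a` and variance `v > 0`. -/
def semicircleLaw (a v : ℝ) : Measure ℝ :=
  (volume.restrict (Set.Icc (a - 2 * √v) (a + 2 * √v))).withDensity
    fun t => ENNReal.ofReal (√(4 * v - (t - a) ^ 2) / (2 * Real.pi * v))

/-- The Marchenko–Pastur law with parameter `c ≥ 0` (all of whose free cumulants are `c`); for
`c = 0` it is the point mass at `0`. -/
def marchenkoPastur (c : ℝ) : Measure ℝ :=
  ENNReal.ofReal (1 - c) • Measure.dirac 0 +
    (volume.restrict (Set.Icc ((1 - √c) ^ 2) ((1 + √c) ^ 2))).withDensity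
      fun t => ENNReal.ofReal
        (√(((1 + √c) ^ 2 - t) * (t - (1 - √c) ^ 2)) / (2 * Real.pi * t))

/-! ### Free cumulants -/

/-- A partition of `{0, …, n - 1}` is non-crossing if there are no `i < j < k < l` with `i, k` in
one block and `j, l` in another one. -/
def IsNoncrossing {n : ℕ} (π : Finpartition (Finset.univ : Finset (Fin n))) : Prop :=
  ∀ B ∈ π.parts, ∀ C ∈ π.parts, ∀ i j k l : Fin n,
    i < j → j < k → k < l → i ∈ B → k ∈ B → j ∈ C → l ∈ C → B = C

open Classical in
/-- `κ 1, κ 2, …` are the free cumulants of the distribution with moments `m 0, m 1, …`, that is,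
the moment-cumulant formula `m n = ∑_{π ∈ NC(n)} ∏_{B ∈ π} κ |B|` holds for all `n`. -/
def IsFreeCumulants (m κ : ℕ → ℝ) : Prop :=
  ∀ n : ℕ, m n = ∑ π : Finpartition (Finset.univ : Finset (Fin n)) with IsNoncrossing π,
    ∏ B ∈ π.parts, κ B.card

/-! ### Free random variables -/

/-- A state on a unital `*`-algebra. -/
def IsState {A : Type*} [Ring A] [StarRing A] [Algebra ℂ A] (φ : A →ₗ[ℂ] ℂ) : Prop :=
  φ 1 = 1 ∧ ∀ a : A, ∃ r : ℝ, 0 ≤ r ∧ φ (star a * a) = (r : ℂ)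

/-- Freeness of a family of unital subalgebras: alternating products of centred elements are
centred. -/
def IsFree {A : Type*} [Ring A] [Algebra ℂ A] (φ : A →ₗ[ℂ] ℂ) {ι : Type*}
    (B : ι → Subalgebra ℂ A) : Prop :=
  ∀ (n : ℕ) (i : Fin (n + 1) → ι) (a : Fin (n + 1) → A),
    (∀ k : Fin n, i k.castSucc ≠ i k.succ) → (∀ k, a k ∈ B (i k)) → (∀ k, φ (a k) = 0) →
      φ (List.ofFn a).prod = 0

/-- Two self-adjoint elements are free if the unital algebras that they generate are free. -/
def AreFree {A : Type*} [Ring A] [Algebra ℂ A] (φ : A →ₗ[ℂ] ℂ) (x y : A) : Prop :=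
  IsFree φ (fun b : Bool => Algebra.adjoin ℂ {if b then x else y})

/-- The element `x` has distribution `μ` with respect to `φ`. -/
def HasDistribution {A : Type*} [Ring A] [Algebra ℂ A] (φ : A →ₗ[ℂ] ℂ) (x : A)
    (μ : Measure ℝ) : Prop :=
  ∀ k : ℕ, Integrable (fun t : ℝ => t ^ k) μ ∧ φ (x ^ k) = ((∫ t, t ^ k ∂μ : ℝ) : ℂ)

/-- `m` is the moment sequence of the difference `x - y` of two free self-adjoint elements `x`, `y`
of a `*`-probability space, where `x` has distribution `μ` and `y` has distribution `ν`. -/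
def IsFreeDifferenceMoments (μ ν : Measure ℝ) (m : ℕ → ℝ) : Prop :=
  ∃ (A : Type) (_ : Ring A) (_ : StarRing A) (_ : Algebra ℂ A) (_ : StarModule ℂ A)
    (φ : A →ₗ[ℂ] ℂ) (x y : A),
    IsState φ ∧ IsSelfAdjoint x ∧ IsSelfAdjoint y ∧ AreFree φ x y ∧
      HasDistribution φ x μ ∧ HasDistribution φ y ν ∧
      ∀ k : ℕ, φ ((x - y) ^ k) = (m k : ℂ)

end

/-! Let `B_s` be the `d₁ × p` matrix whose `i`-th row is the `s`-th row of `G_i`. Up to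
normalisation, `W^Γ` is a `d₂ × d₂` array of `d₁ × d₁` blocks with `(a, b)` block `B_b B_aᵀ`, so its
moments are sums, over closed paths, of expected traces of words in such letters.

Right factor fixed, `d₂ = D`. Gaussian integration by parts gives a loop equation for products of
traces (`gaussianExpect_wordTraces_cons`). As `d₁ → ∞`, terms that reverse a subword or merge two
traces lose one or two powers of `d₁`. What remains factorises into a closed recursion for single
words. Summed over paths (`pathSum_limitMoment_aux`), it becomes, with `*` the shifted convolution
and `γ = c D`, `α = γ m + β * m`, `β = α * m`, `m (n + 1) = α n + D β n`. The combinations `α ± β`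
decouple with signs `±1`, and `α + D β = (D + 1)/2 (α + β) - (D - 1)/2 (α - β)`. These are the
equations for the moments of a difference of free Poisson elements of rates `γ (D ± 1)/2`. Such
elements are realised as `(ℓ_b + r)(ℓ_b + r)*` on a full Fock space. Right creation commutes with
them up to rank one, which yields their recursions, and centred elements send suitable vectors into
the range of `ℓ_b`, which yields freeness.

Left factor fixed. By Wick's formula an expected trace is a sum of monomials in `d₁`, `d₂`, `p`, and
the sum is symmetric in `d₁`, `d₂` (`exists_exponents`). This reduces the case to the previous one.

Both factors growing. All Wick terms are nonnegative, so convergence in the case of one dimension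
equal to `1` bounds every exponent. The normalised moment is therefore a polynomial in `p/(d₁ d₂)`,
`1/d₁`, `1/d₂`, and the joint limit equals the iterated one, `d₁ → ∞` and then `D → ∞`. After
rescaling, the feedback of `β` into `α` is of order `D⁻²`, and the recursion becomes that of the
semicircle law.

The limit laws are identified by moments. Semicircle moments are Catalan numbers, `t` times the
Marchenko–Pastur density is a multiple of a semicircle density, and an explicit antiderivative gives
the total mass. The free cumulants follow because non-crossing partitions into blocks of size one
and two, decomposed by the block of the least element, obey the semicircle recursion. -/

noncomputable section


/-! ### Expectations of polynomials in independent standard Gaussian variables -/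

/-- The `k`-th moment of the standard Gaussian law. -/
def gaussianMoment (k : ℕ) : ℝ := ∫ x, x ^ k ∂(gaussianReal 0 1)

lemma integrable_pow_gaussianReal (k : ℕ) : Integrable (fun x : ℝ => x ^ k) (gaussianReal 0 1) := by
  rcases Nat.eq_zero_or_pos k with rfl | hk
  · simp
  · have h := (memLp_id_gaussianReal (μ := 0) (v := 1) (k : NNReal)).integrable_norm_pow hk.ne'
    refine (integrable_norm_iff (by fun_prop)).1 ?_
    simpa using h

lemma integrable_pow_mul_gaussianPDFReal (k : ℕ) :
    Integrable (fun x : ℝ => x ^ k * gaussianPDFReal 0 1 x) := by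
  have h := integrable_pow_gaussianReal k
  rw [gaussianReal_of_var_ne_zero _ one_ne_zero,
    integrable_withDensity_iff_integrable_smul' (measurable_gaussianPDF _ _)
      (ae_of_all _ fun _ => gaussianPDF_lt_top)] at h
  refine h.congr (ae_of_all _ fun x => ?_)
  simp [mul_comm]

lemma gaussianMoment_zero : gaussianMoment 0 = 1 := by
  simp [gaussianMoment]

lemma gaussianMoment_one : gaussianMoment 1 = 0 := by
  simp [gaussianMoment]

lemma hasDerivAt_gaussianPDFReal_standard (x : ℝ) :
    HasDerivAt (gaussianPDFReal 0 1) (-(x * gaussianPDFReal 0 1 x)) x := by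
  have h : HasDerivAt (fun y : ℝ => -(y - 0) ^ 2 / (2 * ((1 : NNReal) : ℝ))) (-x) x := by
    have := (((hasDerivAt_id x).sub_const 0).pow 2).neg.div_const (2 * ((1 : NNReal) : ℝ))
    refine this.congr_deriv ?_
    simp only [id, NNReal.coe_one]
    push_cast
    ring
  have h2 := (h.exp).const_mul (√(2 * Real.pi * ((1 : NNReal) : ℝ)))⁻¹
  refine h2.congr_deriv ?_
  simp only [gaussianPDFReal]
  ring

/-- Integration by parts: the derivative of the Gaussian density is `-x` times the density. -/
lemma gaussianMoment_add_two (k : ℕ) :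
    gaussianMoment (k + 2) = (k + 1) * gaussianMoment k := by
  have h := integral_mul_deriv_eq_deriv_mul_of_integrable
    (u := fun x : ℝ => x ^ (k + 1)) (u' := fun x : ℝ => (k + 1 : ℝ) * x ^ k)
    (v := gaussianPDFReal 0 1) (v' := fun x => -(x * gaussianPDFReal 0 1 x))
    (fun x _ => by simpa using hasDerivAt_pow (k + 1) x)
    (fun x _ => hasDerivAt_gaussianPDFReal_standard x)
    (((integrable_pow_mul_gaussianPDFReal (k + 2)).neg).congr
      (ae_of_all _ fun x => by simp; ring))
    (((integrable_pow_mul_gaussianPDFReal k).const_mul (k + 1 : ℝ)).congr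
      (ae_of_all _ fun x => by simp; ring))
    (integrable_pow_mul_gaussianPDFReal (k + 1))
  simp only [gaussianMoment, integral_gaussianReal_eq_integral_smul one_ne_zero, smul_eq_mul]
  rw [← integral_const_mul]
  have h1 : ∫ x : ℝ, gaussianPDFReal 0 1 x * x ^ (k + 2)
      = -∫ x : ℝ, x ^ (k + 1) * -(x * gaussianPDFReal 0 1 x) := by
    rw [← integral_neg]
    congr 1; ext x; ring
  rw [h1, h, neg_neg]
  congr 1; ext x; ring

section

variable {σ : Type*} [Fintype σ]

/-- The expectation of a polynomial in independent standard Gaussian variables. -/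
def gaussianExpect (σ : Type*) [Fintype σ] : MvPolynomial σ ℝ →ₗ[ℝ] ℝ :=
  (MvPolynomial.basisMonomials σ ℝ).constr ℝ fun m => ∏ i, gaussianMoment (m i)

lemma gaussianExpect_monomial (m : σ →₀ ℕ) (a : ℝ) :
    gaussianExpect σ (MvPolynomial.monomial m a) = a * ∏ i, gaussianMoment (m i) := by
  have h : MvPolynomial.monomial m a = a • MvPolynomial.basisMonomials σ ℝ m := by
    rw [MvPolynomial.coe_basisMonomials, MvPolynomial.smul_monomial, smul_eq_mul, mul_one]
  rw [h, map_smul, gaussianExpect, Module.Basis.constr_basis, smul_eq_mul]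

lemma gaussianExpect_one : gaussianExpect σ 1 = 1 := by
  have := gaussianExpect_monomial (0 : σ →₀ ℕ) 1
  simpa [gaussianMoment_zero] using this

/-- Gaussian integration by parts. -/
lemma gaussianExpect_X_mul [DecidableEq σ] (a : σ) (f : MvPolynomial σ ℝ) :
    gaussianExpect σ (MvPolynomial.X a * f) = gaussianExpect σ (MvPolynomial.pderiv a f) := by
  induction f using MvPolynomial.induction_on' with
  | add p q hp hq => rw [mul_add, map_add, hp, hq, map_add, map_add]
  | monomial m c =>
    rw [MvPolynomial.pderiv_monomial, MvPolynomial.X, MvPolynomial.monomial_mul,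
      gaussianExpect_monomial, gaussianExpect_monomial]
    rw [Fintype.prod_eq_mul_prod_compl a, Fintype.prod_eq_mul_prod_compl a]
    have h1 : ∏ i ∈ {a}ᶜ, gaussianMoment ((Finsupp.single a 1 + m : σ →₀ ℕ) i)
        = ∏ i ∈ {a}ᶜ, gaussianMoment (m i) := by
      refine Finset.prod_congr rfl fun i hi => ?_
      have : a ≠ i := fun h => by simp [h] at hi
      simp [this]
    have h2 : ∏ i ∈ {a}ᶜ, gaussianMoment ((m - Finsupp.single a 1 : σ →₀ ℕ) i)
        = ∏ i ∈ {a}ᶜ, gaussianMoment (m i) := by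
      refine Finset.prod_congr rfl fun i hi => ?_
      have : a ≠ i := fun h => by simp [h] at hi
      simp [this]
    rw [h1, h2]
    simp only [Finsupp.add_apply, Finsupp.single_eq_same, Finsupp.coe_tsub, Pi.sub_apply]
    -- Only the exponent of `a` differs between the two sides: exponent zero meets the vanishing
    -- first moment, any other the moment recurrence.
    rcases hm : m a with _ | k
    · simp [gaussianMoment_one]
    · rw [show 1 + (k + 1) = k + 2 by ring, gaussianMoment_add_two]
      simp
      ring

variable {Ω : Type*} [MeasurableSpace Ω] {P : Measure Ω} {g : σ → Ω → ℝ}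

lemma integrable_prod_pow_of_hasLaw (hlaw : ∀ i, HasLaw (g i) (gaussianReal 0 1) P)
    (hind : iIndepFun g P) (m : σ →₀ ℕ) : Integrable (fun ω => ∏ i, g i ω ^ m i) P ∧
      ∫ ω, ∏ i, g i ω ^ m i ∂P = ∏ i, gaussianMoment (m i) := by
  have := hind.isProbabilityMeasure
  have hae : ∀ i, AEMeasurable (g i) P := fun i => (hlaw i).aemeasurable
  constructor
  -- Hölder: each of the `card σ` factors lies in `L^(card σ)`, so their product lies in `L¹`. The
  -- empty product is treated apart.
  · have h := MemLp.prod' (s := Finset.univ) (f := fun i ω => g i ω ^ m i) (μ := P)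
      (p := fun _ => (Fintype.card σ : ENNReal)) ?_
    · rcases isEmpty_or_nonempty σ with hσ | hσ
      · simp
      · refine h.integrable ?_
        rw [Finset.sum_const, Finset.card_univ, nsmul_eq_mul, ENNReal.mul_inv_cancel, inv_one]
        · simp
        · simp
    · intro i _
      have h2 : MemLp (fun x : ℝ => x ^ m i) (Fintype.card σ : ENNReal) (gaussianReal 0 1) := by
        have h3 : MemLp (id : ℝ → ℝ) ((m i : ENNReal) * Fintype.card σ) (gaussianReal 0 1) :=
          memLp_id_gaussianReal' _ (by finiteness)
        rcases Nat.eq_zero_or_pos (m i) with h0 | h0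
        · simp only [h0, pow_zero]; exact memLp_const _
        · have h4 := (h3.norm_rpow_div (m i : ENNReal))
          rw [mul_comm, ENNReal.mul_div_cancel_right (by simpa using h0.ne') (by simp)] at h4
          refine (memLp_norm_iff (by fun_prop)).1 ?_
          simpa using h4
      rw [← (hlaw i).map_eq] at h2
      exact h2.comp_of_map (hae i)
  · rw [hind.integral_fun_prod_comp (f := fun i x => x ^ m i) hae (fun i => by fun_prop)]
    refine Finset.prod_congr rfl fun i _ => ?_
    exact (hlaw i).integral_comp (f := fun x => x ^ m i) (by fun_prop)

lemma integral_eval_eq_gaussianExpect (hlaw : ∀ i, HasLaw (g i) (gaussianReal 0 1) P)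
    (hind : iIndepFun g P) (f : MvPolynomial σ ℝ) :
    Integrable (fun ω => MvPolynomial.eval (fun i => g i ω) f) P ∧
      ∫ ω, MvPolynomial.eval (fun i => g i ω) f ∂P = gaussianExpect σ f := by
  induction f using MvPolynomial.induction_on' with
  | add p q hp hq =>
    simp only [map_add]
    exact ⟨hp.1.add hq.1, by rw [integral_add hp.1 hq.1, hp.2, hq.2]⟩
  | monomial m c =>
    have h := integrable_prod_pow_of_hasLaw hlaw hind m
    simp only [MvPolynomial.eval_monomial, gaussianExpect_monomial, Finsupp.prod_fintype, pow_zero,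
      implies_true]
    exact ⟨h.1.const_mul c, by rw [integral_const_mul, h.2]⟩

end


/-! ### Splittings of words and the Leibniz rule -/

/-- All the ways of writing a word as `u ++ x :: v`. -/
def splits {α : Type*} : List α → List (List α × α × List α)
  | [] => []
  | x :: w => ([], x, w) :: (splits w).map fun t => (x :: t.1, t.2.1, t.2.2)

lemma eq_of_mem_splits {α : Type*} {w : List α} {t : List α × α × List α} (h : t ∈ splits w) :
    w = t.1 ++ t.2.1 :: t.2.2 := by
  induction w generalizing t with
  | nil => simp [splits] at h
  | cons x w ih =>
    simp only [splits, List.mem_cons, List.mem_map] at h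
    rcases h with rfl | ⟨s, hs, rfl⟩
    · rfl
    · simp [ih hs]

lemma length_of_mem_splits {α : Type*} {w : List α} {t : List α × α × List α}
    (h : t ∈ splits w) : w.length = t.1.length + t.2.2.length + 1 := by
  rw [eq_of_mem_splits h]
  simp
  ring

lemma Matrix.map_derivation_mul {R l m n : Type*} [CommRing R] [Algebra ℝ R] [Fintype m]
    (δ : Derivation ℝ R R) (M : Matrix l m R) (N : Matrix m n R) :
    (M * N).map δ = M.map δ * N + M * N.map δ := by
  ext i j
  simp only [Matrix.map_apply, Matrix.mul_apply, Matrix.add_apply, map_sum, Derivation.leibniz,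
    smul_eq_mul, ← Finset.sum_add_distrib]
  refine Finset.sum_congr rfl fun x _ => ?_
  ring

lemma Matrix.map_derivation_list_prod {R n α : Type*} [CommRing R] [Algebra ℝ R] [Fintype n]
    [DecidableEq n] (δ : Derivation ℝ R R) (f : α → Matrix n n R) (w : List α) :
    ((w.map f).prod).map δ = ((splits w).map fun t =>
      (t.1.map f).prod * (f t.2.1).map δ * (t.2.2.map f).prod).sum := by
  induction w with
  | nil => ext i j; simp [splits, Matrix.one_apply]; split_ifs <;> simp
  | cons x w ih =>
    rw [List.map_cons, List.prod_cons, Matrix.map_derivation_mul, ih]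
    simp only [splits, List.map_cons, List.map_map, List.sum_cons, List.map_nil, List.prod_nil,
      one_mul, Function.comp_def, List.prod_cons]
    rw [← List.sum_map_mul_left]
    simp only [Matrix.mul_assoc]

lemma Derivation.leibniz_list_prod {R α : Type*} [CommRing R] [Algebra ℝ R]
    (δ : Derivation ℝ R R) (f : α → R) (w : List α) :
    δ ((w.map f).prod) = ((splits w).map fun t =>
      (t.1.map f).prod * δ (f t.2.1) * (t.2.2.map f).prod).sum := by
  induction w with
  | nil => simp [splits]
  | cons x w ih =>
    rw [List.map_cons, List.prod_cons, Derivation.leibniz, ih]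
    simp only [splits, List.map_cons, List.map_map, List.sum_cons, List.map_nil, List.prod_nil,
      one_mul, Function.comp_def, List.prod_cons, smul_eq_mul]
    rw [← List.sum_map_mul_left]
    simp only [mul_assoc]
    ring

/-! ### Words in products of Gaussian matrices -/

section

variable {d D p : ℕ}

/-- The `s`-th of `D` independent `d × p` Gaussian matrices. -/
def gaussianBlock (d p : ℕ) {D : ℕ} (s : Fin D) :
    Matrix (Fin d) (Fin p) (MvPolynomial (Fin d × Fin D × Fin p) ℝ) :=
  Matrix.of fun i k => MvPolynomial.X (i, s, k)

/-- The `d × d` matrix `B_a B_bᵀ`. -/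
def letterMatrix (d p : ℕ) {D : ℕ} (x : Fin D × Fin D) :
    Matrix (Fin d) (Fin d) (MvPolynomial (Fin d × Fin D × Fin p) ℝ) :=
  gaussianBlock d p x.1 * (gaussianBlock d p x.2).transpose

/-- The product of the matrices that belong to the letters of a word. -/
def wordMatrix (d p : ℕ) {D : ℕ} (w : List (Fin D × Fin D)) :
    Matrix (Fin d) (Fin d) (MvPolynomial (Fin d × Fin D × Fin p) ℝ) :=
  (w.map (letterMatrix d p)).prod

/-- The word whose matrix is the transpose of that of `w`. -/
def wordTranspose (w : List (Fin D × Fin D)) : List (Fin D × Fin D) := (w.map Prod.swap).reverse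

lemma length_wordTranspose (w : List (Fin D × Fin D)) :
    (wordTranspose w).length = w.length := by
  simp [wordTranspose]

lemma transpose_letterMatrix (x : Fin D × Fin D) :
    (letterMatrix d p x).transpose = letterMatrix d p x.swap := by
  simp [letterMatrix, Matrix.transpose_mul]

lemma wordMatrix_wordTranspose (w : List (Fin D × Fin D)) :
    wordMatrix d p (wordTranspose w) = (wordMatrix d p w).transpose := by
  rw [wordMatrix, wordMatrix, Matrix.transpose_list_prod, wordTranspose, List.map_reverse]
  simp [Function.comp_def, transpose_letterMatrix]

lemma wordMatrix_append (u v : List (Fin D × Fin D)) :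
    wordMatrix d p (u ++ v) = wordMatrix d p u * wordMatrix d p v := by
  simp [wordMatrix]

lemma wordMatrix_cons (x : Fin D × Fin D) (v : List (Fin D × Fin D)) :
    wordMatrix d p (x :: v) = letterMatrix d p x * wordMatrix d p v := by
  simp [wordMatrix]

lemma wordMatrix_nil : wordMatrix d p ([] : List (Fin D × Fin D)) = 1 := by
  simp [wordMatrix]

/-- The trace of a word. -/
def wordTrace (d p : ℕ) {D : ℕ} (w : List (Fin D × Fin D)) :
    MvPolynomial (Fin d × Fin D × Fin p) ℝ := (wordMatrix d p w).trace

/-- The product of the traces of words. -/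
def wordTraces (d p : ℕ) {D : ℕ} (ws : List (List (Fin D × Fin D))) :
    MvPolynomial (Fin d × Fin D × Fin p) ℝ := (ws.map (wordTrace d p)).prod

lemma map_pderiv_gaussianBlock (i : Fin d) (s t : Fin D) (k : Fin p) :
    (gaussianBlock d p t).map (MvPolynomial.pderiv (R := ℝ) (i, s, k)) =
      if t = s then Matrix.single i k 1 else 0 := by
  ext i' k'
  simp only [gaussianBlock, Matrix.map_apply, Matrix.of_apply, MvPolynomial.pderiv_X]
  split_ifs with h
  · subst h
    simp only [Pi.single_apply, Prod.mk.injEq, Matrix.single_apply, true_and]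
    simp only [eq_comm]
  · simp [h]

lemma map_pderiv_letterMatrix (i : Fin d) (s : Fin D) (k : Fin p) (x : Fin D × Fin D) :
    (letterMatrix d p x).map (MvPolynomial.pderiv (R := ℝ) (i, s, k)) =
      (if x.1 = s then Matrix.single i k (1 : MvPolynomial (Fin d × Fin D × Fin p) ℝ) * (gaussianBlock d p x.2).transpose else 0) +
      (if x.2 = s then gaussianBlock d p x.1 * Matrix.single k i (1 : MvPolynomial (Fin d × Fin D × Fin p) ℝ) else 0) := by
  rw [letterMatrix, Matrix.map_derivation_mul, Matrix.transpose_map, map_pderiv_gaussianBlock,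
    map_pderiv_gaussianBlock]
  split_ifs <;> simp

end

/-! ### Contractions of matrix units -/

section

variable {R m n : Type*} [CommRing R] [Fintype m] [Fintype n]

/-- The unit `E_{ik}` glues its neighbours after transposing the left one, whereas `E_{ki}`, in the
next lemma, cuts the product into two traces. These are the sources of the reversed words and of the
split traces in the loop equation. -/
lemma sum_mul_single_mul_apply_transpose [DecidableEq m] [DecidableEq n] (A C : Matrix n m R) :
    ∑ i : m, ∑ k : n, (A * (Matrix.single i k (1 : R) * C)) k i = (A.transpose * C).trace := by
  simp only [Matrix.trace, Matrix.diag, Matrix.mul_apply, Matrix.transpose_apply,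
    Matrix.single_apply]
  simp [ite_and]

lemma sum_mul_single_mul_apply [DecidableEq m] [DecidableEq n] (A : Matrix n n R) (C : Matrix m m R) :
    ∑ i : m, ∑ k : n, (A * (Matrix.single k i (1 : R) * C)) k i = A.trace * C.trace := by
  simp only [Matrix.trace, Matrix.diag, Matrix.mul_apply, Matrix.single_apply]
  rw [Finset.sum_mul_sum, Finset.sum_comm]
  simp [ite_and]

lemma trace_mul_single_mul {l : Type*} [Fintype l] [DecidableEq m] [DecidableEq n]
    (A : Matrix l m R) (C : Matrix n l R) (i : m)
    (k : n) : (A * (Matrix.single i k (1 : R) * C)).trace = (C * A) k i := by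
  rw [Matrix.trace_mul_comm, Matrix.mul_assoc]
  simp [Matrix.trace, Matrix.mul_apply, Matrix.single_apply, ite_and]

lemma sum_mul_eq_trace_transpose_mul (A C : Matrix n m R) :
    ∑ i : m, ∑ k : n, A k i * C k i = (A.transpose * C).trace := by
  simp [Matrix.trace, Matrix.mul_apply]

lemma sum_mul_eq_trace_mul (A : Matrix n m R) (C : Matrix m n R) :
    ∑ i : m, ∑ k : n, A k i * C i k = (A * C).trace := by
  rw [Finset.sum_comm]
  simp [Matrix.trace, Matrix.mul_apply]

end


lemma Finset.sum_list_sum_map {ι α M : Type*} [AddCommMonoid M] (s : Finset ι) (l : List α)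
    (f : ι → α → M) : ∑ i ∈ s, (l.map (f i)).sum = (l.map fun x => ∑ i ∈ s, f i x).sum := by
  induction l with
  | nil => simp
  | cons x l ih => simp [Finset.sum_add_distrib, ih]

lemma Matrix.mul_list_sum_mul_apply {R α l m n o : Type*} [CommRing R] [Fintype m] [Fintype n]
    (L : List α) (f : α → Matrix m n R) (A : Matrix l m R) (C : Matrix n o R) (i : l) (j : o) :
    (A * (L.map f).sum * C) i j = (L.map fun x => (A * f x * C) i j).sum := by
  induction L with
  | nil => simp
  | cons x L ih => simp [Matrix.mul_add, Matrix.add_mul, ih]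

/-! ### The loop equation for traces of words -/

section

variable {d D p : ℕ}

lemma map_pderiv_wordMatrix (i : Fin d) (s : Fin D) (k : Fin p) (w : List (Fin D × Fin D)) :
    (wordMatrix d p w).map (MvPolynomial.pderiv (R := ℝ) (i, s, k)) =
      ((splits w).map fun t => wordMatrix d p t.1 *
        (letterMatrix d p t.2.1).map (MvPolynomial.pderiv (R := ℝ) (i, s, k)) *
          wordMatrix d p t.2.2).sum :=
  Matrix.map_derivation_list_prod _ _ _

lemma wordTrace_cons (s t : Fin D) (w : List (Fin D × Fin D)) :
    wordTrace d p ((s, t) :: w) = ∑ i, ∑ k, MvPolynomial.X (i, s, k) *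
      ((gaussianBlock d p t).transpose * wordMatrix d p w) k i := by
  rw [wordTrace, wordMatrix_cons, letterMatrix, Matrix.mul_assoc]
  rfl

/-- The derivative hits `B_tᵀ`, which gives `p tr w`; or the left factor of a letter of `w`, which
transposes the prefix before it; or the right factor of a letter, which splits the trace in two. -/
lemma sum_pderiv_transpose_mul_wordMatrix (s t : Fin D) (w : List (Fin D × Fin D)) :
    ∑ i, ∑ k, MvPolynomial.pderiv (R := ℝ) (i, s, k)
        (((gaussianBlock d p t).transpose * wordMatrix d p w) k i) =
      (if t = s then (p : MvPolynomial (Fin d × Fin D × Fin p) ℝ) * wordTrace d p w else 0) +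
      ((splits w).map fun r =>
        (if r.2.1.1 = s then wordTrace d p (wordTranspose r.1 ++ (t, r.2.1.2) :: r.2.2) else 0) +
        (if r.2.1.2 = s then wordTrace d p ((r.2.1.1, t) :: r.1) * wordTrace d p r.2.2
          else 0)).sum := by
  have h : ∀ i k, MvPolynomial.pderiv (R := ℝ) (i, s, k)
        (((gaussianBlock d p t).transpose * wordMatrix d p w) k i) =
      (if t = s then wordMatrix d p w i i else 0) +
        ((splits w).map fun r =>
          (if r.2.1.1 = s then (((gaussianBlock d p t).transpose * wordMatrix d p r.1) *
            (Matrix.single i k (1 : MvPolynomial (Fin d × Fin D × Fin p) ℝ) *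
              ((gaussianBlock d p r.2.1.2).transpose * wordMatrix d p r.2.2))) k i else 0) +
          (if r.2.1.2 = s then
            (((gaussianBlock d p t).transpose * wordMatrix d p r.1 * gaussianBlock d p r.2.1.1) *
            (Matrix.single k i (1 : MvPolynomial (Fin d × Fin D × Fin p) ℝ) * wordMatrix d p r.2.2)) k i else 0)).sum := by
    intro i k
    have h1 := congrFun (congrFun (Matrix.map_derivation_mul (MvPolynomial.pderiv (R := ℝ) (i, s, k))
      (gaussianBlock d p t).transpose (wordMatrix d p w)) k) i
    rw [Matrix.map_apply] at h1
    rw [h1, Matrix.transpose_map, map_pderiv_gaussianBlock, map_pderiv_wordMatrix,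
      Matrix.add_apply]
    congr 1
    · split_ifs
      · simp [Matrix.mul_apply, Matrix.single_apply]
      · simp
    · rw [← Matrix.mul_one ((gaussianBlock d p t).transpose * _), Matrix.mul_list_sum_mul_apply]
      congr 2
      ext1 r
      rw [map_pderiv_letterMatrix, Matrix.mul_one]
      split_ifs <;> simp [Matrix.mul_add, Matrix.add_mul, Matrix.mul_assoc]
  simp only [h, Finset.sum_add_distrib, Finset.sum_list_sum_map]
  congr 1
  · split_ifs
    · simp [wordTrace, Matrix.trace, Finset.mul_sum]
    · simp
  · congr 2
    ext1 r
    congr 1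
    · split_ifs
      · rw [sum_mul_single_mul_apply_transpose, wordTrace, wordMatrix_append, wordMatrix_cons,
          wordMatrix_wordTranspose, letterMatrix, Matrix.transpose_mul, Matrix.transpose_transpose]
        simp only [Matrix.mul_assoc]
      · simp
    · split_ifs
      · rw [sum_mul_single_mul_apply, wordTrace, wordTrace, wordMatrix_cons, letterMatrix,
          Matrix.mul_assoc, Matrix.mul_assoc, Matrix.trace_mul_comm (gaussianBlock d p r.2.1.1),
          Matrix.mul_assoc]
      · simp

/-- Differentiating another trace merges it with the first: by cyclicity `w'` is opened at the
letter hit and joined to `w`, which is transposed when the left factor of that letter is hit. -/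
lemma sum_transpose_mul_wordMatrix_mul_pderiv (s t : Fin D) (w w' : List (Fin D × Fin D)) :
    ∑ i, ∑ k, ((gaussianBlock d p t).transpose * wordMatrix d p w) k i *
        MvPolynomial.pderiv (R := ℝ) (i, s, k) (wordTrace d p w') =
      ((splits w').map fun r =>
        (if r.2.1.1 = s then
          wordTrace d p (wordTranspose w ++ (t, r.2.1.2) :: (r.2.2 ++ r.1)) else 0) +
        (if r.2.1.2 = s then wordTrace d p ((r.2.1.1, t) :: (w ++ r.2.2 ++ r.1)) else 0)).sum := by
  have h : ∀ i k, MvPolynomial.pderiv (R := ℝ) (i, s, k) (wordTrace d p w') =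
      ((splits w').map fun r =>
        (if r.2.1.1 = s then
          ((gaussianBlock d p r.2.1.2).transpose * wordMatrix d p (r.2.2 ++ r.1)) k i else 0) +
        (if r.2.1.2 = s then
          (wordMatrix d p (r.2.2 ++ r.1) * gaussianBlock d p r.2.1.1) i k else 0)).sum := by
    intro i k
    have h1 : MvPolynomial.pderiv (R := ℝ) (i, s, k) (wordTrace d p w') =
        ((wordMatrix d p w').map (MvPolynomial.pderiv (R := ℝ) (i, s, k))).trace := by
      simp [wordTrace, Matrix.trace]
    rw [h1, map_pderiv_wordMatrix, Matrix.trace_list_sum, List.map_map]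
    congr 2
    ext1 r
    rw [Function.comp_apply, map_pderiv_letterMatrix, wordMatrix_append]
    have e1 := trace_mul_single_mul (wordMatrix d p r.1)
      ((gaussianBlock d p r.2.1.2).transpose * wordMatrix d p r.2.2) i k
    have e2 := trace_mul_single_mul (wordMatrix d p r.1 * gaussianBlock d p r.2.1.1)
      (wordMatrix d p r.2.2) k i
    simp only [Matrix.mul_assoc] at e1 e2
    split_ifs <;> simp [Matrix.mul_add, Matrix.add_mul, Matrix.mul_assoc, e1, e2]
  simp only [h, ← List.sum_map_mul_left, Finset.sum_list_sum_map]
  congr 2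
  ext1 r
  simp only [mul_add, Finset.sum_add_distrib]
  congr 1
  · split_ifs
    · rw [sum_mul_eq_trace_transpose_mul, wordTrace, wordMatrix_append (wordTranspose w),
        wordMatrix_wordTranspose, wordMatrix_cons, letterMatrix, Matrix.transpose_mul,
        Matrix.transpose_transpose]
      simp only [Matrix.mul_assoc]
    · simp
  · split_ifs
    · rw [sum_mul_eq_trace_mul, wordTrace, wordMatrix_cons, List.append_assoc, wordMatrix_append w,
        letterMatrix, Matrix.mul_assoc (gaussianBlock d p r.2.1.1),
        Matrix.trace_mul_comm (gaussianBlock d p r.2.1.1)]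
      simp only [Matrix.mul_assoc]
    · simp

/-- The loop equation for the words in the products of Gaussian matrices. -/
lemma gaussianExpect_wordTraces_cons (s t : Fin D) (w : List (Fin D × Fin D))
    (ws : List (List (Fin D × Fin D))) :
    gaussianExpect _ (wordTraces d p (((s, t) :: w) :: ws)) =
      (if t = s then (p : ℝ) * gaussianExpect _ (wordTraces d p (w :: ws)) else 0) +
      ((splits w).map fun r =>
        (if r.2.1.1 = s then gaussianExpect _
          (wordTraces d p ((wordTranspose r.1 ++ (t, r.2.1.2) :: r.2.2) :: ws)) else 0) +
        (if r.2.1.2 = s then gaussianExpect _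
          (wordTraces d p (((r.2.1.1, t) :: r.1) :: r.2.2 :: ws)) else 0)).sum +
      ((splits ws).map fun q => ((splits q.2.1).map fun r =>
        (if r.2.1.1 = s then gaussianExpect _ (wordTraces d p
          ((wordTranspose w ++ (t, r.2.1.2) :: (r.2.2 ++ r.1)) :: (q.1 ++ q.2.2))) else 0) +
        (if r.2.1.2 = s then gaussianExpect _ (wordTraces d p
          (((r.2.1.1, t) :: (w ++ r.2.2 ++ r.1)) :: (q.1 ++ q.2.2))) else 0)).sum).sum := by
  have h : ∀ i k, MvPolynomial.pderiv (R := ℝ) (i, s, k)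
      (((gaussianBlock d p t).transpose * wordMatrix d p w) k i * wordTraces d p ws) =
      MvPolynomial.pderiv (R := ℝ) (i, s, k)
        (((gaussianBlock d p t).transpose * wordMatrix d p w) k i) * wordTraces d p ws +
      ((splits ws).map fun q => ((gaussianBlock d p t).transpose * wordMatrix d p w) k i *
        MvPolynomial.pderiv (R := ℝ) (i, s, k) (wordTrace d p q.2.1) *
          wordTraces d p (q.1 ++ q.2.2)).sum := by
    intro i k
    rw [Derivation.leibniz, wordTraces, Derivation.leibniz_list_prod, smul_eq_mul, smul_eq_mul,
      add_comm, mul_comm, ← List.sum_map_mul_left]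
    congr 3
    ext1 q
    simp only [wordTraces, List.map_append, List.prod_append]
    ring
  -- The first trace is expanded in the entries of its leading factor `B_s`, and each entry is
  -- integrated by parts.
  have h0 : gaussianExpect _ (wordTraces d p (((s, t) :: w) :: ws)) =
      gaussianExpect _ (∑ i, ∑ k, MvPolynomial.pderiv (R := ℝ) (i, s, k)
        (((gaussianBlock d p t).transpose * wordMatrix d p w) k i * wordTraces d p ws)) := by
    rw [wordTraces, List.map_cons, List.prod_cons, wordTrace_cons]
    simp only [Finset.sum_mul, map_sum, mul_assoc, gaussianExpect_X_mul]
    rfl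
  rw [h0]
  simp only [h, Finset.sum_add_distrib, ← Finset.sum_mul, Finset.sum_list_sum_map,
    sum_pderiv_transpose_mul_wordMatrix, sum_transpose_mul_wordMatrix_mul_pderiv]
  rw [map_add, add_mul, map_add, ← List.sum_map_mul_right, map_list_sum, map_list_sum, List.map_map,
    List.map_map]
  congr 2
  · split_ifs
    · rw [mul_assoc, ← nsmul_eq_mul, map_nsmul, nsmul_eq_mul]
      simp [wordTraces]
    · simp
  · congr 2
    ext1 r
    simp only [Function.comp_apply, add_mul, map_add, ite_mul, zero_mul]
    split_ifs <;> simp [wordTraces, mul_assoc]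
  · congr 1
    ext1 q
    simp only [Function.comp_apply]
    rw [← List.sum_map_mul_right, map_list_sum, List.map_map]
    congr 2
    ext1 r
    simp only [Function.comp_apply, add_mul, map_add, ite_mul, zero_mul]
    split_ifs <;> simp [wordTraces]

end


/-! ### The large dimension limit of the words -/

/-- The limit of the normalised expected traces of words in the Gaussian products `B_a B_bᵀ`. -/
def limitMoment {S : Type*} [DecidableEq S] (γ : ℝ) : List (S × S) → ℝ
  | [] => 1
  | (s, t) :: w => (if t = s then γ * limitMoment γ w else 0) +
      ((splits w).attach.map fun r => if r.1.2.1.2 = s then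
        limitMoment γ ((r.1.2.1.1, t) :: r.1.1) * limitMoment γ r.1.2.2 else 0).sum
termination_by w => w.length
decreasing_by
  · simp
  · have := length_of_mem_splits r.2
    simp only [List.length_cons]
    omega
  · have := length_of_mem_splits r.2
    simp only [List.length_cons]
    omega

lemma limitMoment_nil {S : Type*} [DecidableEq S] (γ : ℝ) :
    limitMoment γ ([] : List (S × S)) = 1 := by
  rw [limitMoment]

lemma limitMoment_cons {S : Type*} [DecidableEq S] (γ : ℝ) (s t : S) (w : List (S × S)) :
    limitMoment γ ((s, t) :: w) = (if t = s then γ * limitMoment γ w else 0) +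
      ((splits w).map fun r => if r.2.1.2 = s then
        limitMoment γ ((r.2.1.1, t) :: r.1) * limitMoment γ r.2.2 else 0).sum := by
  rw [limitMoment]
  congr 2
  exact List.attach_map_val (f := fun r => if r.2.1.2 = s then
        limitMoment γ ((r.2.1.1, t) :: r.1) * limitMoment γ r.2.2 else 0) (l := splits w)

/-- The exponent of the dimension in the normalisation of a product of traces of words. -/
def wordsSize {α : Type*} (ws : List (List α)) : ℕ := (ws.map fun w => w.length + 1).sum

lemma wordsSize_cons {α : Type*} (w : List α) (ws : List (List α)) :
    wordsSize (w :: ws) = w.length + 1 + wordsSize ws := by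
  simp [wordsSize]

lemma wordsSize_append {α : Type*} (ws ws' : List (List α)) :
    wordsSize (ws ++ ws') = wordsSize ws + wordsSize ws' := by
  simp [wordsSize]

lemma tendsto_div_pow_add_zero {d : ℕ → ℕ} (hd : Tendsto d atTop atTop) {f : ℕ → ℝ} {a k : ℕ}
    {x : ℝ} (hf : Tendsto (fun N => f N / (d N : ℝ) ^ a) atTop (𝓝 x)) (hk : 0 < k) :
    Tendsto (fun N => f N / (d N : ℝ) ^ (a + k)) atTop (𝓝 0) := by
  have h1 : Tendsto (fun N => ((d N : ℝ)⁻¹) ^ k) atTop (𝓝 0) := by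
    have := (tendsto_inv_atTop_zero.comp (tendsto_natCast_atTop_atTop (R := ℝ))).comp hd
    simpa [hk.ne'] using this.pow k
  have h2 := hf.mul h1
  rw [mul_zero] at h2
  refine h2.congr fun N => ?_
  rw [pow_add, div_eq_mul_inv, div_eq_mul_inv, mul_inv, inv_pow, mul_assoc]

lemma tendsto_ite_zero {ι : Type*} {l : Filter ι} (P : Prop) [Decidable P] {f : ι → ℝ} {x : ℝ}
    (h : P → Tendsto f l (𝓝 x)) :
    Tendsto (fun N => if P then f N else 0) l (𝓝 (if P then x else 0)) := by
  split_ifs with hP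
  · exact h hP
  · exact tendsto_const_nhds

/-- Power counting in the loop equation, by induction on the total length. Every term is shorter by
one letter. Splitting a trace keeps the total of letters and traces, and the factor `p` makes up for
a lost power of `d`; reversing a prefix loses one power and merging two traces loses two. Products
of traces are treated together because splitting leaves single traces. -/
lemma tendsto_gaussianExpect_wordTraces {D : ℕ} {d p : ℕ → ℕ} {γ : ℝ}
    (hd : Tendsto d atTop atTop) (hp : Tendsto (fun N => (p N : ℝ) / d N) atTop (𝓝 γ))
    (ws : List (List (Fin D × Fin D))) :
    Tendsto (fun N => gaussianExpect _ (wordTraces (d N) (p N) ws) / (d N : ℝ) ^ wordsSize ws)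
      atTop (𝓝 (ws.map (limitMoment γ)).prod) := by
  induction hn : (ws.map List.length).sum using Nat.strong_induction_on generalizing ws with
  | _ n IH =>
  induction ws with
  | nil => simp [wordTraces, gaussianExpect_one, wordsSize]
  | cons w ws ih =>
  rcases w with _ | ⟨⟨s, t⟩, w⟩
  -- An empty word has trace `d`, which cancels its contribution to `wordsSize`. The total length
  -- does not drop, hence the inner induction on the list.
  · refine Tendsto.congr' ?_ (ih (by simpa using hn))
      |>.trans (by simp [limitMoment_nil])
    filter_upwards [hd.eventually_gt_atTop 0] with N hN
    have hN' : (d N : ℝ) ≠ 0 := by positivity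
    have h1 : wordTraces (d N) (p N) ([] :: ws) = (d N) • wordTraces (d N) (p N) ws := by
      simp [wordTraces, wordTrace, wordMatrix_nil, Matrix.trace_one]
    rw [h1, map_nsmul, wordsSize_cons, nsmul_eq_mul, List.length_nil, zero_add, pow_add, pow_one,
      mul_div_mul_left _ _ hN']
  refine Tendsto.congr (fun N => congrArg (· / (d N : ℝ) ^ wordsSize (((s, t) :: w) :: ws))
    (gaussianExpect_wordTraces_cons s t w ws).symm) ?_
  simp only [add_div]
  have key : ∀ (ws' : List (List (Fin D × Fin D))) (k : ℕ), (ws'.map List.length).sum < n →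
      wordsSize (((s, t) :: w) :: ws) = wordsSize ws' + k → 0 < k →
      Tendsto (fun N => gaussianExpect _ (wordTraces (d N) (p N) ws') /
        (d N : ℝ) ^ wordsSize (((s, t) :: w) :: ws)) atTop (𝓝 0) := by
    intro ws' k h1 h2 h3
    rw [h2]
    exact tendsto_div_pow_add_zero hd (IH _ h1 ws' rfl) h3
  simp only [List.map_cons, List.sum_cons, List.length_cons] at hn
  have e1 : (((((s, t) :: w) :: ws)).map (limitMoment γ)).prod =
      (if t = s then γ * ((w :: ws).map (limitMoment γ)).prod else 0) +
      ((splits w).map fun r => (if r.2.1.1 = s then (0 : ℝ) else 0) + (if r.2.1.2 = s then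
        ((((r.2.1.1, t) :: r.1) :: r.2.2 :: ws).map (limitMoment γ)).prod else 0)).sum +
      ((splits ws).map fun q => ((splits q.2.1).map fun r => (if r.2.1.1 = s then (0 : ℝ) else 0) +
        (if r.2.1.2 = s then (0 : ℝ) else 0)).sum).sum := by
    rw [List.map_cons, List.prod_cons, limitMoment_cons γ s t w]
    simp only [List.map_cons, List.prod_cons, add_mul, ite_self, zero_add,
      ← List.sum_map_mul_right, ite_mul, zero_mul, mul_assoc]
    simp
  rw [e1]
  refine (Tendsto.add ?_ ?_).add ?_
  · simp only [ite_div, zero_div]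
    refine tendsto_ite_zero _ fun _ => ?_
    refine (hp.mul (IH _ (by simp; omega) (w :: ws) rfl)).congr fun N => ?_
    rw [wordsSize_cons, wordsSize_cons, List.length_cons, div_mul_div_comm, ← pow_succ']
    congr 2
    ring
  · simp only [div_eq_mul_inv, ← List.sum_map_mul_right]
    refine tendsto_list_sum _ fun r hr => ?_
    have hlen := length_of_mem_splits hr
    simp only [add_mul, ite_mul, zero_mul]
    refine Tendsto.add ?_ ?_
    · refine tendsto_ite_zero _ fun _ => ?_
      refine key _ 1 ?_ ?_ one_pos
      · simp [length_wordTranspose]; omega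
      · simp [wordsSize_cons, length_wordTranspose]; omega
    · refine tendsto_ite_zero _ fun _ => ?_
      have hlt : ((((r.2.1.1, t) :: r.1) :: r.2.2 :: ws).map List.length).sum < n := by
        simp; omega
      have := IH _ hlt _ rfl
      refine this.congr fun N => ?_
      rw [div_eq_mul_inv]
      congr 3
      simp [wordsSize_cons]; omega
  · simp only [div_eq_mul_inv, ← List.sum_map_mul_right]
    refine tendsto_list_sum _ fun q hq => ?_
    have hws := eq_of_mem_splits hq
    have hsum : (ws.map List.length).sum = (q.1.map List.length).sum +
      (q.2.1.length + (q.2.2.map List.length).sum) := by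
      rw [hws]; simp
    have hsize : wordsSize ws = wordsSize q.1 + (q.2.1.length + 1 + wordsSize q.2.2) := by
      conv_lhs => rw [hws]
      simp [wordsSize_append, wordsSize_cons]
    refine tendsto_list_sum _ fun r hr => ?_
    have hlen := length_of_mem_splits hr
    simp only [add_mul, ite_mul, zero_mul]
    refine Tendsto.add ?_ ?_
    · refine tendsto_ite_zero _ fun _ => ?_
      refine key _ 2 ?_ ?_ two_pos
      · simp [length_wordTranspose]; omega
      · simp [wordsSize_cons, length_wordTranspose, wordsSize_append]; omega
    · refine tendsto_ite_zero _ fun _ => ?_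
      refine key _ 2 ?_ ?_ two_pos
      · simp; omega
      · simp [wordsSize_cons, wordsSize_append]; omega


/-! ### Powers of the partial transpose as sums over words -/

section

variable {S M : Type*} [Fintype S] [DecidableEq S] [AddCommMonoid M]

/-- The sum of `F` over all words that occur in the `(a, b)` entry of the `n`-th power of the
matrix whose `(s, t)` entry is the letter `(t, s)`. -/
def pathSum : ℕ → S → S → (List (S × S) → M) → M
  | 0, a, b, F => if a = b then F [] else 0
  | n + 1, a, b, F => ∑ f, pathSum n f b fun w => F ((f, a) :: w)

lemma pathSum_congr {n : ℕ} {a b : S} {F F' : List (S × S) → M}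
    (h : ∀ w, w.length = n → F w = F' w) : pathSum n a b F = pathSum n a b F' := by
  induction n generalizing a F F' with
  | zero => simp [pathSum, h]
  | succ n ih => exact Finset.sum_congr rfl fun f _ => ih fun w hw => h _ (by simp [hw])

lemma map_pathSum {M' : Type*} [AddCommMonoid M'] (φ : M →+ M') (n : ℕ) (a b : S)
    (F : List (S × S) → M) : φ (pathSum n a b F) = pathSum n a b fun w => φ (F w) := by
  induction n generalizing a F with
  | zero => simp only [pathSum]; split_ifs <;> simp
  | succ n ih => simp [pathSum, ih]

lemma pathSum_add (n : ℕ) (a b : S) (F F' : List (S × S) → M) :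
    pathSum n a b (fun w => F w + F' w) = pathSum n a b F + pathSum n a b F' := by
  induction n generalizing a F F' with
  | zero => simp only [pathSum]; split_ifs <;> simp
  | succ n ih => simp [pathSum, ih, Finset.sum_add_distrib]

lemma pathSum_zero (n : ℕ) (a b : S) : pathSum n a b (fun _ => (0 : M)) = 0 := by
  induction n generalizing a with
  | zero => simp [pathSum]
  | succ n ih => simp [pathSum, ih]

lemma pathSum_sum {ι : Type*} (s : Finset ι) (n : ℕ) (a b : S) (F : ι → List (S × S) → M) :
    pathSum n a b (fun w => ∑ i ∈ s, F i w) = ∑ i ∈ s, pathSum n a b (F i) := by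
  classical
  induction s using Finset.induction_on with
  | empty => simp [pathSum_zero]
  | insert i s hi ih => simp [Finset.sum_insert hi, pathSum_add, ih]

/-- A path with a marked step from `e` to `f` is a path of length `j` ending at `e` and one of
length `n - 1 - j` starting at `f`. This turns the splittings of the loop equation into
convolutions. -/
lemma pathSum_sum_splits (n : ℕ) (a b : S) (K : List (S × S) → S × S → List (S × S) → M) :
    pathSum n a b (fun w => ((splits w).map fun r => K r.1 r.2.1 r.2.2).sum) =
      ∑ j ∈ Finset.range n, ∑ e, ∑ f,
        pathSum j a e fun u => pathSum (n - 1 - j) f b fun v => K u (f, e) v := by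
  induction n generalizing a K with
  | zero => simp [pathSum, splits]
  | succ n ih =>
    rw [pathSum, Finset.sum_range_succ']
    simp only [splits, List.map_cons, List.map_map, List.sum_cons, pathSum_add, Function.comp_def]
    rw [Finset.sum_add_distrib, add_comm]
    congr 1
    · have h := fun f => ih f fun u x v => K ((f, a) :: u) x v
      simp only [h]
      rw [Finset.sum_comm]
      refine Finset.sum_congr rfl fun j _ => ?_
      rw [Finset.sum_comm]
      refine Finset.sum_congr rfl fun e _ => ?_
      rw [Finset.sum_comm]
      refine Finset.sum_congr rfl fun f _ => ?_
      rw [pathSum, show n + 1 - 1 - (j + 1) = n - 1 - j by omega]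
    · simp [pathSum]

lemma tendsto_pathSum {ι : Type*} {l : Filter ι} {n : ℕ} {a b : S} {F : ι → List (S × S) → ℝ}
    {F' : List (S × S) → ℝ} (h : ∀ w, Tendsto (fun N => F N w) l (𝓝 (F' w))) :
    Tendsto (fun N => pathSum n a b (F N)) l (𝓝 (pathSum n a b F')) := by
  induction n generalizing a F F' with
  | zero => exact tendsto_ite_zero _ fun _ => h _
  | succ n ih => exact tendsto_finsetSum _ fun f _ => ih fun w => h _

end

/-! ### Summing the limit recursion over paths -/

section

variable {D : ℕ} {γ : ℝ} {m α β : ℕ → ℝ}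

/-- Path sums are combinations of Kronecker deltas. With a letter `(s, t)` in front there are two
possible pairings of the four indices, with coefficients `α` and `β`; the recursion of
`limitMoment`, applied to this ansatz, is the system in the hypotheses. -/
lemma pathSum_limitMoment_aux (h0 : m 0 = 1)
    (hα : ∀ n, α n = γ * m n + ∑ j ∈ Finset.range n, β j * m (n - 1 - j))
    (hβ : ∀ n, β n = ∑ j ∈ Finset.range n, α j * m (n - 1 - j))
    (hm : ∀ n, m (n + 1) = α n + D * β n) (n : ℕ) :
    (∀ a b : Fin D, pathSum n a b (limitMoment γ) = if a = b then m n else 0) ∧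
    (∀ s t a b : Fin D, pathSum n a b (fun w => limitMoment γ ((s, t) :: w)) =
      (if s = t ∧ a = b then α n else 0) + (if b = t ∧ a = s then β n else 0)) := by
  induction n using Nat.strong_induction_on with
  | _ n ih =>
  have h1 : ∀ a b : Fin D, pathSum n a b (limitMoment γ) = if a = b then m n else 0 := by
    intro a b
    rcases n with _ | n
    · simp [pathSum, limitMoment_nil, h0]
    -- The first letter is `(f, a)`: the `α` term forces `f = a`, while the `β` term leaves `f` free
    -- and so acquires the factor `D`.
    · simp only [pathSum, (ih n (by omega)).2, hm]
      rw [Finset.sum_add_distrib]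
      rcases eq_or_ne a b with rfl | hab
      · simp
      · have : ∀ x, ¬ (x = a ∧ x = b) := fun x hx => hab (hx.1 ▸ hx.2)
        simp [this, hab, hab.symm]
  refine ⟨h1, fun s t a b => ?_⟩
  rw [funext fun w => limitMoment_cons γ s t w, pathSum_add]
  rw [pathSum_sum_splits n a b fun u x v =>
    if x.2 = s then limitMoment γ ((x.1, t) :: u) * limitMoment γ v else 0]
  have h2 : pathSum n a b (fun w => if t = s then γ * limitMoment γ w else 0) =
      if s = t ∧ a = b then γ * m n else 0 := by
    by_cases hst : s = t
    · subst hst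
      have := map_pathSum (AddMonoidHom.mulLeft γ) n a b (limitMoment γ)
      simp only [AddMonoidHom.coe_mulLeft] at this
      simp [← this, h1]
    · simp [hst, Ne.symm hst, pathSum_zero]
  -- The condition forces `e = s` and the tail forces `f = b`. The front part then carries the
  -- letter `(b, t)`, for which the two pairings are exchanged: `α` feeds `β` and conversely.
  have h3 : ∀ j ∈ Finset.range n, (∑ e, ∑ f, pathSum j a e fun u => pathSum (n - 1 - j) f b fun v =>
      if e = s then limitMoment γ ((f, t) :: u) * limitMoment γ v else 0) =
      (if b = t ∧ a = s then α j * m (n - 1 - j) else 0) +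
        (if s = t ∧ a = b then β j * m (n - 1 - j) else 0) := by
    intro j hj
    rw [Finset.mem_range] at hj
    rw [Finset.sum_eq_single s (fun e _ he => by simp [he, pathSum_zero]) (by simp)]
    simp only [if_true]
    have h4 : ∀ f (u : List (Fin D × Fin D)), (pathSum (n - 1 - j) f b fun v =>
        limitMoment γ ((f, t) :: u) * limitMoment γ v) =
        if f = b then limitMoment γ ((f, t) :: u) * m (n - 1 - j) else 0 := by
      intro f u
      have := map_pathSum (AddMonoidHom.mulLeft (limitMoment γ ((f, t) :: u))) (n - 1 - j) f b
        (limitMoment γ)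
      simp only [AddMonoidHom.coe_mulLeft] at this
      rw [← this, (ih (n - 1 - j) (by omega)).1]
      simp
    simp only [h4]
    rw [Finset.sum_eq_single b (fun f _ hf => by simp [hf, pathSum_zero]) (by simp)]
    simp only [if_true]
    have h5 := map_pathSum (AddMonoidHom.mulRight (m (n - 1 - j))) j a s
      fun u => limitMoment γ ((b, t) :: u)
    simp only [AddMonoidHom.coe_mulRight] at h5
    rw [← h5, (ih j hj).2, add_mul, ite_mul, ite_mul, zero_mul]
  rw [h2, Finset.sum_congr rfl h3, Finset.sum_add_distrib, hα, hβ]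
  have e : ∀ (Q : Prop) [Decidable Q] (f : ℕ → ℝ), (∑ j ∈ Finset.range n, if Q then f j else 0) =
      if Q then ∑ j ∈ Finset.range n, f j else 0 := by
    intro Q _ f
    split_ifs <;> simp
  rw [e, e]
  split_ifs <;> ring

end

/-! ### The moments of the partially transposed Wishart matrix -/

/-- The partial transpose of the unnormalised Wishart matrix, with indeterminate entries. -/
def genericPartialTranspose (d₁ d₂ p : ℕ) : Matrix (Fin d₁ × Fin d₂) (Fin d₁ × Fin d₂)
    (MvPolynomial (Fin d₁ × Fin d₂ × Fin p) ℝ) :=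
  Matrix.of fun x y => ∑ k, MvPolynomial.X (x.1, y.2, k) * MvPolynomial.X (y.1, x.2, k)

/-- With the second index taken as the block index, transposing the blocks of the Wishart matrix
appears as the reversed order of `y.2` and `x.2` in the letter. -/
lemma genericPartialTranspose_apply (d₁ d₂ p : ℕ) (x y : Fin d₁ × Fin d₂) :
    genericPartialTranspose d₁ d₂ p x y = letterMatrix d₁ p (y.2, x.2) x.1 y.1 := by
  simp [genericPartialTranspose, letterMatrix, gaussianBlock, Matrix.mul_apply]

lemma genericPartialTranspose_pow_apply (d₁ d₂ p n : ℕ) (x y : Fin d₁ × Fin d₂) :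
    (genericPartialTranspose d₁ d₂ p ^ n) x y =
      pathSum n x.2 y.2 fun w => wordMatrix d₁ p w x.1 y.1 := by
  induction n generalizing x with
  | zero =>
    obtain ⟨i, a⟩ := x
    obtain ⟨j, b⟩ := y
    simp only [pow_zero, pathSum, wordMatrix_nil, Matrix.one_apply, Prod.mk.injEq, ← ite_and,
      and_comm]
  | succ n ih =>
    rw [pow_succ', Matrix.mul_apply, Fintype.sum_prod_type, Finset.sum_comm, pathSum]
    refine Finset.sum_congr rfl fun f _ => ?_
    simp only [wordMatrix_cons, Matrix.mul_apply, pathSum_sum, ih, genericPartialTranspose_apply]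
    refine Finset.sum_congr rfl fun l _ => ?_
    exact map_pathSum (AddMonoidHom.mulLeft (letterMatrix d₁ p (f, x.2) x.1 l)) n f y.2 _

lemma trace_genericPartialTranspose_pow (d₁ d₂ p n : ℕ) :
    (genericPartialTranspose d₁ d₂ p ^ n).trace = ∑ a, pathSum n a a (wordTrace d₁ p) := by
  simp only [Matrix.trace, Matrix.diag, genericPartialTranspose_pow_apply, Fintype.sum_prod_type]
  rw [Finset.sum_comm]
  refine Finset.sum_congr rfl fun a _ => ?_
  rw [← pathSum_sum]
  rfl

/-- The expected normalised trace of the `n`-th power of the partial transpose. -/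
def partialTransposeMoment (n d₁ d₂ p : ℕ) : ℝ :=
  gaussianExpect _ (genericPartialTranspose d₁ d₂ p ^ n).trace / ((d₁ : ℝ) * d₂) ^ (n + 1)

/-- The limit of the `n`-th moment when the second tensor factor has the fixed dimension `D`. -/
def blockMoment (γ : ℝ) (D n : ℕ) : ℝ := (D : ℝ)⁻¹ * ∑ a : Fin D, pathSum n a a (limitMoment γ)

/-- Any solution of the system gives the block moments, so one may be taken from an operator model.
-/
lemma blockMoment_eq {D : ℕ} (hD : 0 < D) {γ : ℝ} {m α β : ℕ → ℝ} (h0 : m 0 = 1)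
    (hα : ∀ n, α n = γ * m n + ∑ j ∈ Finset.range n, β j * m (n - 1 - j))
    (hβ : ∀ n, β n = ∑ j ∈ Finset.range n, α j * m (n - 1 - j))
    (hm : ∀ n, m (n + 1) = α n + D * β n) (n : ℕ) : blockMoment γ D n = m n := by
  have hD' : (D : ℝ) ≠ 0 := by positivity
  simp only [blockMoment, (pathSum_limitMoment_aux h0 hα hβ hm n).1]
  simp [hD']

lemma tendsto_partialTransposeMoment {D : ℕ} (hD : 0 < D) {γ : ℝ} {d p : ℕ → ℕ}
    (hd : Tendsto d atTop atTop) (hp : Tendsto (fun N => (p N : ℝ) / d N) atTop (𝓝 γ)) (n : ℕ) :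
    Tendsto (fun N => (D : ℝ) ^ n * partialTransposeMoment n (d N) D (p N)) atTop
      (𝓝 (blockMoment γ D n)) := by
  have hD' : (D : ℝ) ≠ 0 := by positivity
  have h1 : Tendsto (fun N => (D : ℝ)⁻¹ * ∑ a : Fin D, pathSum n a a fun w =>
      gaussianExpect _ (wordTraces (d N) (p N) [w]) / (d N : ℝ) ^ wordsSize [w]) atTop
      (𝓝 (blockMoment γ D n)) := by
    refine Tendsto.const_mul _ (tendsto_finsetSum _ fun a _ => tendsto_pathSum fun w => ?_)
    simpa using tendsto_gaussianExpect_wordTraces hd hp [w]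
  refine h1.congr fun N => ?_
  rw [partialTransposeMoment, trace_genericPartialTranspose_pow, map_sum, mul_pow]
  have h3 : ∀ a : Fin D, (pathSum n a a fun w =>
      gaussianExpect _ (wordTraces (d N) (p N) [w]) / (d N : ℝ) ^ wordsSize [w]) =
      gaussianExpect _ (pathSum n a a (wordTrace (d N) (p N))) * ((d N : ℝ) ^ (n + 1))⁻¹ := by
    intro a
    have e := map_pathSum ((AddMonoidHom.mulRight ((d N : ℝ) ^ (n + 1))⁻¹).comp
      (gaussianExpect (Fin (d N) × Fin D × Fin (p N))).toAddMonoidHom) n a a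
      (wordTrace (d N) (p N))
    simp only [AddMonoidHom.comp_apply, AddMonoidHom.coe_mulRight, LinearMap.toAddMonoidHom_coe] at e
    rw [e]
    refine pathSum_congr fun w hw => ?_
    simp [wordTraces, wordsSize, hw, div_eq_mul_inv]
  simp only [h3, ← Finset.sum_mul]
  rw [pow_succ (D : ℝ)]
  field_simp


/-! ### The Wick formula and the expansion in powers of the dimensions -/

/-- Wick's formula, by integrating the first factor by parts repeatedly. The list of pairings is
chosen before `σ` and `f`; this is what makes the exponents below independent of the dimensions. -/
lemma exists_pairings {Q : Type*} (l : List Q) : ∃ Ps : List (List (Q × Q)),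
    ∀ {σ : Type} [Fintype σ] [DecidableEq σ] (f : Q → σ),
      gaussianExpect σ (l.map fun q => MvPolynomial.X (f q)).prod =
        (Ps.map fun P => if ∀ e ∈ P, f e.1 = f e.2 then (1 : ℝ) else 0).sum := by
  induction hn : l.length using Nat.strong_induction_on generalizing l with
  | _ n ih =>
  rcases l with _ | ⟨q, l⟩
  · exact ⟨[[]], by simp [gaussianExpect_one]⟩
  · have h : ∀ r : {r // r ∈ splits l}, ∃ Ps : List (List (Q × Q)),
        ∀ {σ : Type} [Fintype σ] [DecidableEq σ] (f : Q → σ),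
        gaussianExpect σ ((r.1.1 ++ r.1.2.2).map fun q => MvPolynomial.X (f q)).prod =
        (Ps.map fun P => if ∀ e ∈ P, f e.1 = f e.2 then (1 : ℝ) else 0).sum := by
      intro r
      have := length_of_mem_splits r.2
      refine ih _ ?_ _ rfl
      simp only [List.length_cons, List.length_append] at hn ⊢
      omega
    choose Ps hPs using h
    refine ⟨(splits l).attach.flatMap fun r => (Ps r).map fun P => (r.1.2.1, q) :: P, ?_⟩
    intro σ _ _ f
    rw [List.map_cons, List.prod_cons, gaussianExpect_X_mul, Derivation.leibniz_list_prod,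
      map_list_sum, List.map_map, List.map_flatMap, List.flatMap_def,
      List.sum_flatten, List.map_map,
      ← List.attach_map_val (f := _ ∘ _) (l := splits l)]
    congr 2
    ext1 r
    simp only [Function.comp_apply, MvPolynomial.pderiv_X, List.map_map]
    by_cases hq : f r.1.2.1 = f q
    · simp only [hq, Pi.single_eq_same, mul_one, ← List.prod_append, ← List.map_append, hPs r f]
      refine congrArg List.sum (List.map_congr_left fun P _ => ?_)
      exact if_congr (by simp [hq]) rfl rfl
    · simp [hq, Function.comp_def]

/-- Functions that respect `r` are functions on `Quot r`. -/
lemma sum_ite_forall_rel {T : Type*} [Fintype T] [DecidableEq T] (d : ℕ) (r : T → T → Prop)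
    [DecidablePred fun g : T → Fin d => ∀ a b, r a b → g a = g b] :
    ∑ g : T → Fin d, (if ∀ a b, r a b → g a = g b then (1 : ℝ) else 0) =
      (d : ℝ) ^ Nat.card (Quot r) := by
  classical
  have e : {g : T → Fin d // ∀ a b, r a b → g a = g b} ≃ (Quot r → Fin d) :=
    { toFun := fun g => Quot.lift g.1 g.2
      invFun := fun h => ⟨fun a => h (Quot.mk r a), fun a b hab => congrArg h (Quot.sound hab)⟩
      left_inv := fun g => rfl
      right_inv := fun h => by ext1 x; induction x using Quot.ind; rfl }
  rw [Finset.sum_boole, ← Fintype.card_subtype]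
  have : Finite (Quot r) := Quot.finite r
  have := Fintype.ofFinite (Quot r)
  rw [Fintype.card_congr e, Nat.card_eq_fintype_card]
  simp

lemma Matrix.pow_apply_eq_sum_paths {R ι : Type*} [CommRing R] [Fintype ι] [DecidableEq ι]
    (M : Matrix ι ι R) (n : ℕ) (a b : ι) :
    (M ^ n) a b = ∑ x : Fin (n + 1) → ι, if x 0 = a ∧ x (Fin.last n) = b then
      ∏ l : Fin n, M (x l.castSucc) (x l.succ) else 0 := by
  induction n generalizing a with
  | zero =>
    rw [← (Equiv.funUnique (Fin 1) ι).symm.sum_comp]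
    simp only [pow_zero, Matrix.one_apply, Finset.univ_eq_empty, Finset.prod_empty]
    have : ∀ i, ((Equiv.funUnique (Fin 1) ι).symm i 0 = a ∧
        (Equiv.funUnique (Fin 1) ι).symm i (Fin.last 0) = b) ↔ i = a ∧ a = b := fun i =>
      ⟨fun h => ⟨h.1, h.1.symm.trans h.2⟩, fun h => ⟨h.1, h.1.trans h.2⟩⟩
    simp only [this, ite_and]
    simp
  | succ n ih =>
    rw [pow_succ', Matrix.mul_apply, ← (Fin.consEquiv fun _ : Fin (n + 2) => ι).sum_comp,
      Fintype.sum_prod_type]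
    simp only [Fin.consEquiv_apply, Fin.cons_zero, ← Fin.succ_last, Fin.cons_succ,
      Fin.prod_univ_succ (n := n), Fin.castSucc_zero, ← Fin.succ_castSucc, ite_and]
    conv_rhs => rw [Finset.sum_eq_single a (fun c _ hc => by simp [hc]) (by simp)]
    simp only [if_true, ih, Finset.mul_sum]
    rw [Finset.sum_comm]
    refine Finset.sum_congr rfl fun x _ => ?_
    simp only [ite_and, mul_ite, mul_zero]
    simp

lemma Matrix.trace_pow_eq_sum_paths {R ι : Type*} [CommRing R] [Fintype ι] [DecidableEq ι]
    (M : Matrix ι ι R) (n : ℕ) :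
    (M ^ n).trace = ∑ x : Fin (n + 1) → ι, if x 0 = x (Fin.last n) then
      ∏ l : Fin n, M (x l.castSucc) (x l.succ) else 0 := by
  simp only [Matrix.trace, Matrix.diag, Matrix.pow_apply_eq_sum_paths]
  rw [Finset.sum_comm]
  refine Finset.sum_congr rfl fun x _ => ?_
  simp only [ite_and]
  simp [eq_comm]

/-- The position of the first index of the factor `q` in a trace of a power. -/
def indexPos {n : ℕ} (q : Fin n × Bool) : Fin (n + 1) := if q.2 then q.1.succ else q.1.castSucc

/-- The position of the second index of the factor `q` in a trace of a power. -/
def indexPosSwap {n : ℕ} (q : Fin n × Bool) : Fin (n + 1) := indexPos (q.1, !q.2)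

/-- The factor `l` contributes the two variables `X (i_l, s_{l+1}, k_l)` and `X (i_{l+1}, s_l,
k_l)`, told apart by the Boolean. The partial transpose is visible in `i` and `s` sitting at
opposite ends of the step. -/
lemma gaussianExpect_trace_eq_sum (n d₁ d₂ p : ℕ) :
    gaussianExpect _ (genericPartialTranspose d₁ d₂ p ^ n).trace =
      ∑ i : Fin (n + 1) → Fin d₁, ∑ s : Fin (n + 1) → Fin d₂, ∑ k : Fin n → Fin p,
        if i 0 = i (Fin.last n) ∧ s 0 = s (Fin.last n) then gaussianExpect _
          (∏ q : Fin n × Bool, MvPolynomial.X (i (indexPos q), s (indexPosSwap q), k q.1)) else 0 := by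
  rw [Matrix.trace_pow_eq_sum_paths, ← (Equiv.arrowProdEquivProdArrow _ _ _).symm.sum_comp,
    Fintype.sum_prod_type, map_sum]
  refine Finset.sum_congr rfl fun i _ => ?_
  rw [map_sum]
  refine Finset.sum_congr rfl fun s _ => ?_
  simp only [Equiv.arrowProdEquivProdArrow, Equiv.coe_fn_symm_mk, Prod.mk.injEq]
  split_ifs with h
  · simp only [genericPartialTranspose, Matrix.of_apply, Finset.prod_univ_sum,
      Fintype.piFinset_univ, map_sum]
    refine Finset.sum_congr rfl fun k _ => ?_
    rw [Fintype.prod_prod_type]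
    simp [indexPos, indexPosSwap, mul_comm]
  · simp

/-- Exchanging the two variables of every factor interchanges `indexPos` and `indexPosSwap`, and
with them the roles of the two tensor factors. -/
lemma gaussianExpect_trace_eq_sum_swap (n d₁ d₂ p : ℕ) :
    gaussianExpect _ (genericPartialTranspose d₁ d₂ p ^ n).trace =
      ∑ i : Fin (n + 1) → Fin d₁, ∑ s : Fin (n + 1) → Fin d₂, ∑ k : Fin n → Fin p,
        if i 0 = i (Fin.last n) ∧ s 0 = s (Fin.last n) then gaussianExpect _
          (∏ q : Fin n × Bool, MvPolynomial.X (i (indexPosSwap q), s (indexPos q), k q.1)) else 0 := by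
  rw [gaussianExpect_trace_eq_sum]
  refine Finset.sum_congr rfl fun i _ => Finset.sum_congr rfl fun s _ =>
    Finset.sum_congr rfl fun k _ => ?_
  congr 2
  rw [Fintype.prod_prod_type, Fintype.prod_prod_type]
  simp [indexPos, indexPosSwap, mul_comm]

/-- Closed index paths that are compatible with a pairing of the factors. -/
def pathRel {n : ℕ} (h : Fin n × Bool → Fin (n + 1)) (P : List ((Fin n × Bool) × (Fin n × Bool)))
    (x y : Fin (n + 1)) : Prop :=
  (x = 0 ∧ y = Fin.last n) ∨ ∃ e ∈ P, x = h e.1 ∧ y = h e.2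

lemma forall_pathRel_iff {n d : ℕ} (h : Fin n × Bool → Fin (n + 1))
    (P : List ((Fin n × Bool) × (Fin n × Bool))) (i : Fin (n + 1) → Fin d) :
    (∀ x y, pathRel h P x y → i x = i y) ↔
      i 0 = i (Fin.last n) ∧ ∀ e ∈ P, i (h e.1) = i (h e.2) := by
  constructor
  · exact fun H => ⟨H _ _ (Or.inl ⟨rfl, rfl⟩), fun e he => H _ _ (Or.inr ⟨e, he, rfl, rfl⟩)⟩
  · rintro ⟨H1, H2⟩ x y (⟨rfl, rfl⟩ | ⟨e, he, rfl, rfl⟩)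
    · exact H1
    · exact H2 e he

open Classical in
-- The constraint imposed by a pairing separates into constraints on `i`, on `s` and on `k`, each
-- counted by a power of its dimension.
lemma sum_pairing_indicator {n d₁ d₂ p : ℕ} (h h' : Fin n × Bool → Fin (n + 1))
    (P : List ((Fin n × Bool) × (Fin n × Bool))) :
    (∑ i : Fin (n + 1) → Fin d₁, ∑ s : Fin (n + 1) → Fin d₂, ∑ k : Fin n → Fin p,
      if i 0 = i (Fin.last n) ∧ s 0 = s (Fin.last n) then
        if ∀ e ∈ P, (i (h e.1), s (h' e.1), k e.1.1) = (i (h e.2), s (h' e.2), k e.2.1)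
          then (1 : ℝ) else 0 else 0) =
      (d₁ : ℝ) ^ Nat.card (Quot (pathRel h P)) * (d₂ : ℝ) ^ Nat.card (Quot (pathRel h' P)) *
        (p : ℝ) ^ Nat.card (Quot fun x y : Fin n => ∃ e ∈ P, x = e.1.1 ∧ y = e.2.1) := by
  rw [← sum_ite_forall_rel, ← sum_ite_forall_rel, ← sum_ite_forall_rel, Finset.sum_mul_sum,
    Finset.sum_mul]
  refine Finset.sum_congr rfl fun i _ => ?_
  rw [Finset.sum_mul_sum]
  refine Finset.sum_congr rfl fun s _ => Finset.sum_congr rfl fun k _ => ?_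
  have hk : (∀ x y : Fin n, (∃ e ∈ P, x = e.1.1 ∧ y = e.2.1) → k x = k y) ↔
      ∀ e ∈ P, k e.1.1 = k e.2.1 := by
    constructor
    · exact fun H e he => H _ _ ⟨e, he, rfl, rfl⟩
    · rintro H x y ⟨e, he, rfl, rfl⟩
      exact H e he
  simp only [forall_pathRel_iff, hk, ← ite_and, mul_ite, mul_one, mul_zero, Prod.mk.injEq]
  congr 1
  simp only [eq_iff_iff]
  constructor
  · rintro ⟨⟨h1, h2⟩, h3⟩
    exact ⟨fun e he => (h3 e he).2.2, ⟨h2, fun e he => (h3 e he).2.1⟩, h1, fun e he => (h3 e he).1⟩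
  · rintro ⟨h1, ⟨h2, h3⟩, h4, h5⟩
    exact ⟨⟨h4, h2⟩, fun e he => ⟨h5 e he, h3 e he, h1 e he⟩⟩

/-- The expected trace of a power of the partial transpose is a polynomial with nonnegative
coefficients in the dimensions, which is symmetric in the sizes of the two tensor factors. -/
lemma exists_exponents (n : ℕ) : ∃ L : List (ℕ × ℕ × ℕ), ∀ d₁ d₂ p : ℕ,
    gaussianExpect _ (genericPartialTranspose d₁ d₂ p ^ n).trace =
      (L.map fun t => (d₁ : ℝ) ^ t.1 * (d₂ : ℝ) ^ t.2.1 * (p : ℝ) ^ t.2.2).sum ∧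
    gaussianExpect _ (genericPartialTranspose d₂ d₁ p ^ n).trace =
      (L.map fun t => (d₁ : ℝ) ^ t.1 * (d₂ : ℝ) ^ t.2.1 * (p : ℝ) ^ t.2.2).sum := by
  classical
  obtain ⟨Ps, hPs⟩ := exists_pairings (Finset.univ : Finset (Fin n × Bool)).toList
  have hPs' : ∀ {σ : Type} [Fintype σ] [DecidableEq σ] (f : Fin n × Bool → σ),
      gaussianExpect σ (∏ q, MvPolynomial.X (f q)) =
        (Ps.map fun P => if ∀ e ∈ P, f e.1 = f e.2 then (1 : ℝ) else 0).sum := by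
    intro σ _ _ f
    rw [← Finset.prod_map_toList, hPs f]
    congr!
  -- The index maps are parameters, so that one computation serves both orders of the tensor
  -- factors.
  have key : ∀ (h h' : Fin n × Bool → Fin (n + 1)) (d₁ d₂ p : ℕ),
      (∑ i : Fin (n + 1) → Fin d₁, ∑ s : Fin (n + 1) → Fin d₂, ∑ k : Fin n → Fin p,
        if i 0 = i (Fin.last n) ∧ s 0 = s (Fin.last n) then gaussianExpect _
          (∏ q : Fin n × Bool, MvPolynomial.X (i (h q), s (h' q), k q.1)) else 0) =
      (Ps.map fun P => (d₁ : ℝ) ^ Nat.card (Quot (pathRel h P)) *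
        (d₂ : ℝ) ^ Nat.card (Quot (pathRel h' P)) *
        (p : ℝ) ^ Nat.card (Quot fun x y : Fin n => ∃ e ∈ P, x = e.1.1 ∧ y = e.2.1)).sum := by
    intro h h' d₁ d₂ p
    simp only [← sum_pairing_indicator, ← Finset.sum_list_sum_map, hPs']
    refine Finset.sum_congr rfl fun i _ => Finset.sum_congr rfl fun s _ =>
      Finset.sum_congr rfl fun k _ => ?_
    split_ifs <;> simp
  refine ⟨Ps.map fun P => (Nat.card (Quot (pathRel indexPos P)),
    Nat.card (Quot (pathRel indexPosSwap P)),
    Nat.card (Quot fun x y : Fin n => ∃ e ∈ P, x = e.1.1 ∧ y = e.2.1)), fun d₁ d₂ p => ⟨?_, ?_⟩⟩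
  · rw [gaussianExpect_trace_eq_sum, key, List.map_map]
    rfl
  · rw [gaussianExpect_trace_eq_sum_swap, key, List.map_map]
    congr 2
    ext1 P
    simp only [Function.comp_apply]
    ring


/-! ### The limit when both tensor factors grow -/

lemma partialTransposeMoment_comm (n d₁ d₂ p : ℕ) :
    partialTransposeMoment n d₁ d₂ p = partialTransposeMoment n d₂ d₁ p := by
  obtain ⟨L, hL⟩ := exists_exponents n
  rw [partialTransposeMoment, partialTransposeMoment, (hL d₁ d₂ p).1, (hL d₁ d₂ p).2,
    mul_comm (d₁ : ℝ)]

/-- Positive terms cannot cancel, so a single exponent above `A` would force divergence. -/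
lemma exponent_le_of_tendsto {α : Type*} (L : List α) (e : α → ℕ) (A : ℕ) {x : ℝ}
    (h : Tendsto (fun N : ℕ => (L.map fun t => ((N + 1 : ℕ) : ℝ) ^ e t).sum /
      ((N + 1 : ℕ) : ℝ) ^ A) atTop (𝓝 x)) : ∀ t ∈ L, e t ≤ A := by
  intro t ht
  by_contra! hlt
  refine not_tendsto_nhds_of_tendsto_atTop (tendsto_atTop_mono (fun N => ?_)
    (tendsto_natCast_atTop_atTop (R := ℝ))) x h
  have hN : (1 : ℝ) ≤ ((N + 1 : ℕ) : ℝ) := by simp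
  rw [le_div_iff₀ (by positivity)]
  calc (N : ℝ) * ((N + 1 : ℕ) : ℝ) ^ A ≤ ((N + 1 : ℕ) : ℝ) * ((N + 1 : ℕ) : ℝ) ^ A := by
        gcongr; simp
    _ = ((N + 1 : ℕ) : ℝ) ^ (A + 1) := by ring
    _ ≤ ((N + 1 : ℕ) : ℝ) ^ e t := pow_le_pow_right₀ hN hlt
    _ ≤ _ := by
        refine List.single_le_sum (fun y hy => ?_) _ (List.mem_map.2 ⟨t, ht, rfl⟩)
        obtain ⟨s, -, rfl⟩ := List.mem_map.1 hy
        positivity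

/-- With one dimension equal to `1` and `p` equal to the other, the moments converge. This bounds
the joint exponent of `d₁` and `p`, and by symmetry that of `d₂` and `p`, by `n + 1`; dividing by
the normalisation leaves only nonnegative powers of `1/d₁` and `1/d₂`. -/
lemma exists_exponents_le (n : ℕ) : ∃ L : List (ℕ × ℕ × ℕ), ∀ d₁ d₂ p : ℕ, 0 < d₁ → 0 < d₂ →
    partialTransposeMoment n d₁ d₂ p = (L.map fun t => ((p : ℝ) / (d₁ * d₂)) ^ t.2.2 *
      ((d₁ : ℝ)⁻¹) ^ t.1 * ((d₂ : ℝ)⁻¹) ^ t.2.1).sum := by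
  obtain ⟨L, hL⟩ := exists_exponents n
  have hone : Tendsto (fun N : ℕ => (((N + 1 : ℕ)) : ℝ) / ((N + 1 : ℕ) : ℝ)) atTop (𝓝 1) :=
    tendsto_const_nhds.congr fun N => (div_self (by positivity)).symm
  have hlim := tendsto_partialTransposeMoment one_pos (tendsto_add_atTop_nat 1) hone n
  have h1 : ∀ t ∈ L, t.1 + t.2.2 ≤ n + 1 := by
    refine exponent_le_of_tendsto L (fun t => t.1 + t.2.2) (n + 1) (hlim.congr fun N => ?_)
    rw [partialTransposeMoment, (hL _ _ _).1]
    simp [pow_add]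
  have h2 : ∀ t ∈ L, t.2.1 + t.2.2 ≤ n + 1 := by
    refine exponent_le_of_tendsto L (fun t => t.2.1 + t.2.2) (n + 1) (hlim.congr fun N => ?_)
    rw [partialTransposeMoment, (hL _ _ _).2]
    simp [pow_add]
  refine ⟨L.map fun t => (n + 1 - (t.1 + t.2.2), n + 1 - (t.2.1 + t.2.2), t.2.2), ?_⟩
  intro d₁ d₂ p hd₁ hd₂
  have hd₁' : (d₁ : ℝ) ≠ 0 := by positivity
  have hd₂' : (d₂ : ℝ) ≠ 0 := by positivity
  rw [partialTransposeMoment, (hL _ _ _).1, List.map_map, div_eq_mul_inv, ← List.sum_map_mul_right]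
  refine congrArg List.sum (List.map_congr_left fun t ht => ?_)
  obtain ⟨j, hj⟩ := Nat.exists_eq_add_of_le (h1 t ht)
  obtain ⟨k, hk⟩ := Nat.exists_eq_add_of_le (h2 t ht)
  simp only [Function.comp_apply]
  rw [show n + 1 - (t.1 + t.2.2) = j by omega, show n + 1 - (t.2.1 + t.2.2) = k by omega, mul_pow]
  nth_rw 1 [hj]
  rw [hk]
  simp only [div_pow, mul_pow, inv_pow, pow_add]
  field_simp

lemma tendsto_inv_pow_natCast {d : ℕ → ℕ} (hd : Tendsto d atTop atTop) (k : ℕ) :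
    Tendsto (fun N => ((d N : ℝ)⁻¹) ^ k) atTop (𝓝 (0 ^ k)) :=
  ((tendsto_inv_atTop_zero.comp (tendsto_natCast_atTop_atTop (R := ℝ))).comp hd).pow k

/-- A polynomial in `p/(d₁ d₂)`, `1/d₁`, `1/d₂` is continuous, so its joint limit is the iterated
limit supplied by the block moments. -/
lemma tendsto_partialTransposeMoment_of_tendsto_atTop {c x : ℝ} (hc : 0 < c) (n : ℕ)
    {d₁ d₂ p : ℕ → ℕ} (h₁ : Tendsto d₁ atTop atTop) (h₂ : Tendsto d₂ atTop atTop)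
    (hp : Tendsto (fun N => (p N : ℝ) / ((d₁ N : ℝ) * (d₂ N : ℝ))) atTop (𝓝 c))
    (hx : Tendsto (fun D : ℕ => blockMoment (c * D) D n / (D : ℝ) ^ n) atTop (𝓝 x)) :
    Tendsto (fun N => partialTransposeMoment n (d₁ N) (d₂ N) (p N)) atTop (𝓝 x) := by
  obtain ⟨L, hL⟩ := exists_exponents_le n
  have h3 : Tendsto (fun N => partialTransposeMoment n (d₁ N) (d₂ N) (p N)) atTop
      (𝓝 (L.map fun t => c ^ t.2.2 * 0 ^ t.1 * 0 ^ t.2.1).sum) := by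
    refine Tendsto.congr' ?_ (tendsto_list_sum L fun t _ =>
      ((hp.pow t.2.2).mul (tendsto_inv_pow_natCast h₁ t.1)).mul (tendsto_inv_pow_natCast h₂ t.2.1))
    filter_upwards [h₁.eventually_gt_atTop 0, h₂.eventually_gt_atTop 0] with N hN₁ hN₂
    exact (hL _ _ _ hN₁ hN₂).symm
  have h4 : ∀ D : ℕ, 0 < D → blockMoment (c * D) D n / (D : ℝ) ^ n =
      (L.map fun t => c ^ t.2.2 * 0 ^ t.1 * ((D : ℝ)⁻¹) ^ t.2.1).sum := by
    intro D hD
    have hD' : (D : ℝ) ≠ 0 := by positivity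
    -- The test sequence `d₁ = N`, `d₂ = D`, `p = ⌊c D N⌋` has the ratio `c` in the limit; computing
    -- its limit in two ways expresses the block moment through the exponents.
    have hfl : Tendsto (fun N : ℕ => ((⌊c * D * (N : ℝ)⌋₊ : ℕ) : ℝ) / (N : ℝ)) atTop
        (𝓝 (c * D)) :=
      (tendsto_nat_floor_mul_div_atTop (by positivity)).comp tendsto_natCast_atTop_atTop
    have h5 := (tendsto_partialTransposeMoment hD tendsto_id hfl n).div_const ((D : ℝ) ^ n)
    refine tendsto_nhds_unique h5 ?_
    have h6 : Tendsto (fun N : ℕ => ((⌊c * D * (N : ℝ)⌋₊ : ℕ) : ℝ) / ((N : ℝ) * D)) atTop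
        (𝓝 c) := by
      have := hfl.div_const (D : ℝ)
      rw [mul_div_cancel_right₀ _ hD'] at this
      exact this.congr fun N => by rw [div_div]
    refine Tendsto.congr' ?_ (tendsto_list_sum L fun t _ =>
      ((h6.pow t.2.2).mul (tendsto_inv_pow_natCast tendsto_id t.1)).mul tendsto_const_nhds)
    filter_upwards [eventually_gt_atTop 0] with N hN
    rw [mul_div_cancel_left₀ _ (by positivity)]
    exact (hL _ _ _ hN hD).symm
  have h7 : Tendsto (fun D : ℕ => blockMoment (c * D) D n / (D : ℝ) ^ n) atTop
      (𝓝 (L.map fun t => c ^ t.2.2 * 0 ^ t.1 * 0 ^ t.2.1).sum) := by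
    refine Tendsto.congr' ?_ (tendsto_list_sum L fun t _ =>
      tendsto_const_nhds.mul (tendsto_inv_pow_natCast tendsto_id t.2.1))
    filter_upwards [eventually_gt_atTop 0] with D hD
    exact (h4 D hD).symm
  rw [tendsto_nhds_unique hx h7]
  exact h3


/-! ### From Gaussian polynomials to the random matrices -/

section

variable {Ω : Type*} [MeasurableSpace Ω] {P : Measure Ω} {d₁ d₂ p : ℕ}

lemma partialTranspose_wishart (G : Fin d₁ → Matrix (Fin d₂) (Fin p) ℝ) :
    partialTranspose (wishart G) = ((d₁ : ℝ) * d₂)⁻¹ • (MvPolynomial.eval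
      fun t : Fin d₁ × Fin d₂ × Fin p => G t.1 t.2.1 t.2.2).mapMatrix
        (genericPartialTranspose d₁ d₂ p) := by
  ext x y
  simp [partialTranspose, wishart, genericPartialTranspose, Matrix.mul_apply]

lemma integral_normalizedTrace_pow {G : Ω → Fin d₁ → Matrix (Fin d₂) (Fin p) ℝ}
    (hG : IsStandardGaussianBlocks P G) (r : ℝ) (n : ℕ) :
    Integrable (fun ω => normalizedTrace ((r • partialTranspose (wishart (G ω))) ^ n)) P ∧
    ∫ ω, normalizedTrace ((r • partialTranspose (wishart (G ω))) ^ n) ∂P =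
      r ^ n * partialTransposeMoment n d₁ d₂ p := by
  have h1 : ∀ ω, normalizedTrace ((r • partialTranspose (wishart (G ω))) ^ n) =
      MvPolynomial.eval (fun t : Fin d₁ × Fin d₂ × Fin p => G ω t.1 t.2.1 t.2.2)
        (genericPartialTranspose d₁ d₂ p ^ n).trace * (r ^ n / ((d₁ : ℝ) * d₂) ^ (n + 1)) := by
    intro ω
    rw [partialTranspose_wishart, smul_smul, smul_pow, ← map_pow, normalizedTrace,
      Matrix.trace_smul, RingHom.mapMatrix_apply, smul_eq_mul, mul_pow,
      pow_succ, inv_pow]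
    have e : (MvPolynomial.eval fun t : Fin d₁ × Fin d₂ × Fin p => G ω t.1 t.2.1 t.2.2).toAddMonoidHom
        (genericPartialTranspose d₁ d₂ p ^ n).trace = MvPolynomial.eval
        (fun t : Fin d₁ × Fin d₂ × Fin p => G ω t.1 t.2.1 t.2.2)
        (genericPartialTranspose d₁ d₂ p ^ n).trace := rfl
    rw [← e, AddMonoidHom.map_trace]
    simp only [div_eq_mul_inv, mul_inv]
    rw [show ∀ a b x y : ℝ, a * b * x * y = x * (a * (b * y)) from fun a b x y => by ring]
    rfl
  have h2 := integral_eval_eq_gaussianExpect (P := P)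
    (g := fun (t : Fin d₁ × Fin d₂ × Fin p) ω => G ω t.1 t.2.1 t.2.2)
    (fun t => hG.law _ _ _) hG.indep (genericPartialTranspose d₁ d₂ p ^ n).trace
  simp only [h1]
  refine ⟨h2.1.mul_const _, ?_⟩
  rw [integral_mul_const, h2.2, partialTransposeMoment]
  ring

end

section

variable {Ω : ℕ → Type*} [∀ N, MeasurableSpace (Ω N)] {P : ∀ N, Measure (Ω N)} {d₁ d₂ p : ℕ → ℕ}
  {G : ∀ N, Ω N → Fin (d₁ N) → Matrix (Fin (d₂ N)) (Fin (p N)) ℝ} {c : ℝ}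

lemma hasAsymptoticMoments_smul_of_tendsto (hG : ∀ N, IsStandardGaussianBlocks (P N) (G N)) (r : ℝ)
    {m : ℕ → ℝ} (h : ∀ n, Tendsto (fun N => r ^ n * partialTransposeMoment n (d₁ N) (d₂ N) (p N))
      atTop (𝓝 (m n))) :
    HasAsymptoticMoments P (fun N ω => r • partialTranspose (wishart (G N ω))) m := fun n =>
  ⟨fun N => (integral_normalizedTrace_pow (hG N) r n).1,
    (h n).congr fun N => (integral_normalizedTrace_pow (hG N) r n).2.symm⟩

lemma tendsto_div_of_tendsto_div_mul {d p : ℕ → ℕ} {D : ℕ} (hD : 0 < D)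
    (hp : Tendsto (fun N => (p N : ℝ) / ((d N : ℝ) * D)) atTop (𝓝 c)) :
    Tendsto (fun N => (p N : ℝ) / (d N : ℝ)) atTop (𝓝 (c * D)) := by
  have hD' : (D : ℝ) ≠ 0 := by positivity
  refine (hp.mul_const (D : ℝ)).congr fun N => ?_
  rw [← div_div, div_mul_cancel₀ _ hD']

lemma hasAsymptoticMoments_of_right_fixed (hG : ∀ N, IsStandardGaussianBlocks (P N) (G N))
    (hp : Tendsto (fun N => (p N : ℝ) / ((d₁ N : ℝ) * (d₂ N : ℝ))) atTop (𝓝 c)) {D : ℕ}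
    (hD : 0 < D) (h₁ : Tendsto d₁ atTop atTop) (h₂ : ∀ N, d₂ N = D) :
    HasAsymptoticMoments P (fun N ω => (D : ℝ) • partialTranspose (wishart (G N ω)))
      (blockMoment (c * D) D) := by
  refine hasAsymptoticMoments_smul_of_tendsto hG D fun n => ?_
  simp only [h₂] at hp ⊢
  exact tendsto_partialTransposeMoment hD h₁ (tendsto_div_of_tendsto_div_mul hD hp) n

lemma hasAsymptoticMoments_of_left_fixed (hG : ∀ N, IsStandardGaussianBlocks (P N) (G N))
    (hp : Tendsto (fun N => (p N : ℝ) / ((d₁ N : ℝ) * (d₂ N : ℝ))) atTop (𝓝 c)) {D : ℕ}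
    (hD : 0 < D) (h₁ : ∀ N, d₁ N = D) (h₂ : Tendsto d₂ atTop atTop) :
    HasAsymptoticMoments P (fun N ω => (D : ℝ) • partialTranspose (wishart (G N ω)))
      (blockMoment (c * D) D) := by
  refine hasAsymptoticMoments_smul_of_tendsto hG D fun n => ?_
  simp only [h₁, mul_comm (D : ℝ) (d₂ _ : ℝ), partialTransposeMoment_comm n D] at hp ⊢
  exact tendsto_partialTransposeMoment hD h₂ (tendsto_div_of_tendsto_div_mul hD hp) n

lemma hasAsymptoticMoments_of_tendsto_atTop (hG : ∀ N, IsStandardGaussianBlocks (P N) (G N))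
    (hc : 0 < c) (hp : Tendsto (fun N => (p N : ℝ) / ((d₁ N : ℝ) * (d₂ N : ℝ))) atTop (𝓝 c))
    (h₁ : Tendsto d₁ atTop atTop) (h₂ : Tendsto d₂ atTop atTop) {m : ℕ → ℝ}
    (hm : ∀ n, Tendsto (fun D : ℕ => blockMoment (c * D) D n / (D : ℝ) ^ n) atTop (𝓝 (m n))) :
    HasAsymptoticMoments P (fun N ω => partialTranspose (wishart (G N ω))) m := by
  have := hasAsymptoticMoments_smul_of_tendsto hG 1 (m := m) fun n => by
    simpa using tendsto_partialTransposeMoment_of_tendsto_atTop hc n h₁ h₂ hp (hm n)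
  simpa using this

end

/-! ### The moments of the limit -/

/-- The solution `f` of the linear recursion `f n = g n + ε ∑_{j < n} f j m (n - 1 - j)`. -/
def convolutionSolution (g m : ℕ → ℝ) (ε : ℝ) : ℕ → ℝ
  | n => g n + ε * ∑ j : Fin n, convolutionSolution g m ε j * m (n - 1 - j)
decreasing_by exact j.2

lemma convolutionSolution_eq (g m : ℕ → ℝ) (ε : ℝ) (n : ℕ) : convolutionSolution g m ε n =
    g n + ε * ∑ j ∈ Finset.range n, convolutionSolution g m ε j * m (n - 1 - j) := by
  rw [convolutionSolution, Finset.sum_range]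

lemma eq_smul_convolutionSolution {g m f : ℕ → ℝ} {ε r : ℝ}
    (hf : ∀ n, f n = r * g n + ε * ∑ j ∈ Finset.range n, f j * m (n - 1 - j)) (n : ℕ) :
    f n = r * convolutionSolution g m ε n := by
  induction n using Nat.strong_induction_on with
  | _ n ih =>
  rw [hf, convolutionSolution_eq, mul_add, mul_left_comm r ε, Finset.mul_sum _ _ r]
  congr 2
  refine Finset.sum_congr rfl fun j hj => ?_
  rw [ih j (Finset.mem_range.1 hj), mul_assoc]

/-- The sum `u = α + β` and the difference `v = α - β` decouple the system, and `X`, `Y` are their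
multiples by `(D ± 1)/2`. -/
lemma exists_block_recursion {D : ℕ} {γ : ℝ} {m X Y : ℕ → ℝ}
    (hX : ∀ n, X n = γ * ((D + 1) / 2) * m n + ∑ j ∈ Finset.range n, X j * m (n - 1 - j))
    (hY : ∀ n, Y n = γ * ((D - 1) / 2) * m n - ∑ j ∈ Finset.range n, Y j * m (n - 1 - j))
    (hm : ∀ n, m (n + 1) = X n - Y n) : ∃ α β : ℕ → ℝ,
      (∀ n, α n = γ * m n + ∑ j ∈ Finset.range n, β j * m (n - 1 - j)) ∧
      (∀ n, β n = ∑ j ∈ Finset.range n, α j * m (n - 1 - j)) ∧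
      (∀ n, m (n + 1) = α n + D * β n) := by
  -- `u` and `v` are built directly and not as quotients of `X` and `Y`, since the factor `(D -
  -- 1)/2` vanishes for `D = 1`.
  set u := convolutionSolution (fun n => γ * m n) m 1 with hu
  set v := convolutionSolution (fun n => γ * m n) m (-1) with hv
  have hXu : ∀ n, X n = ((D + 1) / 2) * u n := eq_smul_convolutionSolution fun n => by
    rw [hX]; ring
  have hYv : ∀ n, Y n = ((D - 1) / 2) * v n := eq_smul_convolutionSolution fun n => by
    rw [hY]; ring
  have hu' := convolutionSolution_eq (fun n => γ * m n) m 1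
  have hv' := convolutionSolution_eq (fun n => γ * m n) m (-1)
  rw [← hu] at hu'
  rw [← hv] at hv'
  refine ⟨fun n => (u n + v n) / 2, fun n => (u n - v n) / 2, fun n => ?_, fun n => ?_,
    fun n => ?_⟩
  · simp only [sub_div, sub_mul, Finset.sum_sub_distrib, div_mul_eq_mul_div, ← Finset.sum_div]
    rw [hu', hv']
    ring
  · simp only [add_div, add_mul, Finset.sum_add_distrib, div_mul_eq_mul_div, ← Finset.sum_div]
    rw [hu', hv']
    ring
  · rw [hm, hXu, hYv]
    ring

/-- The rescaled moments converge, as the dimension of the fixed tensor factor grows, to the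
moments of a semicircular element. -/
lemma tendsto_blockMoment_div_pow {c : ℝ} {M : ℕ → ℝ} (hM0 : M 0 = 1)
    (hM : ∀ n, M (n + 1) = c * M n + c * ∑ j ∈ Finset.range n, M j * M (n - 1 - j))
    (hex : ∀ D : ℕ, 0 < D → ∃ m α β : ℕ → ℝ, m 0 = 1 ∧
      (∀ n, α n = (c * D) * m n + ∑ j ∈ Finset.range n, β j * m (n - 1 - j)) ∧
      (∀ n, β n = ∑ j ∈ Finset.range n, α j * m (n - 1 - j)) ∧
      (∀ n, m (n + 1) = α n + D * β n)) (n : ℕ) :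
    Tendsto (fun D : ℕ => blockMoment (c * D) D n / (D : ℝ) ^ n) atTop (𝓝 (M n)) := by
  choose m α β h0 hα hβ hm using fun D : ℕ => hex (D + 1) D.succ_pos
  rw [← tendsto_add_atTop_iff_nat 1]
  refine Tendsto.congr (f₁ := fun D => m D n / ((D + 1 : ℕ) : ℝ) ^ n)
    (fun D => by rw [blockMoment_eq D.succ_pos (h0 D) (hα D) (hβ D) (hm D)]) ?_
  have hinv : Tendsto (fun D : ℕ => (((D + 1 : ℕ) : ℝ)⁻¹) ^ 2) atTop (𝓝 0) := by
    simpa using tendsto_inv_pow_natCast (tendsto_add_atTop_nat 1) 2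
  -- `α` is larger by one power of the dimension than `m` and `β`; hence the `β` sum in the
  -- recursion of `α` carries the inverse square of the dimension and disappears.
  have key : ∀ n, Tendsto (fun D => m D n / ((D + 1 : ℕ) : ℝ) ^ n) atTop (𝓝 (M n)) ∧
      Tendsto (fun D => α D n / ((D + 1 : ℕ) : ℝ) ^ (n + 1)) atTop (𝓝 (c * M n)) ∧
      Tendsto (fun D => β D n / ((D + 1 : ℕ) : ℝ) ^ n) atTop
        (𝓝 (c * ∑ j ∈ Finset.range n, M j * M (n - 1 - j))) := by
    intro n
    induction n using Nat.strong_induction_on with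
    | _ n ih =>
    have h1 : Tendsto (fun D => m D n / ((D + 1 : ℕ) : ℝ) ^ n) atTop (𝓝 (M n)) := by
      rcases n with _ | n
      · simp [h0, hM0]
      · rw [hM]
        refine ((ih n (by omega)).2.1.add (ih n (by omega)).2.2).congr fun D => ?_
        rw [hm]
        have : ((D + 1 : ℕ) : ℝ) ≠ 0 := by positivity
        field_simp
        ring
    have hpow : ∀ (D : ℕ) (j : ℕ), j ∈ Finset.range n → ((D + 1 : ℕ) : ℝ) ^ n =
        ((D + 1 : ℕ) : ℝ) ^ (j + 1) * ((D + 1 : ℕ) : ℝ) ^ (n - 1 - j) := by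
      intro D j hj
      rw [Finset.mem_range] at hj
      rw [← pow_add]
      congr 1
      omega
    refine ⟨h1, ?_, ?_⟩
    · have h2 : Tendsto (fun D => ∑ j ∈ Finset.range n, (β D j / ((D + 1 : ℕ) : ℝ) ^ j) *
          (m D (n - 1 - j) / ((D + 1 : ℕ) : ℝ) ^ (n - 1 - j))) atTop
          (𝓝 (∑ j ∈ Finset.range n, (c * ∑ i ∈ Finset.range j, M i * M (j - 1 - i)) *
            M (n - 1 - j))) :=
        tendsto_finsetSum _ fun j hj => by
          have hj' := Finset.mem_range.1 hj
          exact (ih j hj').2.2.mul (ih (n - 1 - j) (by omega)).1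
      have h3 := (h1.const_mul c).add (hinv.mul h2)
      rw [zero_mul, add_zero] at h3
      refine h3.congr fun D => ?_
      have hD : ((D + 1 : ℕ) : ℝ) ≠ 0 := by positivity
      rw [hα, add_div, Finset.sum_div, Finset.mul_sum]
      congr 1
      · field_simp
        ring
      · refine Finset.sum_congr rfl fun j hj => ?_
        rw [pow_succ _ n, hpow D j hj, pow_succ _ j, inv_pow]
        field_simp
    · have h2 : Tendsto (fun D => ∑ j ∈ Finset.range n, (α D j / ((D + 1 : ℕ) : ℝ) ^ (j + 1)) *
          (m D (n - 1 - j) / ((D + 1 : ℕ) : ℝ) ^ (n - 1 - j))) atTop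
          (𝓝 (∑ j ∈ Finset.range n, (c * M j) * M (n - 1 - j))) :=
        tendsto_finsetSum _ fun j hj => by
          have hj' := Finset.mem_range.1 hj
          exact (ih j hj').2.1.mul (ih (n - 1 - j) (by omega)).1
      simp only [mul_assoc, ← Finset.mul_sum] at h2
      refine h2.congr fun D => ?_
      have hD : ((D + 1 : ℕ) : ℝ) ≠ 0 := by positivity
      rw [hβ, Finset.sum_div]
      refine Finset.sum_congr rfl fun j hj => ?_
      rw [hpow D j hj]
      field_simp
  exact (key n).1


/-! ### Operators on the full Fock space over a two-dimensional space -/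

/-- The full Fock space over a two-dimensional Hilbert space. -/
abbrev FockSpace : Type := lp (fun _ : List Bool => ℂ) 2

/-- The orthonormal basis of the Fock space. -/
def fockBasis (w : List Bool) : FockSpace := lp.single 2 w 1

lemma fockBasis_apply (v w : List Bool) : fockBasis v w = if w = v then 1 else 0 := by
  simp [fockBasis, lp.single_apply, Pi.single_apply]

lemma inner_fockBasis_left (w : List Bool) (u : FockSpace) : inner ℂ (fockBasis w) u = u w := by
  simp [fockBasis, lp.inner_single_left]

lemma orthonormal_fockBasis : Orthonormal ℂ fockBasis := by
  classical
  rw [orthonormal_iff_ite]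
  intro v w
  rw [inner_fockBasis_left, fockBasis_apply]

/-- The isometry that permutes the basis vectors of the Fock space by an injective map. -/
def fockShift (f : List Bool → List Bool) (hf : Function.Injective f) :
    FockSpace →L[ℂ] FockSpace :=
  ((orthonormal_fockBasis.comp f hf).orthogonalFamily.linearIsometry).toContinuousLinearMap

variable {f : List Bool → List Bool} {hf : Function.Injective f}

lemma fockShift_fockBasis (w : List Bool) :
    fockShift f hf (fockBasis w) = fockBasis (f w) := by
  simp [fockShift, fockBasis]

lemma star_fockShift_apply (u : FockSpace) (w : List Bool) :
    (star (fockShift f hf) u : FockSpace) w = u (f w) := by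
  rw [← inner_fockBasis_left, ContinuousLinearMap.star_eq_adjoint,
    ContinuousLinearMap.adjoint_inner_right, fockShift_fockBasis, inner_fockBasis_left]

lemma fockShift_apply_map (u : FockSpace) (w : List Bool) : fockShift f hf u (f w) = u w := by
  rw [← inner_fockBasis_left, ← ContinuousLinearMap.adjoint_inner_left,
    ← ContinuousLinearMap.star_eq_adjoint, ← inner_fockBasis_left w]
  congr 1
  ext v
  rw [star_fockShift_apply, fockBasis_apply, fockBasis_apply]
  simp [hf.eq_iff]

lemma fockShift_apply_of_forall_ne (u : FockSpace) {w : List Bool} (h : ∀ v, f v ≠ w) :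
    fockShift f hf u w = 0 := by
  rw [← inner_fockBasis_left, ← ContinuousLinearMap.adjoint_inner_left,
    ← ContinuousLinearMap.star_eq_adjoint, show star (fockShift f hf) (fockBasis w) = 0 from ?_,
    inner_zero_left]
  ext v
  rw [star_fockShift_apply, fockBasis_apply, if_neg (h v)]
  rfl

/-- The left creation operators. -/
def leftCreation (b : Bool) : FockSpace →L[ℂ] FockSpace :=
  fockShift (fun w => b :: w) (List.cons_injective)

/-- The right creation operators. -/
def rightCreation (b : Bool) : FockSpace →L[ℂ] FockSpace :=
  fockShift (fun w => w ++ [b]) (List.append_left_injective [b])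

/-- The vacuum vector. -/
def vacuum : FockSpace := fockBasis []

lemma vacuum_cons (b : Bool) (w : List Bool) : vacuum (b :: w) = 0 := by
  simp [vacuum, fockBasis_apply]

lemma vacuum_nil : vacuum ([] : List Bool) = 1 := by
  simp [vacuum, fockBasis_apply]

lemma leftCreation_apply_nil (b : Bool) (u : FockSpace) : leftCreation b u [] = 0 :=
  fockShift_apply_of_forall_ne u (by simp)

lemma leftCreation_apply_cons (b b' : Bool) (u : FockSpace) (w : List Bool) :
    leftCreation b u (b' :: w) = if b = b' then u w else 0 := by
  split_ifs with h
  · subst h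
    exact fockShift_apply_map u w
  · exact fockShift_apply_of_forall_ne u (by simp [h])

lemma rightCreation_apply_nil (b : Bool) (u : FockSpace) : rightCreation b u [] = 0 :=
  fockShift_apply_of_forall_ne u (by simp)

lemma rightCreation_apply_append (b b' : Bool) (u : FockSpace) (w : List Bool) :
    rightCreation b u (w ++ [b']) = if b = b' then u w else 0 := by
  split_ifs with h
  · subst h
    exact fockShift_apply_map u w
  · exact fockShift_apply_of_forall_ne u (by simp [h])

lemma star_leftCreation_apply (b : Bool) (u : FockSpace) (w : List Bool) :
    (star (leftCreation b) u : FockSpace) w = u (b :: w) :=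
  star_fockShift_apply u w

lemma star_leftCreation_leftCreation (b b' : Bool) (u : FockSpace) :
    star (leftCreation b) (leftCreation b' u) = if b' = b then u else 0 := by
  ext w
  rw [star_leftCreation_apply, leftCreation_apply_cons]
  split_ifs <;> rfl

lemma star_leftCreation_vacuum (b : Bool) : star (leftCreation b) vacuum = 0 := by
  ext w
  rw [star_leftCreation_apply, vacuum_cons]
  rfl

lemma leftCreation_vacuum (b : Bool) : leftCreation b vacuum = rightCreation b vacuum := by
  rw [leftCreation, rightCreation, vacuum, fockShift_fockBasis, fockShift_fockBasis]
  rfl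

lemma leftCreation_rightCreation (b b' : Bool) (u : FockSpace) :
    leftCreation b (rightCreation b' u) = rightCreation b' (leftCreation b u) := by
  ext w
  rcases w with _ | ⟨a, w⟩
  · rw [leftCreation_apply_nil, rightCreation_apply_nil]
  · rw [leftCreation_apply_cons]
    rcases List.eq_nil_or_concat w with rfl | ⟨w, a', rfl⟩
    · rw [rightCreation_apply_nil, ite_self]
      have := rightCreation_apply_append b' a (leftCreation b u) []
      rw [List.nil_append] at this
      rw [this, leftCreation_apply_nil, ite_self]
    · rw [List.concat_eq_append, rightCreation_apply_append, ← List.cons_append,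
        rightCreation_apply_append, leftCreation_apply_cons]
      split_ifs <;> rfl

/-- Deleting the first letter and appending a last one commute except on the empty word, where the
appended letter is itself the first. -/
lemma star_leftCreation_rightCreation (b b' : Bool) (u : FockSpace) :
    star (leftCreation b) (rightCreation b' u) =
      rightCreation b' (star (leftCreation b) u) + if b' = b then u [] • vacuum else 0 := by
  ext w
  rw [star_leftCreation_apply, lp.coeFn_add, Pi.add_apply]
  rcases List.eq_nil_or_concat w with rfl | ⟨w, a', rfl⟩
  · have := rightCreation_apply_append b' b u []
    rw [List.nil_append] at this
    rw [this, rightCreation_apply_nil]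
    split_ifs <;> simp [vacuum_nil]
  · rw [List.concat_eq_append, ← List.cons_append, rightCreation_apply_append,
      rightCreation_apply_append, star_leftCreation_apply]
    have h : vacuum (w ++ [a']) = 0 := by simp [vacuum, fockBasis_apply]
    split_ifs <;> simp [h]

/-- The vacuum state. -/
def vacuumState : (FockSpace →L[ℂ] FockSpace) →ₗ[ℂ] ℂ where
  toFun T := (T vacuum : FockSpace) []
  map_add' S T := by simp
  map_smul' c T := by simp

lemma vacuumState_apply (T : FockSpace →L[ℂ] FockSpace) :
    vacuumState T = inner ℂ vacuum (T vacuum) :=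
  (inner_fockBasis_left _ _).symm

lemma vacuumState_def (T : FockSpace →L[ℂ] FockSpace) :
    vacuumState T = (T vacuum : FockSpace) [] := rfl

lemma isState_vacuumState : IsState vacuumState := by
  refine ⟨by simp [vacuumState_def, vacuum_nil], fun a => ⟨‖a vacuum‖ ^ 2, by positivity, ?_⟩⟩
  rw [vacuumState_apply, mul_apply_eq_comp, ContinuousLinearMap.star_eq_adjoint,
    ContinuousLinearMap.adjoint_inner_right, inner_self_eq_norm_sq_to_K]
  simp

lemma vacuumState_eq_re {T : FockSpace →L[ℂ] FockSpace} (hT : IsSelfAdjoint T) :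
    vacuumState T = ((vacuumState T).re : ℂ) := by
  rw [vacuumState_apply]
  have h' : (starRingEnd ℂ) (inner ℂ vacuum (T vacuum)) = inner ℂ vacuum (T vacuum) := by
    rw [inner_conj_symm]
    exact hT.isSymmetric vacuum vacuum
  exact (Complex.conj_eq_iff_re.1 h').symm

/-- The expansion of a power of an operator that commutes with a creation operator up to an
operator of rank one. -/
lemma pow_apply_of_commutator {z R : FockSpace →L[ℂ] FockSpace} {ξ : FockSpace}
    (h : ∀ u, z (R u) = R (z u) + u [] • ξ) (n : ℕ) (u : FockSpace) :
    (z ^ n) (R u) = R ((z ^ n) u) +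
      ∑ j ∈ Finset.range n, ((z ^ (n - 1 - j)) u : FockSpace) [] • (z ^ j) ξ := by
  induction n with
  | zero => simp
  | succ n ih =>
    rw [pow_succ', mul_apply_eq_comp, ih, map_add, h, Finset.sum_range_succ', add_assoc,
      map_sum, mul_apply_eq_comp, add_comm (((z ^ n) u : FockSpace) [] • ξ)]
    congr 2
    · refine Finset.sum_congr rfl fun j _ => ?_
      rw [map_smul, pow_succ', mul_apply_eq_comp,
        show n + 1 - 1 - (j + 1) = n - 1 - j by omega]


/-! ### Free Poisson and semicircular elements on the Fock space -/

/-- The operator `ℓ_b + r`. -/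
def shiftedCreation (b : Bool) (r : ℝ) : FockSpace →L[ℂ] FockSpace := leftCreation b + (r : ℂ) • 1

/-- A free Poisson element of rate `r ^ 2`. -/
def freePoisson (b : Bool) (r : ℝ) : FockSpace →L[ℂ] FockSpace :=
  shiftedCreation b r * star (shiftedCreation b r)

lemma shiftedCreation_apply (b : Bool) (r : ℝ) (u : FockSpace) :
    shiftedCreation b r u = leftCreation b u + (r : ℂ) • u := rfl

lemma star_shiftedCreation_apply (b : Bool) (r : ℝ) (u : FockSpace) :
    star (shiftedCreation b r) u = star (leftCreation b) u + (r : ℂ) • u := by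
  simp [shiftedCreation, -Complex.coe_smul]

lemma isSelfAdjoint_freePoisson (b : Bool) (r : ℝ) : IsSelfAdjoint (freePoisson b r) :=
  IsSelfAdjoint.mul_star_self _

lemma freePoisson_apply (b : Bool) (r : ℝ) (u : FockSpace) :
    freePoisson b r u = shiftedCreation b r (star (leftCreation b) u + (r : ℂ) • u) := by
  rw [freePoisson, mul_apply_eq_comp, star_shiftedCreation_apply]

/-- The defect comes only from `star (leftCreation b)`, hence only from the matching letter. In a
difference of two such elements each letter therefore detects its own summand. -/
lemma freePoisson_rightCreation (b b' : Bool) (r : ℝ) (u : FockSpace) :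
    freePoisson b r (rightCreation b' u) = rightCreation b' (freePoisson b r u) +
      if b' = b then u [] • shiftedCreation b r vacuum else 0 := by
  simp only [freePoisson_apply, star_leftCreation_rightCreation, shiftedCreation_apply, map_add,
    map_smul, leftCreation_rightCreation, smul_add]
  split_ifs
  · rw [map_smul, smul_comm (r : ℂ) (u [])]
    abel
  · simp only [map_zero, smul_zero, add_zero]

lemma freePoisson_vacuum (b : Bool) (r : ℝ) :
    freePoisson b r vacuum = (r : ℂ) • shiftedCreation b r vacuum := by
  rw [freePoisson_apply, star_leftCreation_vacuum, zero_add, map_smul]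

/-- On the vacuum, left and right creation agree. Moving the right creation through `z ^ n` leaves
the commutator terms alone, as its range has no vacuum component. Here `ε` is the sign of
`freePoisson b r` in `z`. -/
lemma vacuumState_pow_mul_freePoisson {z : FockSpace →L[ℂ] FockSpace} {b : Bool} {r ε : ℝ}
    (h : ∀ u, z (rightCreation b u) = rightCreation b (z u) +
      u [] • ((ε : ℂ) • shiftedCreation b r vacuum)) (n : ℕ) :
    vacuumState (z ^ n * freePoisson b r) = ((r * r : ℝ) : ℂ) * vacuumState (z ^ n) +
      ε * ∑ j ∈ Finset.range n,
        vacuumState (z ^ j * freePoisson b r) * vacuumState (z ^ (n - 1 - j)) := by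
  have h1 : ∀ n, vacuumState (z ^ n * freePoisson b r) =
      r * (((z ^ n) (shiftedCreation b r vacuum) : FockSpace) []) := by
    intro n
    rw [vacuumState_def, mul_apply_eq_comp, freePoisson_vacuum, map_smul]
    rfl
  simp only [h1]
  conv_lhs => rw [shiftedCreation_apply, leftCreation_vacuum, map_add, pow_apply_of_commutator h]
  simp only [map_smul, lp.coeFn_add, Pi.add_apply, lp.coeFn_sum, Finset.sum_apply, lp.coeFn_smul,
    Pi.smul_apply, smul_eq_mul, rightCreation_apply_nil, ← vacuumState_def, zero_add]
  rw [mul_add, Finset.mul_sum, Finset.mul_sum, add_comm]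
  congr 1
  · push_cast
    ring
  · refine Finset.sum_congr rfl fun j _ => ?_
    ring

lemma re_vacuumState_pow_mul_freePoisson {z : FockSpace →L[ℂ] FockSpace} {b : Bool} {r ε : ℝ}
    (hz : IsSelfAdjoint z) (h : ∀ u, z (rightCreation b u) = rightCreation b (z u) +
      u [] • ((ε : ℂ) • shiftedCreation b r vacuum)) (n : ℕ) :
    (vacuumState (z ^ n * freePoisson b r)).re = r * r * (vacuumState (z ^ n)).re +
      ε * ∑ j ∈ Finset.range n,
        (vacuumState (z ^ j * freePoisson b r)).re * (vacuumState (z ^ (n - 1 - j))).re := by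
  have hm : ∀ n, vacuumState (z ^ n) = ((vacuumState (z ^ n)).re : ℂ) := fun n =>
    vacuumState_eq_re (hz.pow n)
  rw [vacuumState_pow_mul_freePoisson h, Complex.add_re, Complex.re_ofReal_mul,
    Complex.re_ofReal_mul, Complex.re_sum]
  congr 2
  refine Finset.sum_congr rfl fun j _ => ?_
  conv_lhs => rw [hm (n - 1 - j)]
  rw [Complex.re_mul_ofReal]

/-- The moments of a free Poisson element. -/
lemma vacuumState_freePoisson_pow_succ (b : Bool) (r : ℝ) (n : ℕ) :
    (vacuumState (freePoisson b r ^ (n + 1))).re =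
      r * r * (vacuumState (freePoisson b r ^ n)).re + ∑ j ∈ Finset.range n,
        (vacuumState (freePoisson b r ^ (j + 1))).re *
          (vacuumState (freePoisson b r ^ (n - 1 - j))).re := by
  have := re_vacuumState_pow_mul_freePoisson (b := b) (r := r) (ε := 1)
    (isSelfAdjoint_freePoisson b r) (fun u => by simp [freePoisson_rightCreation]) n
  simpa only [← pow_succ, one_mul] using this

/-- The moments of a difference of two free Poisson elements. -/
lemma vacuumState_difference (r q : ℝ) :
    ∃ X Y : ℕ → ℝ,
      (∀ n, X n = r * r * (vacuumState ((freePoisson true r - freePoisson false q) ^ n)).re +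
        ∑ j ∈ Finset.range n, X j *
          (vacuumState ((freePoisson true r - freePoisson false q) ^ (n - 1 - j))).re) ∧
      (∀ n, Y n = q * q * (vacuumState ((freePoisson true r - freePoisson false q) ^ n)).re -
        ∑ j ∈ Finset.range n, Y j *
          (vacuumState ((freePoisson true r - freePoisson false q) ^ (n - 1 - j))).re) ∧
      ∀ n, (vacuumState ((freePoisson true r - freePoisson false q) ^ (n + 1))).re = X n - Y n := by
  set z := freePoisson true r - freePoisson false q with hz
  have hsa : IsSelfAdjoint z := (isSelfAdjoint_freePoisson _ _).sub (isSelfAdjoint_freePoisson _ _)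
  have h1 := re_vacuumState_pow_mul_freePoisson (b := true) (r := r) (ε := 1) hsa fun u => by
    simp [hz, freePoisson_rightCreation]
    abel
  have h2 := re_vacuumState_pow_mul_freePoisson (b := false) (r := q) (ε := -1) hsa fun u => by
    simp [hz, freePoisson_rightCreation]
    abel
  refine ⟨_, _, fun n => (h1 n).trans (by rw [one_mul]), fun n => (h2 n).trans (by ring),
    fun n => ?_⟩
  rw [pow_succ, hz, mul_sub, map_sub, Complex.sub_re]

/-- A semicircular element with mean `a` and variance `ρ ^ 2`. -/
def semicircular (a ρ : ℝ) : FockSpace →L[ℂ] FockSpace :=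
  (a : ℂ) • 1 + (ρ : ℂ) • (leftCreation true + star (leftCreation true))

lemma isSelfAdjoint_semicircular (a ρ : ℝ) : IsSelfAdjoint (semicircular a ρ) := by
  rw [IsSelfAdjoint, semicircular]
  simp [add_comm]

lemma vacuumState_semicircular_pow_succ (a ρ : ℝ) (n : ℕ) :
    (vacuumState (semicircular a ρ ^ (n + 1))).re =
      a * (vacuumState (semicircular a ρ ^ n)).re + ρ * ρ * ∑ j ∈ Finset.range n,
        (vacuumState (semicircular a ρ ^ j)).re *
          (vacuumState (semicircular a ρ ^ (n - 1 - j))).re := by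
  set z := semicircular a ρ with hz
  have hz' : ∀ u, z u = (a : ℂ) • u + (ρ : ℂ) • (leftCreation true u + star (leftCreation true) u) :=
    fun u => rfl
  have h : ∀ u, z (rightCreation true u) = rightCreation true (z u) +
      u [] • ((ρ : ℂ) • vacuum) := by
    intro u
    simp only [hz', leftCreation_rightCreation, star_leftCreation_rightCreation, map_add, map_smul,
      smul_add, if_true]
    rw [smul_comm (ρ : ℂ) (u [])]
    abel
  have hm : ∀ n, vacuumState (z ^ n) = ((vacuumState (z ^ n)).re : ℂ) := fun n =>
    vacuumState_eq_re ((isSelfAdjoint_semicircular a ρ).pow n)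
  have h1 : z vacuum = (a : ℂ) • vacuum + (ρ : ℂ) • rightCreation true vacuum := by
    rw [hz', star_leftCreation_vacuum, leftCreation_vacuum, add_zero]
  have h2 : vacuumState (z ^ (n + 1)) = a * vacuumState (z ^ n) + ρ * ∑ j ∈ Finset.range n,
      vacuumState (z ^ (n - 1 - j)) * (ρ * vacuumState (z ^ j)) := by
    conv_lhs => rw [vacuumState_def, pow_succ, mul_apply_eq_comp, h1, map_add, map_smul, map_smul,
      pow_apply_of_commutator h]
    simp only [map_smul, lp.coeFn_add, Pi.add_apply, lp.coeFn_sum, Finset.sum_apply, lp.coeFn_smul,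
      Pi.smul_apply, smul_eq_mul, rightCreation_apply_nil, ← vacuumState_def, zero_add]
  rw [h2, Complex.add_re, Complex.re_ofReal_mul, Complex.re_ofReal_mul, Complex.re_sum, mul_assoc]
  congr 2
  rw [Finset.mul_sum]
  refine Finset.sum_congr rfl fun j _ => ?_
  conv_lhs => rw [hm (n - 1 - j)]
  rw [Complex.re_ofReal_mul, Complex.re_ofReal_mul]
  ring

/-! ### Freeness -/

lemma aeval_apply_eq_divX (T : FockSpace →L[ℂ] FockSpace) (q : Polynomial ℂ) (v : FockSpace) :
    Polynomial.aeval T q v = T (Polynomial.aeval T q.divX v) + q.coeff 0 • v := by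
  have h : Polynomial.aeval T q = T * Polynomial.aeval T q.divX + q.coeff 0 • 1 := by
    conv_lhs => rw [← Polynomial.divX_mul_X_add q]
    rw [mul_comm, map_add, map_mul, Polynomial.aeval_X, Polynomial.aeval_C,
      Algebra.algebraMap_eq_smul_one]
  rw [h]
  rfl

lemma star_leftCreation_aeval (b : Bool) (q : Polynomial ℂ) {v : FockSpace}
    (hv : star (leftCreation b) v = 0) :
    star (leftCreation b) (Polynomial.aeval (leftCreation b) q v) =
      Polynomial.aeval (leftCreation b) q.divX v := by
  rw [aeval_apply_eq_divX, map_add, map_smul, hv, star_leftCreation_leftCreation, smul_zero,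
    add_zero, if_pos rfl]

/-- If `ℓ_b* v = 0`, then `ℓ_b*` sends `q(ℓ_b) v` to the same expression with `q.divX`. So `(ℓ_b +
r)(ℓ_b* + r)` acts on the polynomials `q` by `(X + r)(q.divX + r q)`. -/
lemma exists_polynomial_of_mem_adjoin {b : Bool} {r : ℝ} {a : FockSpace →L[ℂ] FockSpace}
    (ha : a ∈ Algebra.adjoin ℂ {freePoisson b r}) : ∃ q : Polynomial ℂ,
      ∀ v, star (leftCreation b) v = 0 → a v = Polynomial.aeval (leftCreation b) q v := by
  rw [Algebra.adjoin_singleton_eq_range_aeval] at ha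
  obtain ⟨P, rfl⟩ := ha
  simp only [AlgHom.toRingHom_eq_coe, RingHom.coe_coe]
  induction P using Polynomial.induction_on' with
  | add P Q hP hQ =>
    obtain ⟨q, hq⟩ := hP
    obtain ⟨q', hq'⟩ := hQ
    exact ⟨q + q', fun v hv => by simp [hq v hv, hq' v hv]⟩
  | monomial n c =>
    have h : ∀ n, ∃ q : Polynomial ℂ, ∀ v, star (leftCreation b) v = 0 →
        (freePoisson b r ^ n) v = Polynomial.aeval (leftCreation b) q v := by
      intro n
      induction n with
      | zero => exact ⟨1, fun v _ => by simp⟩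
      | succ n ih =>
        obtain ⟨q, hq⟩ := ih
        refine ⟨(Polynomial.X + Polynomial.C (r : ℂ)) * (q.divX + Polynomial.C (r : ℂ) * q),
          fun v hv => ?_⟩
        rw [pow_succ', mul_apply_eq_comp, hq v hv, freePoisson_apply,
          star_leftCreation_aeval b q hv, shiftedCreation_apply]
        simp only [Algebra.algebraMap_eq_smul_one, add_mul, mul_add, map_add, map_mul,
          Polynomial.aeval_X, Polynomial.aeval_C, map_smul, smul_add, one_mul, smul_mul_assoc,
          mul_smul_comm]
        exact add_add_add_comm _ _ _ _
    obtain ⟨q, hq⟩ := h n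
    refine ⟨Polynomial.C c * q, fun v hv => ?_⟩
    simp [Algebra.algebraMap_eq_smul_one, Polynomial.aeval_monomial, hq v hv]

/-- The vacuum state reads off the constant coefficient of the polynomial that represents `a`; when
it is zero, one factor `ℓ_b` splits off. -/
lemma exists_leftCreation_of_centred {b : Bool} {r : ℝ} {a : FockSpace →L[ℂ] FockSpace}
    (ha : a ∈ Algebra.adjoin ℂ {freePoisson b r}) (h0 : vacuumState a = 0) {v : FockSpace}
    (hv : star (leftCreation b) v = 0) : ∃ u, a v = leftCreation b u := by
  obtain ⟨q, hq⟩ := exists_polynomial_of_mem_adjoin ha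
  have h2 : q.coeff 0 = 0 := by
    rw [vacuumState_def, hq _ (star_leftCreation_vacuum b), aeval_apply_eq_divX, lp.coeFn_add,
      Pi.add_apply, leftCreation_apply_nil, lp.coeFn_smul, Pi.smul_apply, vacuum_nil] at h0
    simpa using h0
  exact ⟨_, by rw [hq v hv, aeval_apply_eq_divX, h2, zero_smul, add_zero]⟩

/-- Free Poisson elements that belong to different letters are free. -/
lemma areFree_freePoisson (r q : ℝ) :
    AreFree vacuumState (freePoisson true r) (freePoisson false q) := by
  -- An alternating centred product, applied from the right, keeps the vacuum in the range of the
  -- current left creation operator. That range is annihilated by the adjoint for the next,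
  -- different letter, and has no vacuum component.
  have key : ∀ (n : ℕ) (i : Fin (n + 1) → Bool) (a : Fin (n + 1) → FockSpace →L[ℂ] FockSpace),
      (∀ k : Fin n, i k.castSucc ≠ i k.succ) →
      (∀ k, a k ∈ Algebra.adjoin ℂ {if i k then freePoisson true r else freePoisson false q}) →
      (∀ k, vacuumState (a k) = 0) → ∃ u, (List.ofFn a).prod vacuum = leftCreation (i 0) u := by
    intro n
    have hmem : ∀ (b : Bool) (x : FockSpace →L[ℂ] FockSpace),
        x ∈ Algebra.adjoin ℂ {if b then freePoisson true r else freePoisson false q} →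
        ∃ s, x ∈ Algebra.adjoin ℂ {freePoisson b s} := by
      rintro (_ | _) x hx
      · exact ⟨q, by simpa using hx⟩
      · exact ⟨r, by simpa using hx⟩
    induction n with
    | zero =>
      intro i a _ ha h0
      obtain ⟨s, hs⟩ := hmem _ _ (ha 0)
      simpa using exists_leftCreation_of_centred hs (h0 0) (star_leftCreation_vacuum _)
    | succ n ih =>
      intro i a hi ha h0
      obtain ⟨u, hu⟩ := ih (fun k => i k.succ) (fun k => a k.succ) (fun k => hi k.succ)
        (fun k => ha k.succ) (fun k => h0 k.succ)
      obtain ⟨s, hs⟩ := hmem _ _ (ha 0)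
      rw [List.ofFn_succ, List.prod_cons, mul_apply_eq_comp, hu]
      refine exists_leftCreation_of_centred hs (h0 0) ?_
      rw [star_leftCreation_leftCreation, if_neg]
      exact (hi 0).symm
  intro n i a hi ha h0
  obtain ⟨u, hu⟩ := key n i a hi ha h0
  rw [vacuumState_def, hu, leftCreation_apply_nil]


/-! ### Moments of the semicircle law -/

lemma integrable_withDensity_Icc_iff {a b : ℝ} {g : ℝ → ℝ} (hg : Measurable g)
    (h0 : ∀ t ∈ Set.Icc a b, 0 ≤ g t) (f : ℝ → ℝ) :
    Integrable f ((volume.restrict (Set.Icc a b)).withDensity fun t => ENNReal.ofReal (g t)) ↔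
      IntegrableOn (fun t => g t * f t) (Set.Icc a b) := by
  rw [integrable_withDensity_iff_integrable_smul' (by fun_prop)
    (ae_of_all _ fun _ => ENNReal.ofReal_lt_top), IntegrableOn]
  refine integrable_congr ?_
  filter_upwards [ae_restrict_mem measurableSet_Icc] with t ht
  rw [ENNReal.toReal_ofReal (h0 t ht), smul_eq_mul]

lemma integral_withDensity_Icc {a b : ℝ} (hab : a ≤ b) {g : ℝ → ℝ} (hg : Measurable g)
    (h0 : ∀ t ∈ Set.Icc a b, 0 ≤ g t) (f : ℝ → ℝ) :
    ∫ t, f t ∂((volume.restrict (Set.Icc a b)).withDensity fun t => ENNReal.ofReal (g t)) =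
      ∫ t in a..b, g t * f t := by
  rw [integral_withDensity_eq_integral_toReal_smul (by fun_prop)
    (ae_of_all _ fun _ => ENNReal.ofReal_lt_top), intervalIntegral.integral_of_le hab,
    ← integral_Icc_eq_integral_Ioc]
  refine integral_congr_ae ?_
  filter_upwards [ae_restrict_mem measurableSet_Icc] with t ht
  rw [ENNReal.toReal_ofReal (h0 t ht), smul_eq_mul]

/-- The moments of the standard semicircle law. -/
def semicircleMoment (n : ℕ) : ℝ := ∫ s in (-2 : ℝ)..2, √(4 - s ^ 2) / (2 * Real.pi) * s ^ n

lemma integral_semicircleLaw (a : ℝ) {v : ℝ} (hv : 0 < v) (f : ℝ → ℝ) :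
    ∫ t, f t ∂(semicircleLaw a v) =
      ∫ s in (-2 : ℝ)..2, √(4 - s ^ 2) / (2 * Real.pi) * f (a + √v * s) := by
  have hs : 0 < √v := Real.sqrt_pos.2 hv
  rw [semicircleLaw, integral_withDensity_Icc (by linarith) (by fun_prop)
    (fun t _ => by have := Real.pi_pos; positivity)]
  have h := intervalIntegral.integral_comp_add_mul (a := -2) (b := 2)
    (fun t => √(4 * v - (t - a) ^ 2) / (2 * Real.pi * v) * f t) hs.ne' a
  rw [show a + √v * -2 = a - 2 * √v by ring, show a + √v * 2 = a + 2 * √v by ring, smul_eq_mul,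
    eq_inv_mul_iff_mul_eq₀ hs.ne', ← intervalIntegral.integral_const_mul] at h
  rw [← h]
  refine intervalIntegral.integral_congr fun s _ => ?_
  have h1 : 4 * v - (a + √v * s - a) ^ 2 = v * (4 - s ^ 2) := by
    have := Real.sq_sqrt hv.le
    rw [add_sub_cancel_left, mul_pow, this]
    ring
  simp only [h1, Real.sqrt_mul hv.le]
  have h2 : √v * √v = v := Real.mul_self_sqrt hv.le
  have hpi := Real.pi_pos.ne'
  calc √v * (√v * √(4 - s ^ 2) / (2 * Real.pi * v) * f (a + √v * s))
      = √v * √v / v * (√(4 - s ^ 2) / (2 * Real.pi) * f (a + √v * s)) := by field_simp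
    _ = _ := by rw [h2, div_self hv.ne', one_mul]

lemma semicircleMoment_zero : semicircleMoment 0 = 1 := by
  have h := intervalIntegral.integral_comp_mul_left (a := -1) (b := 1)
    (fun s : ℝ => √(4 - s ^ 2)) two_ne_zero
  have h1 : ∀ s : ℝ, √(4 - (2 * s) ^ 2) = 2 * √(1 - s ^ 2) := by
    intro s
    rw [show 4 - (2 * s) ^ 2 = 2 ^ 2 * (1 - s ^ 2) by ring, Real.sqrt_mul (by norm_num),
      Real.sqrt_sq (by norm_num)]
  simp only [h1, intervalIntegral.integral_const_mul, integral_sqrt_one_sub_sq, smul_eq_mul] at h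
  norm_num at h
  have h2 : ∫ s in (-2 : ℝ)..2, √(4 - s ^ 2) = 2 * Real.pi := by linarith
  simp only [semicircleMoment, pow_zero, mul_one, intervalIntegral.integral_div, h2]
  exact div_self (by have := Real.pi_pos; positivity)

/-- The function vanishes at `±2`, so integrating its derivative relates the moments `k - 1` and `k
+ 1`. For `k = 0` the truncated exponent is harmless because of the factor `k`. -/
lemma hasDerivAt_pow_mul_semicircle (k : ℕ) {s : ℝ} (hs : s ∈ Set.Ioo (-2 : ℝ) 2) :
    HasDerivAt (fun s : ℝ => s ^ k * ((4 - s ^ 2) * √(4 - s ^ 2)))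
      (4 * k * (√(4 - s ^ 2) * s ^ (k - 1)) - (k + 3) * (√(4 - s ^ 2) * s ^ (k + 1))) s := by
  have h0 : 0 < 4 - s ^ 2 := by nlinarith [hs.1, hs.2]
  have h1 : HasDerivAt (fun s : ℝ => 4 - s ^ 2) (-(2 * s)) s := by
    simpa using (hasDerivAt_pow 2 s).const_sub 4
  have h2 := (hasDerivAt_pow k s).mul (h1.mul (h1.sqrt h0.ne'))
  refine h2.congr_deriv ?_
  have h3 : √(4 - s ^ 2) * √(4 - s ^ 2) = 4 - s ^ 2 := Real.mul_self_sqrt h0.le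
  have h4 : (4 - s ^ 2) * (-(2 * s) / (2 * √(4 - s ^ 2))) = - s * √(4 - s ^ 2) := by
    have := (Real.sqrt_pos.2 h0).ne'
    field_simp
    linear_combination s * h3
  simp only [Pi.mul_apply]
  rw [h4]
  rcases k with _ | k
  · simp
    ring
  · simp
    ring

lemma semicircleMoment_recursion (k : ℕ) :
    4 * k * semicircleMoment (k - 1) = (k + 3) * semicircleMoment (k + 1) := by
  have hc : ∀ n : ℕ, Continuous fun s : ℝ => √(4 - s ^ 2) * s ^ n := fun n => by fun_prop
  have h := intervalIntegral.integral_eq_sub_of_hasDerivAt_of_le (a := -2) (b := 2)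
    (f := fun s : ℝ => s ^ k * ((4 - s ^ 2) * √(4 - s ^ 2))) (by norm_num) (by fun_prop)
    (fun s hs => hasDerivAt_pow_mul_semicircle k hs)
    ((((hc _).const_mul _).sub ((hc _).const_mul _)).intervalIntegrable _ _)
  rw [intervalIntegral.integral_sub (((hc _).const_mul _).intervalIntegrable _ _)
    (((hc _).const_mul _).intervalIntegrable _ _), intervalIntegral.integral_const_mul,
    intervalIntegral.integral_const_mul] at h
  norm_num at h
  have h1 : ∀ n, semicircleMoment n =
      (∫ s in (-2 : ℝ)..2, √(4 - s ^ 2) * s ^ n) / (2 * Real.pi) := by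
    intro n
    rw [semicircleMoment, ← intervalIntegral.integral_div]
    refine intervalIntegral.integral_congr fun s _ => ?_
    ring
  rw [h1, h1]
  linear_combination h / (2 * Real.pi)

/-- The moments of the standard semicircle law, in terms of the Catalan numbers. -/
def catalanMoment (n : ℕ) : ℝ := if Even n then (catalan (n / 2) : ℝ) else 0

lemma catalanMoment_even (k : ℕ) : catalanMoment (2 * k) = catalan k := by
  simp [catalanMoment]

lemma catalanMoment_odd (k : ℕ) : catalanMoment (2 * k + 1) = 0 := by
  simp [catalanMoment]

lemma semicircleMoment_eq (n : ℕ) : semicircleMoment n = catalanMoment n := by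
  rcases Nat.even_or_odd' n with ⟨k, rfl | rfl⟩
  · rw [catalanMoment_even]
    induction k with
    | zero => simp [semicircleMoment_zero]
    | succ k ih =>
      have h1 := semicircleMoment_recursion (2 * k + 1)
      rw [Nat.add_sub_cancel, ih] at h1
      have h2 := succ_mul_catalan_eq_centralBinom k
      have h3 := succ_mul_catalan_eq_centralBinom (k + 1)
      have h4 := Nat.succ_mul_centralBinom_succ k
      rw [← h2, ← h3] at h4
      have h5 : ((k : ℝ) + 1) * ((k + 1 + 1) * catalan (k + 1)) =
          2 * (2 * k + 1) * ((k + 1) * catalan k) := by exact_mod_cast h4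
      push_cast at h1
      rw [show 2 * (k + 1) = 2 * k + 1 + 1 by ring]
      have h6 : ((k : ℝ) + 1) * (2 * k + 4) ≠ 0 := by positivity
      refine mul_left_cancel₀ h6 ?_
      linear_combination -(k + 1 : ℝ) * h1 - 2 * h5
  · rw [catalanMoment_odd]
    induction k with
    | zero => simpa using semicircleMoment_recursion 0
    | succ k ih =>
      have h1 := semicircleMoment_recursion (2 * k + 2)
      rw [show 2 * k + 2 - 1 = 2 * k + 1 by omega, ih, mul_zero] at h1
      have h6 : (((2 * k + 2 : ℕ) : ℝ) + 3) ≠ 0 := by positivity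
      exact (mul_eq_zero.1 h1.symm).resolve_left h6

lemma sum_range_odd_of_vanishing {h : ℕ → ℝ} (h0 : ∀ i, h (2 * i + 1) = 0) (k : ℕ) :
    ∑ j ∈ Finset.range (2 * k + 1), h j = ∑ i ∈ Finset.range (k + 1), h (2 * i) := by
  induction k with
  | zero => simp
  | succ k ih =>
    rw [show 2 * (k + 1) + 1 = 2 * k + 1 + 1 + 1 by ring, Finset.sum_range_succ,
      Finset.sum_range_succ, ih, h0, Finset.sum_range_succ _ (k + 1), add_zero]
    rfl

lemma catalanMoment_succ (n : ℕ) : catalanMoment (n + 1) =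
    ∑ j ∈ Finset.range n, catalanMoment j * catalanMoment (n - 1 - j) := by
  rcases Nat.even_or_odd' n with ⟨k, rfl | rfl⟩
  · rw [catalanMoment_odd]
    refine (Finset.sum_eq_zero fun j hj => ?_).symm
    rw [Finset.mem_range] at hj
    rcases Nat.even_or_odd' j with ⟨i, rfl | rfl⟩
    · rw [show 2 * k - 1 - 2 * i = 2 * (k - 1 - i) + 1 by omega, catalanMoment_odd, mul_zero]
    · rw [catalanMoment_odd, zero_mul]
  · rw [show 2 * k + 1 + 1 = 2 * (k + 1) by ring, catalanMoment_even, catalan_succ,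
      sum_range_odd_of_vanishing fun i => by rw [catalanMoment_odd, zero_mul], Finset.sum_range]
    push_cast
    refine Finset.sum_congr rfl fun i _ => ?_
    rw [show 2 * k - 2 * (i : ℕ) = 2 * (k - i) by omega, catalanMoment_even,
      catalanMoment_even]

lemma re_vacuumState_semicircular_pow (n : ℕ) :
    (vacuumState (semicircular 0 1 ^ n)).re = semicircleMoment n := by
  rw [semicircleMoment_eq]
  induction n using Nat.strong_induction_on with
  | _ n ih =>
  rcases n with _ | n
  · simp [vacuumState_def, vacuum_nil, catalanMoment]
  · rw [vacuumState_semicircular_pow_succ, catalanMoment_succ]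
    rw [zero_mul, zero_add, one_mul, one_mul]
    refine Finset.sum_congr rfl fun j hj => ?_
    rw [Finset.mem_range] at hj
    rw [ih j (by omega), ih (n - 1 - j) (by omega)]

lemma integral_pow_semicircleLaw (a : ℝ) {v : ℝ} (hv : 0 < v) (n : ℕ) :
    ∫ t, t ^ n ∂(semicircleLaw a v) = (vacuumState (semicircular a (√v) ^ n)).re := by
  have h1 : semicircular a (√v) =
      ((√v : ℝ) : ℂ) • semicircular 0 1 + ((a : ℝ) : ℂ) • 1 := by
    simp only [semicircular, Complex.ofReal_zero, zero_smul, zero_add, Complex.ofReal_one, one_smul]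
    rw [add_comm]
  have hcomm : Commute (((√v : ℝ) : ℂ) • semicircular 0 1)
      (((a : ℝ) : ℂ) • (1 : FockSpace →L[ℂ] FockSpace)) :=
    ((Commute.one_right _).smul_left _).smul_right _
  rw [integral_semicircleLaw a hv, h1, hcomm.add_pow, map_sum, Complex.re_sum]
  have h2 : ∀ m, vacuumState ((((√v : ℝ) : ℂ) • semicircular 0 1) ^ m *
      (((a : ℝ) : ℂ) • 1) ^ (n - m) * (n.choose m : FockSpace →L[ℂ] FockSpace)) =
      ((√v ^ m * a ^ (n - m) * n.choose m : ℝ) : ℂ) * vacuumState (semicircular 0 1 ^ m) := by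
    intro m
    rw [smul_pow, smul_pow, one_pow, smul_mul_smul_comm, mul_one, ← nsmul_eq_mul',
      map_nsmul, map_smul, nsmul_eq_mul, smul_eq_mul]
    push_cast
    ring
  simp only [h2, Complex.re_ofReal_mul, re_vacuumState_semicircular_pow, semicircleMoment,
    ← intervalIntegral.integral_const_mul]
  rw [← intervalIntegral.integral_finsetSum
    fun m _ => Continuous.intervalIntegrable (by fun_prop) _ _]
  refine intervalIntegral.integral_congr fun s _ => ?_
  rw [add_comm a, add_pow, Finset.mul_sum]
  refine Finset.sum_congr rfl fun m _ => ?_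
  ring


/-! ### Moments of the Marchenko–Pastur law -/

lemma hasDerivAt_arcsin_comp {u : ℝ → ℝ} {u' k t : ℝ} (hu : HasDerivAt u u' t) (hk : 0 < k)
    (h : 1 - u t ^ 2 = k ^ 2) : HasDerivAt (fun t => Real.arcsin (u t)) (u' / k) t := by
  have h1 : u t ≠ -1 := fun h1 => by nlinarith [sq_pos_of_pos hk]
  have h2 : u t ≠ 1 := fun h1 => by nlinarith [sq_pos_of_pos hk]
  refine ((Real.hasDerivAt_arcsin h1 h2).comp t hu).congr_deriv ?_
  rw [h, Real.sqrt_sq hk.le]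
  ring

lemma marchenkoPastur_radicand (r t : ℝ) :
    ((1 + r) ^ 2 - t) * (t - (1 - r) ^ 2) = 4 * r ^ 2 - (t - (1 + r ^ 2)) ^ 2 := by
  ring

/-- An antiderivative of `√((b - t) (t - a)) / t`, where `a = (1 - r) ^ 2` and
`b = (1 + r) ^ 2`. -/
def marchenkoPasturPrimitive (r t : ℝ) : ℝ :=
  √(((1 + r) ^ 2 - t) * (t - (1 - r) ^ 2)) +
    (1 + r ^ 2) * Real.arcsin ((t - (1 + r ^ 2)) / (2 * r)) -
    |1 - r ^ 2| * Real.arcsin (((1 + r ^ 2) * t - (1 - r ^ 2) ^ 2) / (2 * r * t))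

lemma continuousOn_marchenkoPasturPrimitive {r : ℝ} (hr : 0 < r) :
    ContinuousOn (marchenkoPasturPrimitive r) (Set.Icc ((1 - r) ^ 2) ((1 + r) ^ 2)) := by
  have h1 : ContinuousOn (fun t => √(((1 + r) ^ 2 - t) * (t - (1 - r) ^ 2)) +
      (1 + r ^ 2) * Real.arcsin ((t - (1 + r ^ 2)) / (2 * r)))
      (Set.Icc ((1 - r) ^ 2) ((1 + r) ^ 2)) := by
    refine Continuous.continuousOn ?_
    have := Real.continuous_arcsin
    fun_prop
  refine h1.sub ?_
  -- For `r = 1` the interval reaches the singular point `t = 0` of the last quotient, but then its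
  -- coefficient vanishes.
  rcases eq_or_ne (1 - r ^ 2) 0 with h | h
  · simp only [h, abs_zero, zero_mul]
    exact continuousOn_const
  · refine continuousOn_const.mul (Real.continuous_arcsin.comp_continuousOn ?_)
    refine ContinuousOn.div (by fun_prop) (by fun_prop) fun t ht => ?_
    have h2 : 0 < (1 - r) ^ 2 := sq_pos_of_ne_zero fun h3 => h (by linear_combination (1 + r) * h3)
    have : 0 < t := h2.trans_le ht.1
    positivity

lemma hasDerivAt_marchenkoPasturPrimitive {r t : ℝ} (hr : 0 < r)
    (ht : t ∈ Set.Ioo ((1 - r) ^ 2) ((1 + r) ^ 2)) :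
    HasDerivAt (marchenkoPasturPrimitive r)
      (√(((1 + r) ^ 2 - t) * (t - (1 - r) ^ 2)) / t) t := by
  have hQ : 0 < ((1 + r) ^ 2 - t) * (t - (1 - r) ^ 2) :=
    mul_pos (sub_pos.2 ht.2) (sub_pos.2 ht.1)
  have ht0 : 0 < t := (sq_nonneg _).trans_lt ht.1
  set S := √(((1 + r) ^ 2 - t) * (t - (1 - r) ^ 2)) with hS
  have hS0 : 0 < S := Real.sqrt_pos.2 hQ
  have hSS : S ^ 2 = ((1 + r) ^ 2 - t) * (t - (1 - r) ^ 2) := Real.sq_sqrt hQ.le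
  have h1 : HasDerivAt (fun t => √(((1 + r) ^ 2 - t) * (t - (1 - r) ^ 2)))
      ((1 + r ^ 2 - t) / S) t := by
    have := ((((hasDerivAt_id t).const_sub ((1 + r) ^ 2)).mul
      ((hasDerivAt_id t).sub_const ((1 - r) ^ 2))).sqrt hQ.ne')
    refine this.congr_deriv ?_
    simp only [Pi.mul_apply, id, ← hS]
    field_simp
    ring
  have h2 : HasDerivAt (fun t => Real.arcsin ((t - (1 + r ^ 2)) / (2 * r))) (1 / S) t := by
    have h := hasDerivAt_arcsin_comp
      (((hasDerivAt_id t).sub_const (1 + r ^ 2)).div_const (2 * r))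
      (k := S / (2 * r)) (by positivity) (by
        simp only [id, div_pow, hSS]
        field_simp
        ring)
    refine h.congr_deriv ?_
    field_simp
  have h3 : HasDerivAt (fun t => |1 - r ^ 2| *
      Real.arcsin (((1 + r ^ 2) * t - (1 - r ^ 2) ^ 2) / (2 * r * t)))
      ((1 - r ^ 2) ^ 2 / (t * S)) t := by
    rcases eq_or_ne (1 - r ^ 2) 0 with h0 | h0
    · simp only [h0, abs_zero, zero_mul]
      simpa using hasDerivAt_const t (0 : ℝ)
    · have h4 : 0 < |1 - r ^ 2| := abs_pos.2 h0
      have h5 := sq_abs (1 - r ^ 2)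
      have h := (hasDerivAt_arcsin_comp
        ((((hasDerivAt_id t).const_mul (1 + r ^ 2)).sub_const ((1 - r ^ 2) ^ 2)).div
          ((hasDerivAt_id t).const_mul (2 * r)) (by simp only [id]; positivity))
        (k := |1 - r ^ 2| * S / (2 * r * t)) (by positivity) (by
          simp only [id, Pi.div_apply, div_pow, mul_pow, hSS, h5]
          field_simp
          ring)).const_mul |1 - r ^ 2|
      refine h.congr_deriv ?_
      simp only [id]
      field_simp
      ring
  -- Over the denominator `t S` the numerator is `-t² + 2 (1 + r²) t - (1 - r²)² = S²`.
  refine ((h1.add (h2.const_mul (1 + r ^ 2))).sub h3).congr_deriv ?_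
  field_simp
  rw [hSS]
  ring

lemma marchenkoPasturPrimitive_sub {r : ℝ} (hr : 0 < r) :
    marchenkoPasturPrimitive r ((1 + r) ^ 2) - marchenkoPasturPrimitive r ((1 - r) ^ 2) =
      Real.pi * (1 + r ^ 2 - |1 - r ^ 2|) := by
  have h1 : ((1 + r) ^ 2 - (1 + r ^ 2)) / (2 * r) = 1 := by field_simp; ring
  have h2 : ((1 - r) ^ 2 - (1 + r ^ 2)) / (2 * r) = -1 := by field_simp; ring
  have h3 : ((1 + r ^ 2) * (1 + r) ^ 2 - (1 - r ^ 2) ^ 2) / (2 * r * (1 + r) ^ 2) = 1 := by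
    field_simp; ring
  have h4 : |1 - r ^ 2| * Real.arcsin
      (((1 + r ^ 2) * (1 - r) ^ 2 - (1 - r ^ 2) ^ 2) / (2 * r * (1 - r) ^ 2)) =
      - (|1 - r ^ 2| * (Real.pi / 2)) := by
    rcases eq_or_ne (1 - r) 0 with h | h
    · rw [show 1 - r ^ 2 = 0 by linear_combination (1 + r) * h]
      simp
    · rw [show ((1 + r ^ 2) * (1 - r) ^ 2 - (1 - r ^ 2) ^ 2) / (2 * r * (1 - r) ^ 2) = -1 by
        field_simp; ring, Real.arcsin_neg_one, mul_neg]
  simp only [marchenkoPasturPrimitive, h1, h2, h3, h4, sub_self, zero_mul, mul_zero, Real.sqrt_zero,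
    Real.arcsin_one, Real.arcsin_neg_one]
  ring

lemma sq_one_sub_le {r : ℝ} (hr : 0 ≤ r) : (1 - r) ^ 2 ≤ (1 + r) ^ 2 := by nlinarith

/-- A nonnegative derivative of a continuous function is integrable; this covers `r = 1`, where the
density is unbounded near `0`. -/
lemma integrableOn_marchenkoPastur_density {r : ℝ} (hr : 0 < r) :
    IntegrableOn (fun t => √(((1 + r) ^ 2 - t) * (t - (1 - r) ^ 2)) / t)
      (Set.Icc ((1 - r) ^ 2) ((1 + r) ^ 2)) := by
  rw [integrableOn_Icc_iff_integrableOn_Ioc]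
  refine intervalIntegral.integrableOn_deriv_of_nonneg (continuousOn_marchenkoPasturPrimitive hr)
    (fun t ht => hasDerivAt_marchenkoPasturPrimitive hr ht) fun t ht => ?_
  have : 0 < t := (sq_nonneg _).trans_lt ht.1
  positivity

lemma integral_marchenkoPastur_density {r : ℝ} (hr : 0 < r) :
    ∫ t in ((1 - r) ^ 2)..((1 + r) ^ 2), √(((1 + r) ^ 2 - t) * (t - (1 - r) ^ 2)) / t =
      Real.pi * (1 + r ^ 2 - |1 - r ^ 2|) := by
  rw [← marchenkoPasturPrimitive_sub hr]
  refine intervalIntegral.integral_eq_sub_of_hasDerivAt_of_le (sq_one_sub_le hr.le)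
    (continuousOn_marchenkoPasturPrimitive hr)
    (fun t ht => hasDerivAt_marchenkoPasturPrimitive hr ht) ?_
  rw [intervalIntegrable_iff_integrableOn_Icc_of_le (sq_one_sub_le hr.le)]
  exact integrableOn_marchenkoPastur_density hr

lemma marchenkoPastur_density_nonneg {r t : ℝ} (ht : t ∈ Set.Icc ((1 - r) ^ 2) ((1 + r) ^ 2)) :
    0 ≤ √(((1 + r) ^ 2 - t) * (t - (1 - r) ^ 2)) / (2 * Real.pi * t) := by
  have h0 : 0 ≤ t := (sq_nonneg _).trans ht.1
  have := Real.pi_pos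
  positivity

lemma marchenkoPastur_density_mul_pow {r t : ℝ} (ht : t ∈ Set.Icc ((1 - r) ^ 2) ((1 + r) ^ 2))
    (k : ℕ) : √(((1 + r) ^ 2 - t) * (t - (1 - r) ^ 2)) / (2 * Real.pi * t) * t ^ (k + 1) =
      √(((1 + r) ^ 2 - t) * (t - (1 - r) ^ 2)) / (2 * Real.pi) * t ^ k := by
  -- The point `0` belongs to the interval only as its left end point, where the radicand vanishes.
  rcases eq_or_ne t 0 with rfl | h
  · have h1 : (1 - r) ^ 2 = 0 := le_antisymm ht.1 (sq_nonneg _)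
    simp [h1]
  · have := Real.pi_pos.ne'
    field_simp
    ring

lemma integrable_pow_marchenkoPastur {c : ℝ} (hc : 0 ≤ c) (k : ℕ) :
    Integrable (fun t : ℝ => t ^ k) (marchenkoPastur c) := by
  refine Integrable.add_measure ?_ ?_
  · exact (integrable_dirac (by simp)).smul_measure ENNReal.ofReal_ne_top
  · rw [integrable_withDensity_Icc_iff (by fun_prop) fun t ht => marchenkoPastur_density_nonneg ht]
    rcases hc.eq_or_lt with rfl | hc
    · simp
    rcases k with _ | k
    · refine ((integrableOn_marchenkoPastur_density (Real.sqrt_pos.2 hc)).div_const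
        (2 * Real.pi)).congr (ae_of_all _ fun t => ?_)
      simp only [pow_zero, mul_one]
      rw [div_div, mul_comm t]
    · rw [integrableOn_congr_fun (fun t ht => marchenkoPastur_density_mul_pow ht k)
        measurableSet_Icc]
      exact Continuous.integrableOn_Icc (by fun_prop)

lemma integral_marchenkoPastur {c : ℝ} (hc : 0 ≤ c) (k : ℕ) :
    ∫ t, t ^ k ∂(marchenkoPastur c) = max (1 - c) 0 * 0 ^ k +
      ∫ t in ((1 - √c) ^ 2)..((1 + √c) ^ 2),
        √(((1 + √c) ^ 2 - t) * (t - (1 - √c) ^ 2)) / (2 * Real.pi * t) * t ^ k := by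
  have h := integrable_pow_marchenkoPastur hc k
  rw [marchenkoPastur] at h ⊢
  rw [integral_add_measure h.left_of_add_measure h.right_of_add_measure, integral_smul_measure,
    integral_dirac, ENNReal.toReal_ofReal', integral_withDensity_Icc
      (sq_one_sub_le (Real.sqrt_nonneg c)) (by fun_prop)
      fun t ht => marchenkoPastur_density_nonneg ht, smul_eq_mul]

/-- The continuous part has mass `(1 + c - |1 - c|)/2 = min 1 c`; the atom supplies the rest. -/
lemma integral_marchenkoPastur_zero {c : ℝ} (hc : 0 ≤ c) :
    ∫ t, t ^ 0 ∂(marchenkoPastur c) = 1 := by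
  rw [integral_marchenkoPastur hc]
  rcases hc.eq_or_lt with rfl | hc
  · simp
  have h1 : ∀ t, √(((1 + √c) ^ 2 - t) * (t - (1 - √c) ^ 2)) / (2 * Real.pi * t) * t ^ 0 =
      √(((1 + √c) ^ 2 - t) * (t - (1 - √c) ^ 2)) / t / (2 * Real.pi) := by
    intro t
    rw [pow_zero, mul_one, div_div, mul_comm t]
  simp only [h1, intervalIntegral.integral_div,
    integral_marchenkoPastur_density (Real.sqrt_pos.2 hc), Real.sq_sqrt hc.le]
  have := Real.pi_pos.ne'
  rcases le_total c 1 with h | h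
  · rw [abs_of_nonneg (by linarith), max_eq_left (by linarith)]
    field_simp
    ring
  · rw [abs_of_nonpos (by linarith), max_eq_right (by linarith)]
    field_simp
    ring

/-- For `c > 0`, `t` times the density is `c` times the semicircle density with mean `1 + c` and
variance `c`, and the atom at `0` does not contribute. -/
lemma integral_marchenkoPastur_succ {c : ℝ} (hc : 0 ≤ c) (k : ℕ) :
    ∫ t, t ^ (k + 1) ∂(marchenkoPastur c) =
      c * (vacuumState (semicircular (1 + c) (√c) ^ k)).re := by
  rw [integral_marchenkoPastur hc]
  rcases hc.eq_or_lt with rfl | hc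
  · simp
  have hs := Real.sq_sqrt hc.le
  rw [← integral_pow_semicircleLaw _ hc, semicircleLaw, integral_withDensity_Icc
    (by have := Real.sqrt_nonneg c; linarith) (by fun_prop)
    (fun t _ => by have := Real.pi_pos; positivity),
    show 1 + c - 2 * √c = (1 - √c) ^ 2 by linear_combination -hs,
    show 1 + c + 2 * √c = (1 + √c) ^ 2 by linear_combination -hs,
    ← intervalIntegral.integral_const_mul, pow_succ, mul_zero, mul_zero, zero_add]
  refine intervalIntegral.integral_congr fun t ht => ?_
  rw [Set.uIcc_of_le (sq_one_sub_le (Real.sqrt_nonneg c))] at ht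
  rw [marchenkoPastur_density_mul_pow ht, marchenkoPastur_radicand, hs]
  have := Real.pi_pos.ne'
  field_simp

/-- The last term of the free Poisson convolution contains the zeroth moment `1`; joined to the
linear term, it turns the coefficient `c` into the mean `1 + c`. The other terms are the semicircle
convolution. -/
lemma re_vacuumState_freePoisson_pow_succ (b : Bool) {c : ℝ} (hc : 0 ≤ c) (k : ℕ) :
    (vacuumState (freePoisson b (√c) ^ (k + 1))).re =
      c * (vacuumState (semicircular (1 + c) (√c) ^ k)).re := by
  have hs := Real.mul_self_sqrt hc
  induction k using Nat.strong_induction_on with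
  | _ k ih =>
  rw [vacuumState_freePoisson_pow_succ, hs]
  rcases k with _ | k
  · simp
  · rw [vacuumState_semicircular_pow_succ, hs, ih k (by omega), Finset.sum_range_succ,
      ih k (by omega), show k + 1 - 1 - k = 0 by omega, pow_zero]
    have h1 : ∀ j ∈ Finset.range k, (vacuumState (freePoisson b (√c) ^ (j + 1))).re *
        (vacuumState (freePoisson b (√c) ^ (k + 1 - 1 - j))).re =
        c * (c * ((vacuumState (semicircular (1 + c) (√c) ^ j)).re *
          (vacuumState (semicircular (1 + c) (√c) ^ (k - 1 - j))).re)) := by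
      intro j hj
      rw [Finset.mem_range] at hj
      rw [ih j (by omega), show k + 1 - 1 - j = k - 1 - j + 1 by omega, ih _ (by omega)]
      ring
    have h2 : (vacuumState 1).re = 1 := by simp [vacuumState_def, vacuum_nil]
    rw [Finset.sum_congr rfl h1, ← Finset.mul_sum, ← Finset.mul_sum, h2]
    ring

lemma hasDistribution_freePoisson (b : Bool) {c : ℝ} (hc : 0 ≤ c) :
    HasDistribution vacuumState (freePoisson b (√c)) (marchenkoPastur c) := by
  intro k
  refine ⟨integrable_pow_marchenkoPastur hc k, ?_⟩
  rw [vacuumState_eq_re ((isSelfAdjoint_freePoisson b (√c)).pow k)]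
  rcases k with _ | k
  · rw [integral_marchenkoPastur_zero hc]
    simp [vacuumState_def, vacuum_nil]
  · rw [re_vacuumState_freePoisson_pow_succ b hc, integral_marchenkoPastur_succ hc]


/-! ### Free cumulants of the semicircle law -/

section Noncrossing

variable {α : Type*} [LinearOrder α]

/-- A non-crossing partition of `s` into blocks with one or two elements. -/
structure IsNoncrossingMatching (s : Finset α) (P : Finset (Finset α)) : Prop where
  subset : ∀ B ∈ P, B ⊆ s
  cover : ∀ x ∈ s, ∃ B ∈ P, x ∈ B
  disjoint : ∀ B ∈ P, ∀ C ∈ P, ∀ x, x ∈ B → x ∈ C → B = C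
  card : ∀ B ∈ P, B.card = 1 ∨ B.card = 2
  noncrossing : ∀ B ∈ P, ∀ C ∈ P, ∀ i j k l : α,
    i < j → j < k → k < l → i ∈ B → k ∈ B → j ∈ C → l ∈ C → B = C

open Classical in
/-- The set of non-crossing partitions of `s` into blocks with one or two elements. -/
def noncrossingMatchings (s : Finset α) : Finset (Finset (Finset α)) :=
  {P ∈ s.powerset.powerset | IsNoncrossingMatching s P}

lemma mem_noncrossingMatchings {s : Finset α} {P : Finset (Finset α)} :
    P ∈ noncrossingMatchings s ↔ IsNoncrossingMatching s P := by
  simp only [noncrossingMatchings, Finset.mem_filter, Finset.mem_powerset, and_iff_right_iff_imp]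
  exact fun h B hB => Finset.mem_powerset.2 (h.subset B hB)

lemma IsNoncrossingMatching.nonempty {s : Finset α} {P : Finset (Finset α)}
    (h : IsNoncrossingMatching s P) {B : Finset α} (hB : B ∈ P) : B.Nonempty := by
  rw [← Finset.card_pos]
  rcases h.card B hB with h | h <;> omega

lemma IsNoncrossingMatching.insert_singleton {s : Finset α} {x : α} {P : Finset (Finset α)}
    (hx : ∀ y ∈ s, x < y) (h : IsNoncrossingMatching s P) :
    IsNoncrossingMatching (insert x s) (insert {x} P) := by
  have h1 : ∀ B ∈ P, x ∉ B := fun B hB hxB => lt_irrefl x (hx x (h.subset B hB hxB))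
  refine ⟨?_, ?_, ?_, ?_, ?_⟩
  · have := h.subset
    intro B hB y hy
    grind
  · have := h.cover
    intro y hy
    rcases Finset.mem_insert.1 hy with rfl | hy
    · exact ⟨{y}, by simp, by simp⟩
    · obtain ⟨B, hB, hyB⟩ := this y hy
      exact ⟨B, Finset.mem_insert_of_mem hB, hyB⟩
  · have := h.disjoint
    intro B hB C hC y hyB hyC
    grind
  · have := h.card
    intro B hB
    rcases Finset.mem_insert.1 hB with rfl | hB
    · simp
    · exact this B hB
  · have := h.noncrossing
    intro B hB C hC i j k l hij hjk hkl hi hk hj hl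
    rcases Finset.mem_insert.1 hB with rfl | hB <;> rcases Finset.mem_insert.1 hC with rfl | hC
    · rfl
    · simp only [Finset.mem_singleton] at hi hk
      subst hi hk
      exact absurd (hij.trans hjk) (lt_irrefl _)
    · simp only [Finset.mem_singleton] at hj hl
      subst hj hl
      exact absurd (hjk.trans hkl) (lt_irrefl _)
    · exact this B hB C hC i j k l hij hjk hkl hi hk hj hl

lemma IsNoncrossingMatching.erase_singleton {s : Finset α} {x : α} {P : Finset (Finset α)}
    (hx : x ∉ s) (h : IsNoncrossingMatching (insert x s) P) (hP : {x} ∈ P) :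
    IsNoncrossingMatching s (P.erase {x}) := by
  refine ⟨?_, ?_, ?_, ?_, ?_⟩
  · intro B hB y hy
    have h1 := h.subset B (Finset.mem_of_mem_erase hB) hy
    rcases Finset.mem_insert.1 h1 with rfl | h1
    · exact absurd (h.disjoint B (Finset.mem_of_mem_erase hB) {y} hP y hy (by simp))
        (Finset.ne_of_mem_erase hB)
    · exact h1
  · intro y hy
    obtain ⟨B, hB, hyB⟩ := h.cover y (Finset.mem_insert_of_mem hy)
    refine ⟨B, Finset.mem_erase.2 ⟨?_, hB⟩, hyB⟩
    rintro rfl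
    rw [Finset.mem_singleton] at hyB
    exact hx (hyB ▸ hy)
  · exact fun B hB C hC =>
      h.disjoint B (Finset.mem_of_mem_erase hB) C (Finset.mem_of_mem_erase hC)
  · exact fun B hB => h.card B (Finset.mem_of_mem_erase hB)
  · exact fun B hB C hC =>
      h.noncrossing B (Finset.mem_of_mem_erase hB) C (Finset.mem_of_mem_erase hC)

lemma IsNoncrossingMatching.insert_pair {s : Finset α} {x l : α} {P Q : Finset (Finset α)}
    (hx : ∀ y ∈ s, x < y) (hl : l ∈ s) (hP : IsNoncrossingMatching {y ∈ s | y < l} P)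
    (hQ : IsNoncrossingMatching {y ∈ s | l < y} Q) :
    IsNoncrossingMatching (insert x s) (insert {x, l} (P ∪ Q)) := by
  have hxl := hx l hl
  have hP1 : ∀ B ∈ P, ∀ y ∈ B, y ∈ s ∧ x < y ∧ y < l := fun B hB y hy => by
    have := Finset.mem_filter.1 (hP.subset B hB hy)
    exact ⟨this.1, hx y this.1, this.2⟩
  have hQ1 : ∀ B ∈ Q, ∀ y ∈ B, y ∈ s ∧ x < y ∧ l < y := fun B hB y hy => by
    have := Finset.mem_filter.1 (hQ.subset B hB hy)
    exact ⟨this.1, hx y this.1, this.2⟩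
  have hmem : ∀ B, B ∈ insert {x, l} (P ∪ Q) ↔ B = {x, l} ∨ B ∈ P ∨ B ∈ Q := fun B => by
    rw [Finset.mem_insert, Finset.mem_union]
  have hpair : ∀ y, y ∈ ({x, l} : Finset α) ↔ y = x ∨ y = l := fun y => by simp
  refine ⟨?_, ?_, ?_, ?_, ?_⟩
  · intro B hB y hy
    rcases (hmem B).1 hB with rfl | hB | hB
    · rcases (hpair y).1 hy with rfl | rfl
      · simp
      · exact Finset.mem_insert_of_mem hl
    · exact Finset.mem_insert_of_mem (hP1 B hB y hy).1
    · exact Finset.mem_insert_of_mem (hQ1 B hB y hy).1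
  · intro y hy
    rcases Finset.mem_insert.1 hy with rfl | hy
    · exact ⟨{y, l}, by simp, by simp⟩
    rcases lt_trichotomy y l with h | rfl | h
    · obtain ⟨B, hB, hyB⟩ := hP.cover y (Finset.mem_filter.2 ⟨hy, h⟩)
      exact ⟨B, (hmem B).2 (Or.inr (Or.inl hB)), hyB⟩
    · exact ⟨{x, y}, by simp, by simp⟩
    · obtain ⟨B, hB, hyB⟩ := hQ.cover y (Finset.mem_filter.2 ⟨hy, h⟩)
      exact ⟨B, (hmem B).2 (Or.inr (Or.inr hB)), hyB⟩
  · intro B hB C hC y hyB hyC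
    have h1 := hP.disjoint
    have h2 := hQ.disjoint
    rcases (hmem B).1 hB with rfl | hB | hB <;> rcases (hmem C).1 hC with rfl | hC | hC <;> grind
  · intro B hB
    rcases (hmem B).1 hB with rfl | hB | hB
    · exact Or.inr (Finset.card_pair hxl.ne)
    · exact hP.card B hB
    · exact hQ.card B hB
  · intro B hB C hC i j k m hij hjk hkm hi hk hj hm
    have h1 := hP.noncrossing
    have h2 := hQ.noncrossing
    rcases (hmem B).1 hB with rfl | hB | hB <;> rcases (hmem C).1 hC with rfl | hC | hC
    · rfl
    · have := hP1 C hC m hm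
      rcases (hpair k).1 hk with rfl | rfl <;> rcases (hpair i).1 hi with rfl | rfl <;> grind
    · have := hQ1 C hC j hj
      rcases (hpair k).1 hk with rfl | rfl <;> rcases (hpair i).1 hi with rfl | rfl <;> grind
    · have := hP1 B hB i hi
      rcases (hpair j).1 hj with rfl | rfl <;> rcases (hpair m).1 hm with rfl | rfl <;> grind
    · exact h1 B hB C hC i j k m hij hjk hkm hi hk hj hm
    · exact absurd hjk ((hP1 B hB k hk).2.2.trans (hQ1 C hC j hj).2.2).not_gt
    · have := hQ1 B hB i hi
      rcases (hpair j).1 hj with rfl | rfl <;> rcases (hpair m).1 hm with rfl | rfl <;> grind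
    · exact absurd hij ((hP1 C hC j hj).2.2.trans (hQ1 B hB i hi).2.2).not_gt
    · exact h2 B hB C hC i j k m hij hjk hkm hi hk hj hm

lemma IsNoncrossingMatching.restrict {s t : Finset α} {P : Finset (Finset α)} (ht : t ⊆ s)
    (h : IsNoncrossingMatching s P) (hP : ∀ B ∈ P, ∀ y ∈ B, y ∈ t → B ⊆ t) :
    IsNoncrossingMatching t {B ∈ P | B ⊆ t} := by
  refine ⟨fun B hB => (Finset.mem_filter.1 hB).2, fun y hy => ?_, fun B hB C hC => ?_,
    fun B hB => h.card B (Finset.mem_filter.1 hB).1, fun B hB C hC => ?_⟩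
  · obtain ⟨B, hB, hyB⟩ := h.cover y (ht hy)
    exact ⟨B, Finset.mem_filter.2 ⟨hB, hP B hB y hyB hy⟩, hyB⟩
  · exact h.disjoint B (Finset.mem_filter.1 hB).1 C (Finset.mem_filter.1 hC).1
  · exact h.noncrossing B (Finset.mem_filter.1 hB).1 C (Finset.mem_filter.1 hC).1

/-- A block with elements `i < l` and `k > l` would cross the pair, as `x < i < l < k`. -/
lemma IsNoncrossingMatching.eq_or_subset {s : Finset α} {x l : α} {P : Finset (Finset α)}
    (hx : ∀ y ∈ s, x < y) (h : IsNoncrossingMatching (insert x s) P) (hP : {x, l} ∈ P)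
    {B : Finset α} (hB : B ∈ P) :
    B = {x, l} ∨ B ⊆ {y ∈ s | y < l} ∨ B ⊆ {y ∈ s | l < y} := by
  by_contra! hne
  obtain ⟨h0, h1, h2⟩ := hne
  have hxB : ∀ y ∈ B, y ∈ s ∧ y ≠ l := by
    intro y hy
    constructor
    · rcases Finset.mem_insert.1 (h.subset B hB hy) with rfl | h3
      · exact absurd (h.disjoint B hB _ hP y hy (by simp)) h0
      · exact h3
    · rintro rfl
      exact h0 (h.disjoint B hB _ hP y hy (by simp))
  obtain ⟨k, hk, hkl⟩ := Finset.not_subset.1 h1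
  obtain ⟨i, hi, hil⟩ := Finset.not_subset.1 h2
  simp only [Finset.mem_filter, (hxB k hk).1, (hxB i hi).1, true_and, not_lt] at hkl hil
  exact h0 (h.noncrossing {x, l} hP B hB x i l k (hx i (hxB i hi).1)
    (lt_of_le_of_ne hil (hxB i hi).2) (lt_of_le_of_ne hkl (hxB k hk).2.symm)
    (by simp) (by simp) hi hk).symm

/-- The block of the least element `x` is a singleton or a pair `{x, l}`, and such a pair separates
the elements below `l` from those above it. -/
lemma noncrossingMatchings_insert {s : Finset α} {x : α} (hx : ∀ y ∈ s, x < y) :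
    noncrossingMatchings (insert x s) = (noncrossingMatchings s).image (insert {x}) ∪
      s.biUnion fun l =>
        (noncrossingMatchings {y ∈ s | y < l} ×ˢ noncrossingMatchings {y ∈ s | l < y}).image
          fun p => insert {x, l} (p.1 ∪ p.2) := by
  have hxs : x ∉ s := fun h => lt_irrefl x (hx x h)
  ext P
  simp only [Finset.mem_union, Finset.mem_image, Finset.mem_biUnion, Finset.mem_product,
    mem_noncrossingMatchings, Prod.exists]
  constructor
  · intro h
    obtain ⟨B, hB, hxB⟩ := h.cover x (Finset.mem_insert_self x s)
    rcases h.card B hB with h1 | h1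
    · obtain ⟨y, rfl⟩ := Finset.card_eq_one.1 h1
      rw [Finset.mem_singleton] at hxB
      subst hxB
      exact Or.inl ⟨_, h.erase_singleton hxs hB, Finset.insert_erase hB⟩
    · obtain ⟨l, hl⟩ : ∃ l, B.erase x = {l} := by
        rw [← Finset.card_eq_one, Finset.card_erase_of_mem hxB, h1]
      have hBl : B = {x, l} := by rw [← Finset.insert_erase hxB, hl]
      have hlx : l ≠ x := by
        have : l ∈ B.erase x := by rw [hl]; simp
        exact Finset.ne_of_mem_erase this
      subst hBl
      have hls : l ∈ s := by
        have := h.subset _ hB (show l ∈ ({x, l} : Finset α) by simp)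
        exact (Finset.mem_insert.1 this).resolve_left hlx
      have hxl := hx l hls
      have key := fun C hC => h.eq_or_subset hx hB (B := C) hC
      refine Or.inr ⟨l, hls, {B ∈ P | B ⊆ {y ∈ s | y < l}}, {B ∈ P | B ⊆ {y ∈ s | l < y}},
        ⟨h.restrict ?_ ?_, h.restrict ?_ ?_⟩, ?_⟩
      · exact (Finset.filter_subset _ _).trans (Finset.subset_insert _ _)
      · intro C hC y hy hyt
        have hyt := Finset.mem_filter.1 hyt
        rcases key C hC with rfl | h3 | h3
        · simp only [Finset.mem_insert, Finset.mem_singleton] at hy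
          rcases hy with rfl | rfl
          · exact absurd hyt.1 hxs
          · exact absurd hyt.2 (lt_irrefl _)
        · exact h3
        · exact absurd hyt.2 (Finset.mem_filter.1 (h3 hy)).2.not_gt
      · exact (Finset.filter_subset _ _).trans (Finset.subset_insert _ _)
      · intro C hC y hy hyt
        have hyt := Finset.mem_filter.1 hyt
        rcases key C hC with rfl | h3 | h3
        · simp only [Finset.mem_insert, Finset.mem_singleton] at hy
          rcases hy with rfl | rfl
          · exact absurd hyt.1 hxs
          · exact absurd hyt.2 (lt_irrefl _)
        · exact absurd hyt.2 (Finset.mem_filter.1 (h3 hy)).2.not_gt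
        · exact h3
      · ext C
        simp only [Finset.mem_insert, Finset.mem_union, Finset.mem_filter]
        constructor
        · rintro (rfl | h3 | h3)
          · exact hB
          · exact h3.1
          · exact h3.1
        · intro hC
          rcases key C hC with h3 | h3 | h3
          · exact Or.inl h3
          · exact Or.inr (Or.inl ⟨hC, h3⟩)
          · exact Or.inr (Or.inr ⟨hC, h3⟩)
  · rintro (⟨Q, hQ, rfl⟩ | ⟨l, hl, Q, R, ⟨hQ, hR⟩, rfl⟩)
    · exact hQ.insert_singleton hx
    · exact hQ.insert_pair hx hl hR

/-- The number of non-crossing partitions of `s` into blocks with one or two elements, weighted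
by `c` to the number of blocks. -/
def noncrossingWeight (c : ℝ) (s : Finset α) : ℝ :=
  ∑ P ∈ noncrossingMatchings s, c ^ P.card

lemma noncrossingWeight_empty (c : ℝ) : noncrossingWeight c (∅ : Finset α) = 1 := by
  have h : noncrossingMatchings (∅ : Finset α) = {∅} := by
    ext P
    rw [mem_noncrossingMatchings, Finset.mem_singleton]
    constructor
    · intro h
      refine Finset.eq_empty_of_forall_notMem fun B hB => ?_
      have h1 := h.nonempty hB
      rw [Finset.subset_empty.1 (h.subset B hB)] at h1
      exact Finset.not_nonempty_empty h1
    · rintro rfl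
      constructor <;> simp
  simp [noncrossingWeight, h]

lemma noncrossingWeight_insert (c : ℝ) {s : Finset α} {x : α} (hx : ∀ y ∈ s, x < y) :
    noncrossingWeight c (insert x s) = c * noncrossingWeight c s +
      c * ∑ l ∈ s, noncrossingWeight c {y ∈ s | y < l} * noncrossingWeight c {y ∈ s | l < y} := by
  have hxs : ∀ {P : Finset (Finset α)} {t : Finset α}, t ⊆ s → IsNoncrossingMatching t P →
      ∀ B ∈ P, x ∉ B := fun ht h B hB hxB => lt_irrefl x (hx x (ht (h.subset B hB hxB)))
  have hpair : ∀ (l : α) (P Q : Finset (Finset α)), IsNoncrossingMatching {y ∈ s | y < l} P →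
      IsNoncrossingMatching {y ∈ s | l < y} Q → ∀ B ∈ insert {x, l} (P ∪ Q), x ∈ B →
        B = {x, l} := by
    intro l P Q hP hQ B hB hxB
    rcases Finset.mem_insert.1 hB with h | h
    · exact h
    rcases Finset.mem_union.1 h with h | h
    · exact absurd hxB (hxs (Finset.filter_subset _ _) hP B h)
    · exact absurd hxB (hxs (Finset.filter_subset _ _) hQ B h)
  rw [noncrossingWeight, noncrossingMatchings_insert hx, Finset.sum_union, Finset.sum_biUnion,
    Finset.mul_sum]
  · congr 1
    · rw [Finset.sum_image, noncrossingWeight, Finset.mul_sum]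
      · refine Finset.sum_congr rfl fun P hP => ?_
        rw [Finset.card_insert_of_notMem fun h => hxs subset_rfl (mem_noncrossingMatchings.1 hP) _ h
          (Finset.mem_singleton_self x), pow_succ']
      · intro P hP Q hQ hPQ
        have hP1 := hxs subset_rfl (mem_noncrossingMatchings.1 hP)
        have hQ1 := hxs subset_rfl (mem_noncrossingMatchings.1 hQ)
        rw [← Finset.erase_insert fun h => hP1 {x} h (Finset.mem_singleton_self x), hPQ,
          Finset.erase_insert fun h => hQ1 {x} h (Finset.mem_singleton_self x)]
    · refine Finset.sum_congr rfl fun l hl => ?_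
      -- `P` and `Q` can be recovered from the matching they form with `{x, l}`, which gives
      -- injectivity, and the three pieces are disjoint, which gives the block count.
      have hsplit : ∀ P Q : Finset (Finset α), IsNoncrossingMatching {y ∈ s | y < l} P →
          IsNoncrossingMatching {y ∈ s | l < y} Q →
          P = {B ∈ insert {x, l} (P ∪ Q) | ∀ y ∈ B, y < l} ∧
            Q = {B ∈ insert {x, l} (P ∪ Q) | ∀ y ∈ B, x < y ∧ l < y} ∧
            Disjoint P Q ∧ {x, l} ∉ P ∪ Q := by
        intro P Q hP hQ
        have hP1 : ∀ B ∈ P, ∀ y ∈ B, x < y ∧ y < l := fun B hB y hy => by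
          have := Finset.mem_filter.1 (hP.subset B hB hy)
          exact ⟨hx y this.1, this.2⟩
        have hQ1 : ∀ B ∈ Q, ∀ y ∈ B, x < y ∧ l < y := fun B hB y hy => by
          have := Finset.mem_filter.1 (hQ.subset B hB hy)
          exact ⟨hx y this.1, this.2⟩
        have hP2 : ∀ B ∈ P, ¬ ∀ y ∈ B, x < y ∧ l < y := fun B hB h => by
          obtain ⟨y, hy⟩ := hP.nonempty hB
          exact (h y hy).2.not_gt (hP1 B hB y hy).2
        have hQ2 : ∀ B ∈ Q, ¬ ∀ y ∈ B, y < l := fun B hB h => by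
          obtain ⟨y, hy⟩ := hQ.nonempty hB
          exact (h y hy).not_gt (hQ1 B hB y hy).2
        refine ⟨?_, ?_, Finset.disjoint_left.2 fun B hB hB' => hP2 B hB (hQ1 B hB'), ?_⟩
        · ext B
          simp only [Finset.mem_filter, Finset.mem_insert, Finset.mem_union]
          constructor
          · exact fun hB => ⟨Or.inr (Or.inl hB), fun y hy => (hP1 B hB y hy).2⟩
          · rintro ⟨rfl | hB | hB, h⟩
            · exact absurd (h l (by simp)) (lt_irrefl l)
            · exact hB
            · exact absurd h (hQ2 B hB)
        · ext B
          simp only [Finset.mem_filter, Finset.mem_insert, Finset.mem_union]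
          constructor
          · exact fun hB => ⟨Or.inr (Or.inr hB), hQ1 B hB⟩
          · rintro ⟨rfl | hB | hB, h⟩
            · exact absurd (h x (by simp)).1 (lt_irrefl x)
            · exact absurd h (hP2 B hB)
            · exact hB
        · intro h
          rcases Finset.mem_union.1 h with h | h
          · exact lt_irrefl x (hP1 _ h x (by simp)).1
          · exact lt_irrefl x (hQ1 _ h x (by simp)).1
      rw [Finset.sum_image, Finset.sum_product, noncrossingWeight, noncrossingWeight,
        Finset.sum_mul_sum, Finset.mul_sum]
      · refine Finset.sum_congr rfl fun P hP => ?_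
        rw [Finset.mul_sum]
        refine Finset.sum_congr rfl fun Q hQ => ?_
        obtain ⟨-, -, h1, h2⟩ :=
          hsplit P Q (mem_noncrossingMatchings.1 hP) (mem_noncrossingMatchings.1 hQ)
        rw [Finset.card_insert_of_notMem h2, Finset.card_union_of_disjoint h1]
        ring
      · rintro ⟨P, Q⟩ hPQ ⟨P', Q'⟩ hPQ' heq
        simp only [Finset.coe_product, Set.mem_prod, Finset.mem_coe,
          mem_noncrossingMatchings] at hPQ hPQ' heq
        obtain ⟨h1, h2, -⟩ := hsplit P Q hPQ.1 hPQ.2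
        obtain ⟨h1', h2', -⟩ := hsplit P' Q' hPQ'.1 hPQ'.2
        rw [heq] at h1 h2
        rw [Prod.mk.injEq]
        exact ⟨h1.trans h1'.symm, h2.trans h2'.symm⟩
  · intro l hl l' hl' hne
    refine Finset.disjoint_left.2 fun R hR hR' => hne ?_
    simp only [Finset.mem_image, Finset.mem_product, mem_noncrossingMatchings,
      Prod.exists] at hR hR'
    obtain ⟨P, Q, ⟨hP, hQ⟩, rfl⟩ := hR
    obtain ⟨P', Q', ⟨hP', hQ'⟩, heq⟩ := hR'
    have h1 := hpair l P Q hP hQ {x, l'} (by rw [← heq]; simp) (by simp)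
    have h2 : l' ∈ ({x, l} : Finset α) := by rw [← h1]; simp
    simp only [Finset.mem_insert, Finset.mem_singleton] at h2
    exact (h2.resolve_left (hx l' hl').ne').symm
  · refine Finset.disjoint_left.2 fun R hR hR' => ?_
    simp only [Finset.mem_image, Finset.mem_biUnion, Finset.mem_product, mem_noncrossingMatchings,
      Prod.exists] at hR hR'
    obtain ⟨P, hP, rfl⟩ := hR
    obtain ⟨l, hl, P', Q', ⟨hP', hQ'⟩, heq⟩ := hR'
    have h1 := hpair l P' Q' hP' hQ' {x} (by rw [heq]; simp) (by simp)
    have h2 : l ∈ ({x} : Finset α) := by rw [h1]; simp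
    exact (hx l hl).ne' (Finset.mem_singleton.1 h2)

/-- The rank of `l` in `s` takes each value below `s.card` once. This converts sums over the partner
of the least element into sums over `range`. -/
lemma sum_card_filter_lt (f : ℕ → ℝ) (s : Finset α) :
    ∑ l ∈ s, f (Finset.card {y ∈ s | y < l}) = ∑ j ∈ Finset.range s.card, f j := by
  induction s using Finset.induction_on_max with
  | empty => simp
  | insert m s hm ih =>
    have hms : m ∉ s := fun h => lt_irrefl m (hm m h)
    rw [Finset.sum_insert hms, Finset.card_insert_of_notMem hms, Finset.sum_range_succ, ← ih,
      add_comm, Finset.filter_insert, if_neg (lt_irrefl m), Finset.filter_true_of_mem hm]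
    congr 1
    refine Finset.sum_congr rfl fun l hl => ?_
    rw [Finset.filter_insert, if_neg (hm l hl).not_gt]

lemma card_filter_gt {s : Finset α} {l : α} (hl : l ∈ s) :
    Finset.card {y ∈ s | l < y} = s.card - 1 - Finset.card {y ∈ s | y < l} := by
  have h1 := Finset.card_filter_add_card_filter_not (s := s) (fun y => l < y)
  have h2 : {y ∈ s | ¬ l < y} = insert l {y ∈ s | y < l} := by
    ext y
    simp only [Finset.mem_filter, Finset.mem_insert, not_lt, le_iff_lt_or_eq]
    grind
  rw [h2, Finset.card_insert_of_notMem (by simp)] at h1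
  omega

lemma noncrossingWeight_eq {c : ℝ} {M : ℕ → ℝ} (hM0 : M 0 = 1)
    (hM : ∀ n, M (n + 1) = c * M n + c * ∑ j ∈ Finset.range n, M j * M (n - 1 - j)) (n : ℕ)
    (s : Finset α) (hs : s.card = n) : noncrossingWeight c s = M n := by
  induction n using Nat.strong_induction_on generalizing s with
  | _ n ih =>
  rcases n with _ | n
  · rw [Finset.card_eq_zero.1 hs, noncrossingWeight_empty, hM0]
  · have hne : s.Nonempty := Finset.card_pos.1 (by omega)
    set x := s.min' hne
    have hx : ∀ y ∈ s.erase x, x < y := fun y hy => Finset.min'_lt_of_mem_erase_min' s hne hy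
    have hc : (s.erase x).card = n := by
      rw [Finset.card_erase_of_mem (Finset.min'_mem s hne), hs, Nat.add_sub_cancel]
    rw [← Finset.insert_erase (Finset.min'_mem s hne), noncrossingWeight_insert c hx,
      ih n (by omega) _ hc, hM, ← hc, ← sum_card_filter_lt fun j => M j * M ((s.erase x).card - 1 - j)]
    congr 2
    refine Finset.sum_congr rfl fun l hl => ?_
    have h1 : Finset.card {y ∈ s.erase x | y < l} < (s.erase x).card :=
      Finset.card_lt_card (Finset.filter_ssubset.2 ⟨l, hl, lt_irrefl l⟩)
    have h2 := card_filter_gt hl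
    rw [ih _ (by omega) _ rfl, ih _ (by omega) _ h2]

end Noncrossing

open Classical in
-- A block of any other size makes the product vanish, and the remaining partitions contribute a
-- factor `c` for each block.
lemma sum_noncrossing_eq_noncrossingWeight (c : ℝ) (n : ℕ) :
    ∑ π : Finpartition (Finset.univ : Finset (Fin n)) with IsNoncrossing π,
      ∏ B ∈ π.parts, (if B.card = 1 ∨ B.card = 2 then c else 0) =
    noncrossingWeight c (Finset.univ : Finset (Fin n)) := by
  rw [← Finset.sum_filter_of_ne (p := fun π => ∀ B ∈ π.parts, B.card = 1 ∨ B.card = 2)]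
  · refine Finset.sum_bij (fun π _ => π.parts) ?_ ?_ ?_ ?_
    · intro π hπ
      simp only [Finset.mem_filter, Finset.mem_univ, true_and] at hπ
      refine mem_noncrossingMatchings.2 ⟨fun B _ => Finset.subset_univ B, fun x hx => ?_,
        fun B hB C hC x hxB hxC => ?_, hπ.2, hπ.1⟩
      · exact π.exists_mem hx
      · exact π.eq_of_mem_parts hB hC hxB hxC
    · exact fun π _ π' _ h => Finpartition.ext h
    · intro P hP
      have hP := mem_noncrossingMatchings.1 hP
      refine ⟨⟨P, ?_, ?_, ?_⟩, ?_, rfl⟩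
      · rw [Finset.supIndep_iff_pairwiseDisjoint]
        intro B hB C hC hne
        exact Finset.disjoint_left.2 fun x hxB hxC => hne (hP.disjoint B hB C hC x hxB hxC)
      · refine Finset.eq_univ_of_forall fun x => ?_
        obtain ⟨B, hB, hx⟩ := hP.cover x (Finset.mem_univ x)
        exact Finset.mem_sup.2 ⟨B, hB, hx⟩
      · intro h
        exact Finset.not_nonempty_empty (hP.nonempty h)
      · simp only [Finset.mem_filter, Finset.mem_univ, true_and]
        exact ⟨hP.noncrossing, hP.card⟩
    · intro π hπ
      simp only [Finset.mem_filter, Finset.mem_univ, true_and] at hπ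
      rw [Finset.prod_congr rfl fun B hB => if_pos (hπ.2 B hB), Finset.prod_const]
  · intro π _ hne B hB
    by_contra h
    exact hne (Finset.prod_eq_zero hB (if_neg h))


/-! ### The limit laws -/

lemma integral_pow_semicircleLaw_zero {c : ℝ} (hc : 0 < c) :
    ∫ t, t ^ 0 ∂(semicircleLaw c c) = 1 := by
  rw [integral_pow_semicircleLaw c hc]
  simp [vacuumState_def, vacuum_nil]

lemma integral_pow_semicircleLaw_succ {c : ℝ} (hc : 0 < c) (n : ℕ) :
    ∫ t, t ^ (n + 1) ∂(semicircleLaw c c) = c * ∫ t, t ^ n ∂(semicircleLaw c c) +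
      c * ∑ j ∈ Finset.range n, (∫ t, t ^ j ∂(semicircleLaw c c)) *
        ∫ t, t ^ (n - 1 - j) ∂(semicircleLaw c c) := by
  simp only [integral_pow_semicircleLaw c hc]
  rw [vacuumState_semicircular_pow_succ, Real.mul_self_sqrt hc.le]

lemma isFreeCumulants_semicircleLaw {c : ℝ} (hc : 0 < c) :
    IsFreeCumulants (fun k => ∫ t, t ^ k ∂(semicircleLaw c c))
      (fun k => if k = 1 ∨ k = 2 then c else 0) := fun n => by
  rw [sum_noncrossing_eq_noncrossingWeight, noncrossingWeight_eq
    (M := fun k => ∫ t, t ^ k ∂(semicircleLaw c c)) (integral_pow_semicircleLaw_zero hc)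
    (integral_pow_semicircleLaw_succ hc) n _ (by simp)]

/-- The difference of the free Poisson elements with rates `c D (D + 1) / 2` and
`c D (D - 1) / 2`. -/
def freePoissonDifference (c : ℝ) (D : ℕ) : FockSpace →L[ℂ] FockSpace :=
  freePoisson true (√(c * D * ((D + 1) / 2))) - freePoisson false (√(c * D * ((D - 1) / 2)))

lemma rate_nonneg {c : ℝ} (hc : 0 < c) {D : ℕ} (hD : 0 < D) :
    0 ≤ c * D * ((D + 1) / 2 : ℝ) ∧ 0 ≤ c * D * ((D - 1) / 2 : ℝ) := by
  have h1 : (1 : ℝ) ≤ D := by exact_mod_cast hD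
  exact ⟨by positivity, mul_nonneg (by positivity) (by linarith)⟩

lemma exists_recursion_freePoissonDifference {c : ℝ} (hc : 0 < c) {D : ℕ} (hD : 0 < D) :
    ∃ m α β : ℕ → ℝ, (m = fun n => (vacuumState (freePoissonDifference c D ^ n)).re) ∧ m 0 = 1 ∧
      (∀ n, α n = (c * D) * m n + ∑ j ∈ Finset.range n, β j * m (n - 1 - j)) ∧
      (∀ n, β n = ∑ j ∈ Finset.range n, α j * m (n - 1 - j)) ∧
      (∀ n, m (n + 1) = α n + D * β n) := by
  obtain ⟨h1, h2⟩ := rate_nonneg hc hD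
  obtain ⟨X, Y, hX, hY, hm⟩ := vacuumState_difference (√(c * D * ((D + 1) / 2)))
    (√(c * D * ((D - 1) / 2)))
  simp only [Real.mul_self_sqrt h1] at hX
  simp only [Real.mul_self_sqrt h2] at hY
  obtain ⟨α, β, hα, hβ, hm'⟩ := exists_block_recursion hX hY hm
  exact ⟨_, α, β, rfl, by simp [vacuumState_def, vacuum_nil], hα, hβ, hm'⟩

lemma blockMoment_eq_re {c : ℝ} (hc : 0 < c) {D : ℕ} (hD : 0 < D) (n : ℕ) :
    blockMoment (c * D) D n = (vacuumState (freePoissonDifference c D ^ n)).re := by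
  obtain ⟨m, α, β, rfl, h0, hα, hβ, hm⟩ := exists_recursion_freePoissonDifference hc hD
  exact blockMoment_eq hD h0 hα hβ hm n

lemma isFreeDifferenceMoments_blockMoment {c : ℝ} (hc : 0 < c) {D : ℕ} (hD : 0 < D) :
    IsFreeDifferenceMoments (marchenkoPastur (c * D * ((D + 1) / 2)))
      (marchenkoPastur (c * D * ((D - 1) / 2))) (blockMoment (c * D) D) := by
  refine ⟨FockSpace →L[ℂ] FockSpace, inferInstance, inferInstance, inferInstance, inferInstance,
    vacuumState, freePoisson true (√(c * D * ((D + 1) / 2))),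
    freePoisson false (√(c * D * ((D - 1) / 2))), isState_vacuumState,
    isSelfAdjoint_freePoisson _ _, isSelfAdjoint_freePoisson _ _, areFree_freePoisson _ _,
    hasDistribution_freePoisson _ (rate_nonneg hc hD).1,
    hasDistribution_freePoisson _ (rate_nonneg hc hD).2, fun k => ?_⟩
  rw [blockMoment_eq_re hc hD]
  exact vacuumState_eq_re
    (((isSelfAdjoint_freePoisson _ _).sub (isSelfAdjoint_freePoisson _ _)).pow k)

lemma tendsto_blockMoment_semicircleLaw {c : ℝ} (hc : 0 < c) (n : ℕ) :
    Tendsto (fun D : ℕ => blockMoment (c * D) D n / (D : ℝ) ^ n) atTop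
      (𝓝 (∫ t, t ^ n ∂(semicircleLaw c c))) := by
  refine tendsto_blockMoment_div_pow (M := fun k => ∫ t, t ^ k ∂(semicircleLaw c c))
    (integral_pow_semicircleLaw_zero hc) (integral_pow_semicircleLaw_succ hc) (fun D hD => ?_) n
  obtain ⟨m, α, β, -, h⟩ := exists_recursion_freePoissonDifference hc hD
  exact ⟨m, α, β, h⟩

end

theorem mainTheorem7 {Ω : ℕ → Type*} [∀ N, MeasurableSpace (Ω N)]
    (P : ∀ N, Measure (Ω N)) [∀ N, IsProbabilityMeasure (P N)]
    (d₁ d₂ p : ℕ → ℕ)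
    (G : ∀ N, Ω N → Fin (d₁ N) → Matrix (Fin (d₂ N)) (Fin (p N)) ℝ)
    (hG : ∀ N, IsStandardGaussianBlocks (P N) (G N))
    (c : ℝ) (hc : 0 < c)
    (hp : Tendsto (fun N => (p N : ℝ) / ((d₁ N : ℝ) * (d₂ N : ℝ))) atTop (𝓝 c)) :
    (Tendsto d₁ atTop atTop → Tendsto d₂ atTop atTop →
      HasAsymptoticMoments P (fun N ω => partialTranspose (wishart (G N ω)))
        (fun k => ∫ t, t ^ k ∂(semicircleLaw c c)) ∧
      IsFreeCumulants (fun k => ∫ t, t ^ k ∂(semicircleLaw c c))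
        (fun k => if k = 1 ∨ k = 2 then c else 0)) ∧
    (∀ D : ℕ, 2 ≤ D → Tendsto d₁ atTop atTop → (∀ N, d₂ N = D) →
      ∃ m : ℕ → ℝ,
        HasAsymptoticMoments P (fun N ω => (D : ℝ) • partialTranspose (wishart (G N ω))) m ∧
        IsFreeDifferenceMoments (marchenkoPastur (c * D * ((D + 1) / 2)))
          (marchenkoPastur (c * D * ((D - 1) / 2))) m) ∧
    (∀ D : ℕ, 1 ≤ D → (∀ N, d₁ N = D) → Tendsto d₂ atTop atTop →
      ∃ m : ℕ → ℝ,
        HasAsymptoticMoments P (fun N ω => (D : ℝ) • partialTranspose (wishart (G N ω))) m ∧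
        IsFreeDifferenceMoments (marchenkoPastur (c * D * ((D + 1) / 2)))
          (marchenkoPastur (c * D * ((D - 1) / 2))) m) := by
  refine ⟨fun h₁ h₂ => ⟨hasAsymptoticMoments_of_tendsto_atTop hG hc hp h₁ h₂
    (tendsto_blockMoment_semicircleLaw hc), isFreeCumulants_semicircleLaw hc⟩,
    fun D hD h₁ h₂ => ⟨_, hasAsymptoticMoments_of_right_fixed hG hp (by omega) h₁ h₂,
      isFreeDifferenceMoments_blockMoment hc (by omega)⟩,
    fun D hD h₁ h₂ => ⟨_, hasAsymptoticMoments_of_left_fixed hG hp hD h₁ h₂,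
      isFreeDifferenceMoments_blockMoment hc hD⟩⟩
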